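/- **Setting.** Let $\Omega\subset\mathbb R^d$ ($d\ge 1$) be a bounded domain (for instance $d=2,3$ and $\Omega$ convex polygonal or with $C^{1,1}$ boundary), $\varepsilon,T>0$, and let $f:\mathbb R\to\mathbb R$ be differentiable with $|f'|<L$ everywhere. Write $(\cdot,\cdot)$ and $\|\cdot\|$ for the inner product and norm of $L^2(\Omega)$. Let $u\in H^1(0,T;H^1_0(\Omega))$ be a weak solution of the Allen–Cahn equation $u_t-\varepsilon\Delta u+\frac1\varepsilon f(u)=0$, that is $$\int_0^T (u_t,v_t)+\varepsilon(\nabla u,\nabla v_t)+\tfrac1\varepsilon(f(u),v_t)\,dt=0\qquad\text{for all } v\in H^1(0,T;H_0^1(\Omega)) \text{ with } v(0)=u(0).$$ *Projections.* $P_M^0(\Omega)$ is the space of polynomials of degree at most $M$ on $\Omega$ that vanish on $\partial\Omega$, and $\Pi_M^0:H_0^1(\Omega)\to P_M^0(\Omega)$ is the projection given by $(\nabla(\Pi_M^0w-w),\nabla v)=0$ for all $v\in P_M^0(\Omega)$. Let $N\ge1$, $K\ge 1$, $\tau=T/K$, $t_n=n\tau$, $I_n=[t_{n-1},t_n]$,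 and $\|w\|_n^2=\int_{I_n}\|w(t)\|^2dt$. The operator $\Pi_N^n$ maps a function $w$ of time to the polynomial in $t$ of degree at most $N$ that agrees with $w$ at $t_{n-1}$ and $t_n$ and satisfies $\int_{I_n}(w-\Pi_N^nw)'q'\,dt=0$ for all scalar polynomials $q$ of degree at most $N$ with $q(t_{n-1})=q(t_n)=0$. Put $\Pi^n u=\Pi_N^n\Pi_M^0u$. *Implicit ESET scheme.* The functions $h^1,\dots,h^K$ are such that $h^n$ lies in $P_M^0(\Omega)\otimes P_N(I_n)$ and starts at $h^n(t_{n-1})=u^{n-1}$, where $u^0=\Pi_M^0u(0)$ and $u^m=h^m(t_m)$ for $m\ge1$, and $$\int_{t_{n-1}}^{t_n}(h^n_t,v_t)+\varepsilon(\nabla h^n,\nabla v_t)+\tfrac1\varepsilon(f(h^n),v_t)\,dt=0\qquad\text{for all } v\in P_M^0(\Omega)\otimes P_N(I_n)\text{ with } v(t_{n-1})=u^{n-1}.$$ Let $\rho^n=h^n-\Pi^nu$, $D_\tau=\frac{\varepsilon}{4L}-\frac{8\tau^2L}{\varepsilon}$, $D_2=\frac{8L}{\varepsilon}$, and $$E_p^n(\tau)=6\|\partial_t(\Pi_M^0-I)\Pi_N^nu\|_n^2+6\varepsilon^2\|\Delta(\Pi_N^n-I)\Pi_M^0u\|_n^2+\tfrac{6L^2}{\varepsilon^2}\|\Pi^nu-u\|_n^2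 .$$ **Theorem 3.** (i) If $\tau\le\frac{\varepsilon}{4\sqrt2L}$, then for every $n=1,\dots,K$ $$\|\rho^n(t_n)\|^2+\frac{\varepsilon^2}{2L}\|\nabla\rho^n(t_n)\|^2+\sum_{k=1}^nD_\tau\|\rho_t^k\|_k^2\;\le\;\frac{\varepsilon}{L}\sum_{k=1}^ne^{D_2(n-k)\tau}E_p^k(\tau).$$ In particular, if $\varepsilon\le L$, the left-hand side is at most $\sum_{k=1}^ne^{D_2(n-k)\tau}E_p^k(\tau)$. (ii) Suppose moreover that $u\in C^{N+1}([0,T];H_0^1(\Omega))$, and let $c,r\in\mathbb R$. Then there is a constant $C$, which may depend on $\Omega,\varepsilon,f,L,T,N,u,c,r$ but not on $M$, $K$ (that is, $\tau$), $n$ or $h$, such that the following holds for all $K\ge1$ and every $M\ge1$ for which the projection in space is accurate in the sense that, for all $t\in[0,T]$, $$\|\nabla^\mu(\Pi_M^0u-u)(t)\|\le cM^{-r}\ (\mu=0,1),\qquad \|(\Pi_M^0u_t-u_t)(t)\|\le cM^{-r},\qquad\|\Delta\Pi_M^0\partial_t^{N+1}u(t)\|\le c.$$ First, $E_p^n(\tau)\le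 C(\tau M^{-2r}+\tau^{2N+3})$ for $n=1,\dots,K$. Second, if $\tau\le\frac{\varepsilon}{4\sqrt2L}$, then for every solution $h$ of the scheme $$\|h^n(t)-u(t)\|+\|\nabla(h^n(t)-u(t))\|\le C(M^{-r}+\tau^{N+1})\qquad\text{for all } n=1,\dots,K,\ t\in I_n .$$ -/

import Mathlib

open MeasureTheory Set
open scoped InnerProductSpace ContDiff

noncomputable section

namespace ESET

/-! ### The spaces `L²(Ω)`, `L²(Ω; ℝᵈ)` and `H₀¹(Ω)` -/

/-- `ℝᵈ` with its Euclidean norm. -/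
abbrev Sp (d : ℕ) : Type := EuclideanSpace ℝ (Fin d)

/-- `L²(Ω)`. -/
abbrev L2 {d : ℕ} (Ω : Set (Sp d)) : Type := Lp ℝ 2 (volume.restrict Ω)

/-- `L²(Ω; ℝᵈ)`. -/
abbrev L2Vec {d : ℕ} (Ω : Set (Sp d)) : Type := Lp (Sp d) 2 (volume.restrict Ω)

/-- The pairs `(φ, ∇φ)` in `L²(Ω) × L²(Ω; ℝᵈ)` with `φ ∈ C_c^∞(Ω)`. -/
def testPairs {d : ℕ} (Ω : Set (Sp d)) : Set (WithLp 2 (L2 Ω × L2Vec Ω)) :=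
  {w | ∃ φ : Sp d → ℝ, ContDiff ℝ ∞ φ ∧ HasCompactSupport φ ∧ tsupport φ ⊆ Ω ∧
    w.fst =ᵐ[volume.restrict Ω] φ ∧ w.snd =ᵐ[volume.restrict Ω] gradient φ}

/-- `H₀¹(Ω)`: the closure of `C_c^∞(Ω)` in the `H¹`-norm, where a function is recorded
together with its weak gradient.  It inherits the Hilbert space structure given by
`(v, w)_{L²} + (∇v, ∇w)_{L²}`. -/
def H01 {d : ℕ} (Ω : Set (Sp d)) : Submodule ℝ (WithLp 2 (L2 Ω × L2Vec Ω)) :=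
  (Submodule.span ℝ (testPairs Ω)).topologicalClosure

/-- The underlying function of an element of `H₀¹(Ω)`. -/
def val {d : ℕ} {Ω : Set (Sp d)} (w : H01 Ω) : L2 Ω :=
  (w : WithLp 2 (L2 Ω × L2Vec Ω)).fst

/-- The gradient of an element of `H₀¹(Ω)`. -/
def grad {d : ℕ} {Ω : Set (Sp d)} (w : H01 Ω) : L2Vec Ω :=
  (w : WithLp 2 (L2 Ω × L2Vec Ω)).snd

/-- `g = Δ w` in the sense of distributions. -/
def HasLaplacian {d : ℕ} {Ω : Set (Sp d)} (w : H01 Ω) (g : L2 Ω) : Prop :=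
  ∀ φ : H01 Ω, ⟪g, val φ⟫_ℝ = - ⟪grad w, grad φ⟫_ℝ

open Classical in
/-- The Laplacian `Δ w ∈ L²(Ω)`; it is only used for polynomials `w`, for which it exists. -/
def lap {d : ℕ} {Ω : Set (Sp d)} (w : H01 Ω) : L2 Ω :=
  if h : ∃ g, HasLaplacian w g then h.choose else 0

/-! ### The polynomial space and the projection in space -/

/-- `P_M⁰(Ω)`: the polynomials of (total) degree at most `M` that vanish on `∂Ω`,
as a subspace of `H₀¹(Ω)`. -/
def PM0 {d : ℕ} (Ω : Set (Sp d)) (M : ℕ) : Submodule ℝ (H01 Ω) where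
  carrier := {w | ∃ p : MvPolynomial (Fin d) ℝ, p.totalDegree ≤ M ∧
    (∀ x ∈ frontier Ω, MvPolynomial.eval (fun i => x i) p = 0) ∧
    val w =ᵐ[volume.restrict Ω] fun x => MvPolynomial.eval (fun i => x i) p}
  zero_mem' := by
    refine ⟨0, by simp, by simp, ?_⟩
    have h : val (0 : H01 Ω) = 0 := rfl
    rw [h]
    filter_upwards [Lp.coeFn_zero ℝ 2 (volume.restrict Ω)] with x hx
    rw [hx, map_zero, Pi.zero_apply]
  add_mem' := by
    rintro v w ⟨p, hp, hp0, hvp⟩ ⟨q, hq, hq0, hwq⟩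
    refine ⟨p + q, (MvPolynomial.totalDegree_add p q).trans (max_le hp hq), ?_, ?_⟩
    · intro x hx
      simp [hp0 x hx, hq0 x hx]
    · have h : val (v + w) = val v + val w := rfl
      rw [h]
      filter_upwards [Lp.coeFn_add (val v) (val w), hvp, hwq] with x h1 h2 h3
      rw [h1, Pi.add_apply, h2, h3, map_add]
  smul_mem' := by
    rintro c w ⟨p, hp, hp0, hwp⟩
    refine ⟨c • p, (MvPolynomial.totalDegree_smul_le c p).trans hp, ?_, ?_⟩
    · intro x hx
      simp [MvPolynomial.smul_eval, hp0 x hx]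
    · have h : val (c • w) = c • val w := rfl
      rw [h]
      filter_upwards [Lp.coeFn_smul c (val w), hwp] with x h1 h2
      rw [h1, Pi.smul_apply, h2, MvPolynomial.smul_eval, smul_eq_mul]

/-- `p = Π_M⁰ w`: `p ∈ P_M⁰(Ω)` and `(∇(p - w), ∇v) = 0` for all `v ∈ P_M⁰(Ω)`. -/
def IsSpaceProj {d : ℕ} {Ω : Set (Sp d)} (M : ℕ) (w p : H01 Ω) : Prop :=
  p ∈ PM0 Ω M ∧ ∀ v ∈ PM0 Ω M, ⟪grad (p - w), grad v⟫_ℝ = 0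

open Classical in
/-- The projection `Π_M⁰ : H₀¹(Ω) → P_M⁰(Ω)`. -/
def spaceProj {d : ℕ} {Ω : Set (Sp d)} (M : ℕ) (w : H01 Ω) : H01 Ω :=
  if h : ∃ p, IsSpaceProj M w p then h.choose else 0

/-! ### Functions of time -/

/-- `g` is a polynomial of degree at most `N` in time with coefficients in the subspace `S`. -/
def IsTimePoly {X : Type*} [AddCommGroup X] [Module ℝ X] (N : ℕ) (S : Submodule ℝ X)
    (g : ℝ → X) : Prop :=
  ∃ c : ℕ → X, (∀ i, c i ∈ S) ∧ ∀ t, g t = ∑ i ∈ Finset.range (N + 1), t ^ i • c i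

/-- `v ∈ H¹(a, b; X)`, where `v` is identified with its absolutely continuous representative:
`v` is on `[a, b]` the primitive of a function in `L²(a, b; X)`.  Its weak derivative is then
almost everywhere equal to `deriv v`. -/
def IsH1Time {X : Type*} [NormedAddCommGroup X] [NormedSpace ℝ X] (a b : ℝ) (v : ℝ → X) :
    Prop :=
  ∃ dv : ℝ → X, MemLp dv 2 (volume.restrict (Ioc a b)) ∧
    ∀ t ∈ Icc a b, v t = v a + ∫ s in a..t, dv s

/-- Linear interpolation in time at the end points of `[a, b]`. -/
def linInterp {X : Type*} [AddCommGroup X] [Module ℝ X] (a b : ℝ) (w : ℝ → X) (t : ℝ) : X :=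
  ((b - t) / (b - a)) • w a + ((t - a) / (b - a)) • w b

/-- `p` is the projection of `w ∈ H₀¹(a, b; X)` to the polynomials of degree at most `N` that
vanish at `a` and `b`: `∫ₐᵇ q'(t) (w - p)'(t) dt = 0` for all such scalar polynomials `q`. -/
def IsTimeProj0 {X : Type*} [NormedAddCommGroup X] [NormedSpace ℝ X] (N : ℕ) (a b : ℝ)
    (w p : ℝ → X) : Prop :=
  IsTimePoly N ⊤ p ∧ p a = 0 ∧ p b = 0 ∧
    ∀ q : ℝ → ℝ, IsTimePoly N ⊤ q → q a = 0 → q b = 0 →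
      ∫ t in a..b, deriv q t • deriv (fun s => w s - p s) t = 0

open Classical in
/-- The projection `Π_N^{0,n}` for the time interval `[a, b]`. -/
def timeProj0 {X : Type*} [NormedAddCommGroup X] [NormedSpace ℝ X] (N : ℕ) (a b : ℝ)
    (w : ℝ → X) : ℝ → X :=
  if h : ∃ p, IsTimeProj0 N a b w p then h.choose else 0

/-- The operator `Π_N^n = I_1^n + Π_N^{0,n} (id - I_1^n)` for the time interval `[a, b]`. -/
def timeProj {X : Type*} [NormedAddCommGroup X] [NormedSpace ℝ X] (N : ℕ) (a b : ℝ)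
    (w : ℝ → X) (t : ℝ) : X :=
  linInterp a b w t + timeProj0 N a b (fun s => w s - linInterp a b w s) t

/-- The space-time projection `Π^n u = Π_N^n Π_M⁰ u` for the time interval `[a, b]`. -/
def stProj {d : ℕ} {Ω : Set (Sp d)} (N M : ℕ) (a b : ℝ) (u : ℝ → H01 Ω) (t : ℝ) : H01 Ω :=
  timeProj N a b (fun s => spaceProj M (u s)) t

/-! ### The equation and the scheme -/

/-- `∫ₐᵇ (y_t, v_t) + ε (∇y, ∇v_t) + ε⁻¹ (f(y), v_t) dt`. -/
def weakForm {d : ℕ} {Ω : Set (Sp d)} (ε : ℝ) (f : ℝ → ℝ) (a b : ℝ) (y v : ℝ → H01 Ω) : ℝ :=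
  ∫ t in a..b, (⟪val (deriv y t), val (deriv v t)⟫_ℝ
    + ε * ⟪grad (y t), grad (deriv v t)⟫_ℝ
    + 1 / ε * ∫ x in Ω, f (val (y t) x) * val (deriv v t) x)

/-- `u ∈ H¹(0, T; H₀¹(Ω))` solves the energetic weak form of the Allen-Cahn equation on `[0, T]`
(with initial value `u 0`). -/
def IsWeakSolution {d : ℕ} {Ω : Set (Sp d)} (ε : ℝ) (f : ℝ → ℝ) (T : ℝ) (u : ℝ → H01 Ω) :
    Prop :=
  IsH1Time 0 T u ∧ ∀ v : ℝ → H01 Ω, IsH1Time 0 T v → v 0 = u 0 → weakForm ε f 0 T u v = 0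

/-- The value `u^m = h^m(t_m)` of a family `h^1, h^2, …` at the node `t_m = m τ`, with `u^0`
the given initial value. -/
def nodal {X : Type*} (τ : ℝ) (u0 : X) (h : ℕ → ℝ → X) : ℕ → X
  | 0 => u0
  | m + 1 => h (m + 1) (((m + 1 : ℕ) : ℝ) * τ)

/-- `h^1, …, h^K` is a solution of the implicit ESET scheme with step size `τ`, degree `M` in
space, degree `N` in time and initial value `u0`: on `I_n = [t_{n-1}, t_n]`, `h^n` lies in
`P_M⁰(Ω) ⊗ P_N(I_n)`, starts at `u^{n-1}`, and satisfies the weak form for all test functions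
in the same set. -/
def IsESET {d : ℕ} {Ω : Set (Sp d)} (ε : ℝ) (f : ℝ → ℝ) (τ : ℝ) (K N M : ℕ) (u0 : H01 Ω)
    (h : ℕ → ℝ → H01 Ω) : Prop :=
  ∀ n ∈ Finset.Icc 1 K,
    IsTimePoly N (PM0 Ω M) (h n) ∧
    h n (((n : ℝ) - 1) * τ) = nodal τ u0 h (n - 1) ∧
    ∀ v : ℝ → H01 Ω, IsTimePoly N (PM0 Ω M) v →
      v (((n : ℝ) - 1) * τ) = nodal τ u0 h (n - 1) →
      weakForm ε f (((n : ℝ) - 1) * τ) (n * τ) (h n) v = 0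

/-! ### The error terms -/

/-- `ρ^n = h^n - Π^n u`. -/
def rho {d : ℕ} {Ω : Set (Sp d)} (τ : ℝ) (N M : ℕ) (u : ℝ → H01 Ω) (h : ℕ → ℝ → H01 Ω)
    (n : ℕ) (t : ℝ) : H01 Ω :=
  h n t - stProj N M (((n : ℝ) - 1) * τ) (n * τ) u t

/-- The left-hand side of the error inequality:
`‖ρ^n(t_n)‖² + ε² / (2 L) ‖∇ρ^n(t_n)‖² + ∑_{k=1}^n D_τ ‖ρ_t^k‖_k²` with
`D_τ = ε / (4 L) - 8 τ² L / ε`, where `‖·‖_k` is the norm of `L²(I_k × Ω)`. -/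
def errLHS {d : ℕ} {Ω : Set (Sp d)} (ε L τ : ℝ) (N M : ℕ) (u : ℝ → H01 Ω)
    (h : ℕ → ℝ → H01 Ω) (n : ℕ) : ℝ :=
  ‖val (rho τ N M u h n (n * τ))‖ ^ 2
  + ε ^ 2 / (2 * L) * ‖grad (rho τ N M u h n (n * τ))‖ ^ 2
  + ∑ k ∈ Finset.Icc 1 n, (ε / (4 * L) - 8 * τ ^ 2 * L / ε) *
      (∫ t in (((k : ℝ) - 1) * τ)..(k * τ), ‖val (deriv (rho τ N M u h k) t)‖ ^ 2)

/-- `E_p^n(τ) = 6 ‖∂_t (Π_M⁰ - id) Π_N^n u‖_n² + 6 ε² ‖Δ (Π_N^n - id) Π_M⁰ u‖_n²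
+ (6 L² / ε²) ‖Π^n u - u‖_n²`, where `‖·‖_n` is the norm of `L²(I_n × Ω)`. -/
def Ep {d : ℕ} {Ω : Set (Sp d)} (ε L τ : ℝ) (N M : ℕ) (u : ℝ → H01 Ω) (n : ℕ) : ℝ :=
  6 * (∫ t in (((n : ℝ) - 1) * τ)..(n * τ),
      ‖val (deriv (fun s => spaceProj M (timeProj N (((n : ℝ) - 1) * τ) (n * τ) u s)
        - timeProj N (((n : ℝ) - 1) * τ) (n * τ) u s) t)‖ ^ 2)
  + 6 * ε ^ 2 * (∫ t in (((n : ℝ) - 1) * τ)..(n * τ),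
      ‖lap (stProj N M (((n : ℝ) - 1) * τ) (n * τ) u t - spaceProj M (u t))‖ ^ 2)
  + 6 * L ^ 2 / ε ^ 2 * (∫ t in (((n : ℝ) - 1) * τ)..(n * τ),
      ‖val (stProj N M (((n : ℝ) - 1) * τ) (n * τ) u t - u t)‖ ^ 2)

/-- The assumption on the projection in space, for polynomials of degree `M` and a solution `u`
that is `N + 1` times differentiable in time: with the constants `c` and `r`, the projection
errors of `u` (in `L²` and for the gradient) and of `u_t` (in `L²`) are at most `c M^{-r}`, and
the Laplacian of `Π_M⁰ ∂_t^{N+1} u` is bounded by `c`. -/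
def SpaceAccuracy {d : ℕ} {Ω : Set (Sp d)} (T c r : ℝ) (N M : ℕ) (u : ℝ → H01 Ω) : Prop :=
  ∀ t ∈ Icc 0 T,
    ‖val (spaceProj M (u t) - u t)‖ ≤ c * (M : ℝ) ^ (-r) ∧
    ‖grad (spaceProj M (u t) - u t)‖ ≤ c * (M : ℝ) ^ (-r) ∧
    ‖val (spaceProj M (derivWithin u (Icc 0 T) t) - derivWithin u (Icc 0 T) t)‖
      ≤ c * (M : ℝ) ^ (-r) ∧
    ‖lap (spaceProj M (iteratedDerivWithin (N + 1) u (Icc 0 T) t))‖ ≤ c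

end ESET

end

/-! Fix a time interval `[a, b]`. Write `P` for the projection in space, `Λ = Δ ∘ P`, and `ρ = h - P
Π_N u`.

Error equation. The time derivative of an admissible test function can be any polynomial `w` in time
of degree less than `N` with values in `P_M⁰(Ω)`. The projection in time is the primitive of the
`L²`-projection of the derivative to polynomials of degree less than `N` (`timeProj_eq`), so `(u -
Π_N u)_t` vanishes against `w`. By the definition of `P`, so does `∇(P u - u)`. Subtracting the
equations for `h` and `u` leaves `∫ (ρ_t, w) + ε (∇ρ, ∇w) = ∫ (R, w)` (`error_equation`). Here `R`
collects `∂_t (P - id) Π_N u`, `ε Λ (Π_N u - u)` and the Lipschitz difference of the nonlinear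
terms.

Stability. The choice `w = ρ_t` turns the gradient term into a time derivative. Multiplication by `ε
/ L`, Young's inequality and `‖ρ(t)‖ ≤ ‖ρ(a)‖ + ∫ ‖ρ_t‖` give one step of the estimate
(`energy_step`). The projection in time interpolates at the nodes, so the steps can be chained. A
discrete Gronwall argument starting from error zero yields (i) (`energy_add_sum_le`). The Young
constants are chosen slightly better than (i) needs: at the largest admissible `τ` the factor `D_τ`
is zero, whereas the sharper factor stays at least `ε / (40 L)`. This keeps `∫ ‖ρ_t‖²` under control
in (ii).

Rates. The first term of `E_p` is bounded because `P - id` commutes with the `L²`-projection in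
time. The second and third use Taylor approximation of `u_t` in time, applied under a bounded
operator (`norm_map_timeProj_sub_le`).

Errors inside an interval. The energy controls `∇ρ` only at nodes, and an inverse estimate in space
would cost powers of `M`. Instead the error equation is tested with `w(s) = k(s) (ρ(t) - ρ(a))`,
where `k` has degree less than `N`, is of size `1 / τ`, and satisfies `∫ k (g - g(a)) = g(t) - g(a)`
for all `g` of degree at most `N` (`exists_kernel`). The result bounds `‖∇(ρ(t) - ρ(a))‖²` by `∫
‖R‖²`, `∫ ‖ρ_t‖²` and `‖∇ρ(a)‖²`, with constants that depend on neither `M` nor `τ`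
(`norm_grad_sub_sq_le`). -/

noncomputable section

namespace ESET

/-! ### Density of test functions, integration by parts, the weak Laplacian and Poincaré's
inequality. -/

section Space

variable {d : ℕ} {Ω : Set (Sp d)}

/-- The embedding of `H₀¹(Ω)` into `L²(Ω)`. -/
def valL : H01 Ω →L[ℝ] L2 Ω :=
  (WithLp.fstL 2 ℝ (L2 Ω) (L2Vec Ω)).comp (H01 Ω).subtypeL

/-- The gradient as a bounded operator on `H₀¹(Ω)`. -/
def gradL : H01 Ω →L[ℝ] L2Vec Ω :=
  (WithLp.sndL 2 ℝ (L2 Ω) (L2Vec Ω)).comp (H01 Ω).subtypeL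

@[simp] lemma valL_apply (w : H01 Ω) : valL w = val w := rfl

@[simp] lemma gradL_apply (w : H01 Ω) : gradL w = grad w := rfl

lemma norm_sq_eq_val_add_grad (w : H01 Ω) : ‖w‖ ^ 2 = ‖val w‖ ^ 2 + ‖grad w‖ ^ 2 :=
  WithLp.prod_norm_sq_eq_of_L2 (w : WithLp 2 (L2 Ω × L2Vec Ω))

instance : CompleteSpace (H01 Ω) := by
  unfold H01
  infer_instance

/-- `φ` is a test function on `Ω` representing `w`. -/
def IsTestRep (w : H01 Ω) (φ : Sp d → ℝ) : Prop :=
  ContDiff ℝ ∞ φ ∧ HasCompactSupport φ ∧ tsupport φ ⊆ Ω ∧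
    val w =ᵐ[volume.restrict Ω] φ ∧ grad w =ᵐ[volume.restrict Ω] gradient φ

lemma gradient_add' {φ ψ : Sp d → ℝ} (hφ : Differentiable ℝ φ) (hψ : Differentiable ℝ ψ)
    (x : Sp d) : gradient (φ + ψ) x = gradient φ x + gradient ψ x := by
  simp only [gradient]
  rw [fderiv_add (hφ x) (hψ x), map_add]

lemma gradient_const_smul' {φ : Sp d → ℝ} (hφ : Differentiable ℝ φ) (c : ℝ) (x : Sp d) :
    gradient (c • φ) x = c • gradient φ x := by
  simp only [gradient]
  rw [fderiv_const_smul (hφ x), map_smulₛₗ]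
  simp

/-- Test pairs are already closed under sums and multiples, so elements of `H01 Ω` are limits of
single test functions and no linear combinations appear in density arguments. -/
lemma span_testPairs : (Submodule.span ℝ (testPairs Ω) : Set _) = testPairs Ω := by
  refine Subset.antisymm ?_ Submodule.subset_span
  intro w hw
  induction hw using Submodule.span_induction with
  | mem x h => exact h
  | zero =>
    refine ⟨0, contDiff_const, HasCompactSupport.zero, by simp [tsupport], ?_, ?_⟩
    · exact Lp.coeFn_zero ℝ 2 (volume.restrict Ω)
    · refine (Lp.coeFn_zero (Sp d) 2 (volume.restrict Ω)).trans ?_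
      filter_upwards with x
      exact (gradient_fun_const x (0 : ℝ)).symm
  | add x y _ _ hx hy =>
    obtain ⟨φ, h1, h2, h3, h4, h5⟩ := hx
    obtain ⟨ψ, g1, g2, g3, g4, g5⟩ := hy
    refine ⟨φ + ψ, h1.add g1, h2.add g2, (tsupport_add φ ψ).trans (union_subset h3 g3), ?_, ?_⟩
    · filter_upwards [Lp.coeFn_add x.fst y.fst, h4, g4] with a e1 e2 e3
      rw [WithLp.add_fst, e1, Pi.add_apply, e2, e3, Pi.add_apply]
    · filter_upwards [Lp.coeFn_add x.snd y.snd, h5, g5] with a e1 e2 e3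
      rw [WithLp.add_snd, e1, Pi.add_apply, e2, e3,
        gradient_add' (h1.differentiable (by simp)) (g1.differentiable (by simp))]
  | smul c x _ hx =>
    obtain ⟨φ, h1, h2, h3, h4, h5⟩ := hx
    refine ⟨c • φ, h1.const_smul c, h2.smul_left (f := fun _ => c),
      (tsupport_smul_subset_right (fun _ => c) φ).trans h3, ?_, ?_⟩
    · filter_upwards [Lp.coeFn_smul c x.fst, h4] with a e1 e2
      rw [WithLp.smul_fst, e1, Pi.smul_apply, e2, Pi.smul_apply]
    · filter_upwards [Lp.coeFn_smul c x.snd, h5] with a e1 e2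
      rw [WithLp.smul_snd, e1, Pi.smul_apply, e2,
        gradient_const_smul' (h1.differentiable (by simp))]

/-- A closed property that holds for test functions holds on `H₀¹(Ω)`. -/
lemma H01_induction {p : H01 Ω → Prop} (hp : IsClosed {w | p w})
    (h : ∀ w φ, IsTestRep w φ → p w) (w : H01 Ω) : p w := by
  have hw : (w : WithLp 2 (L2 Ω × L2Vec Ω)) ∈
      closure (Submodule.span ℝ (testPairs Ω) : Set (WithLp 2 (L2 Ω × L2Vec Ω))) := w.2
  obtain ⟨x, hx, hxw⟩ := mem_closure_iff_seq_limit.1 hw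
  have hx' : ∀ n, x n ∈ H01 Ω := fun n => Submodule.le_topologicalClosure _ (hx n)
  have ht : Filter.Tendsto (fun n => (⟨x n, hx' n⟩ : H01 Ω)) Filter.atTop (nhds w) :=
    tendsto_subtype_rng.2 hxw
  refine hp.mem_of_tendsto ht (Filter.Eventually.of_forall fun n => ?_)
  have := hx n
  rw [span_testPairs] at this
  obtain ⟨φ, hφ⟩ := this
  exact h _ φ hφ

lemma memLp_of_continuous (hΩo : IsOpen Ω) (hΩb : Bornology.IsBounded Ω)
    {E : Type*} [NormedAddCommGroup E] [SecondCountableTopologyEither (Sp d) E]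
    {φ : Sp d → E} (hφ : Continuous φ) :
    MemLp φ 2 (volume.restrict Ω) := by
  have hc : IsCompact (closure Ω) := hΩb.isCompact_closure
  obtain ⟨C, hC⟩ := hc.exists_bound_of_continuousOn hφ.continuousOn
  have : IsFiniteMeasure (volume.restrict Ω) :=
    ⟨by simpa using hΩb.measure_lt_top⟩
  refine MemLp.of_bound hφ.aestronglyMeasurable C ?_
  filter_upwards [ae_restrict_mem hΩo.measurableSet] with x hx
  exact hC x (subset_closure hx)

/-- The partial derivative in direction `i`. -/
def pd (i : Fin d) (φ : Sp d → ℝ) (x : Sp d) : ℝ :=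
  fderiv ℝ φ x (EuclideanSpace.single i 1)

lemma contDiff_pd {φ : Sp d → ℝ} (hφ : ContDiff ℝ ∞ φ) (i : Fin d) : ContDiff ℝ ∞ (pd i φ) :=
  (hφ.fderiv_right (m := ∞) (by simp)).clm_apply contDiff_const

lemma tsupport_pd_subset (φ : Sp d → ℝ) (i : Fin d) : tsupport (pd i φ) ⊆ tsupport φ :=
  tsupport_fderiv_apply_subset ℝ _

lemma hasCompactSupport_pd {φ : Sp d → ℝ} (hφ : HasCompactSupport φ) (i : Fin d) :
    HasCompactSupport (pd i φ) :=
  hφ.fderiv_apply ℝ _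

lemma gradient_apply (φ : Sp d → ℝ) (x : Sp d) (i : Fin d) : gradient φ x i = pd i φ x := by
  rw [pd, ← inner_gradient_left, EuclideanSpace.inner_single_right]
  simp

lemma inner_gradient_gradient (φ ψ : Sp d → ℝ) (x : Sp d) :
    ⟪gradient φ x, gradient ψ x⟫_ℝ = ∑ i, pd i φ x * pd i ψ x := by
  rw [PiLp.inner_apply]
  refine Finset.sum_congr rfl fun i _ => ?_
  rw [gradient_apply, gradient_apply, mul_comm]
  rfl

/-- The classical Laplacian. -/
def clap (φ : Sp d → ℝ) (x : Sp d) : ℝ := ∑ i, pd i (pd i φ) x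

lemma continuous_clap {φ : Sp d → ℝ} (hφ : ContDiff ℝ ∞ φ) : Continuous (clap φ) :=
  continuous_finsetSum _ fun i _ => (contDiff_pd (contDiff_pd hφ i) i).continuous

lemma integral_mul_pd {φ ψ : Sp d → ℝ} (hφ : ContDiff ℝ ∞ φ) (hψ : ContDiff ℝ ∞ ψ)
    (hc : HasCompactSupport ψ) (i : Fin d) :
    ∫ x, φ x * pd i ψ x = - ∫ x, pd i φ x * ψ x := by
  refine integral_mul_fderiv_eq_neg_fderiv_mul_of_integrable ?_ ?_ ?_
    (fun x _ => (hφ.differentiable (by simp)) x) (fun x _ => (hψ.differentiable (by simp)) x)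
  · exact ((contDiff_pd hφ i).continuous.mul hψ.continuous).integrable_of_hasCompactSupport
      hc.mul_left
  · exact (hφ.continuous.mul (contDiff_pd hψ i).continuous).integrable_of_hasCompactSupport
      (hasCompactSupport_pd hc i).mul_left
  · exact (hφ.continuous.mul hψ.continuous).integrable_of_hasCompactSupport hc.mul_left

lemma integral_sum_pd_mul_pd {φ ψ : Sp d → ℝ} (hφ : ContDiff ℝ ∞ φ) (hψ : ContDiff ℝ ∞ ψ)
    (hc : HasCompactSupport ψ) :
    ∫ x, ∑ i, pd i φ x * pd i ψ x = - ∫ x, clap φ x * ψ x := by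
  rw [integral_finsetSum, ← integral_neg]
  · simp_rw [clap, Finset.sum_mul, ← Finset.sum_neg_distrib]
    rw [integral_finsetSum]
    · refine Finset.sum_congr rfl fun i _ => ?_
      rw [integral_mul_pd (contDiff_pd hφ i) hψ hc i, integral_neg]
    · intro i _
      exact (((contDiff_pd (contDiff_pd hφ i) i).continuous.mul
        hψ.continuous).integrable_of_hasCompactSupport hc.mul_left).neg
  · intro i _
    exact ((contDiff_pd hφ i).continuous.mul
      (contDiff_pd hψ i).continuous).integrable_of_hasCompactSupport
        (hasCompactSupport_pd hc i).mul_left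

lemma setIntegral_eq_integral_of_tsupport {φ g : Sp d → ℝ} (hφ : tsupport φ ⊆ Ω)
    (h : ∀ x, φ x = 0 → g x = 0) : ∫ x in Ω, g x = ∫ x, g x :=
  setIntegral_eq_integral_of_forall_compl_eq_zero fun x hx =>
    h x (image_eq_zero_of_notMem_tsupport fun hx' => hx (hφ hx'))

lemma IsTestRep.pd_eq_zero {w : H01 Ω} {φ : Sp d → ℝ} (h : IsTestRep w φ) {x : Sp d}
    (hx : x ∉ Ω) (i : Fin d) : pd i φ x = 0 :=
  image_eq_zero_of_notMem_tsupport fun hx' => hx (h.2.2.1 (tsupport_pd_subset φ i hx'))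

lemma IsTestRep.eq_zero {w : H01 Ω} {φ : Sp d → ℝ} (h : IsTestRep w φ) {x : Sp d}
    (hx : x ∉ Ω) : φ x = 0 :=
  image_eq_zero_of_notMem_tsupport fun hx' => hx (h.2.2.1 hx')

/-- `(∇w, ∇φ) = -(w, Δφ)` for `w ∈ H₀¹(Ω)` and a test function `φ`. -/
lemma inner_grad_testRep (hΩo : IsOpen Ω) (hΩb : Bornology.IsBounded Ω) (w v : H01 Ω)
    {φ : Sp d → ℝ} (h : IsTestRep v φ) :
    ⟪grad w, grad v⟫_ℝ = - ∫ x in Ω, val w x * clap φ x := by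
  have hm := memLp_of_continuous hΩo hΩb (continuous_clap h.1)
  have key : ∀ w : H01 Ω, ⟪val w, hm.toLp⟫_ℝ = ∫ x in Ω, val w x * clap φ x := by
    intro w
    rw [L2.inner_def]
    refine integral_congr_ae ?_
    filter_upwards [hm.coeFn_toLp] with x hx
    rw [hx]
    simp [mul_comm]
  rw [← key]
  -- Both sides are continuous in `w`, so it suffices to integrate by parts between two test
  -- functions.
  revert w
  refine H01_induction (p := fun w => ⟪grad w, grad v⟫_ℝ = - ⟪val w, hm.toLp⟫_ℝ) ?_ ?_
  · refine isClosed_eq ?_ ?_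
    · exact (gradL.continuous.inner continuous_const)
    · exact (valL.continuous.inner continuous_const).neg
  · intro w ψ hw
    rw [key, L2.inner_def]
    have e1 : ∫ x in Ω, ⟪grad w x, grad v x⟫_ℝ = ∫ x in Ω, ∑ i, pd i φ x * pd i ψ x := by
      refine integral_congr_ae ?_
      filter_upwards [hw.2.2.2.2, h.2.2.2.2] with x hx1 hx2
      rw [hx1, hx2, real_inner_comm, inner_gradient_gradient]
    have e2 : ∫ x in Ω, val w x * clap φ x = ∫ x in Ω, clap φ x * ψ x := by
      refine integral_congr_ae ?_
      filter_upwards [hw.2.2.2.1] with x hx1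
      rw [hx1, mul_comm]
    rw [e1, e2, setIntegral_eq_integral_of_forall_compl_eq_zero,
      setIntegral_eq_integral_of_forall_compl_eq_zero, integral_sum_pd_mul_pd h.1 hw.1 hw.2.1]
    · intro x hx
      rw [hw.eq_zero hx, mul_zero]
    · intro x hx
      simp [hw.pd_eq_zero hx]

/-- An element of `H₀¹(Ω)` that agrees with a smooth function has a Laplacian in `L²(Ω)`. -/
lemma exists_hasLaplacian (hΩo : IsOpen Ω) (hΩb : Bornology.IsBounded Ω) (w : H01 Ω)
    {p : Sp d → ℝ} (hp : ContDiff ℝ ∞ p) (hw : val w =ᵐ[volume.restrict Ω] p) :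
    ∃ g : L2 Ω, g =ᵐ[volume.restrict Ω] clap p ∧ HasLaplacian w g := by
  have hm := memLp_of_continuous hΩo hΩb (continuous_clap hp)
  refine ⟨hm.toLp, hm.coeFn_toLp, ?_⟩
  refine H01_induction ?_ ?_
  · refine isClosed_eq ?_ ?_
    · exact (continuous_const.inner valL.continuous)
    · exact (continuous_const.inner gradL.continuous).neg
  · intro v φ h
    -- Only the values of `w` are known to agree with `p`, not the gradient. All derivatives are
    -- therefore moved to `φ`, then `w` is replaced by `p`, and two classical integrations by parts
    -- bring them back to `p`.
    rw [inner_grad_testRep hΩo hΩb w v h, neg_neg, L2.inner_def]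
    have e1 : ∫ x in Ω, ⟪(hm.toLp : L2 Ω) x, val v x⟫_ℝ = ∫ x in Ω, clap p x * φ x := by
      refine integral_congr_ae ?_
      filter_upwards [hm.coeFn_toLp, h.2.2.2.1] with x hx1 hx2
      rw [hx1, hx2]
      simp [mul_comm]
    have e2 : ∫ x in Ω, val w x * clap φ x = ∫ x in Ω, clap φ x * p x := by
      refine integral_congr_ae ?_
      filter_upwards [hw] with x hx1
      rw [hx1, mul_comm]
    rw [e1, e2, setIntegral_eq_integral_of_forall_compl_eq_zero,
      setIntegral_eq_integral_of_forall_compl_eq_zero]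
    · have h1 := integral_sum_pd_mul_pd hp h.1 h.2.1
      have h2 : ∫ x, clap φ x * p x = - ∫ x, ∑ i, pd i p x * pd i φ x := by
        rw [integral_finsetSum, ← Finset.sum_neg_distrib]
        · simp_rw [clap, Finset.sum_mul]
          rw [integral_finsetSum]
          · refine Finset.sum_congr rfl fun i _ => ?_
            rw [← integral_mul_pd hp (contDiff_pd h.1 i) (hasCompactSupport_pd h.2.1 i) i]
            simp_rw [mul_comm]
          · intro i _
            exact (((contDiff_pd (contDiff_pd h.1 i) i).continuous.mul
              hp.continuous).integrable_of_hasCompactSupport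
              (hasCompactSupport_pd (hasCompactSupport_pd h.2.1 i) i).mul_right)
        · intro i _
          exact ((contDiff_pd hp i).continuous.mul
            (contDiff_pd h.1 i).continuous).integrable_of_hasCompactSupport
              (hasCompactSupport_pd h.2.1 i).mul_left
      rw [h2, h1, neg_neg]
    · intro x hx
      have : clap φ x = 0 := Finset.sum_eq_zero fun i _ =>
        image_eq_zero_of_notMem_tsupport fun hx' => hx (h.2.2.1
          (tsupport_pd_subset φ i (tsupport_pd_subset _ i hx')))
      rw [this, zero_mul]
    · intro x hx
      rw [h.eq_zero hx, mul_zero]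

/-- The Laplacian is unique. -/
lemma HasLaplacian.unique (hΩo : IsOpen Ω) (hΩb : Bornology.IsBounded Ω) {w : H01 Ω}
    {g g' : L2 Ω} (h : HasLaplacian w g) (h' : HasLaplacian w g') : g = g' := by
  have : IsFiniteMeasure (volume.restrict Ω) := ⟨by simpa using hΩb.measure_lt_top⟩
  rw [← sub_eq_zero]
  have hz : ∀ v : H01 Ω, ⟪g - g', val v⟫_ℝ = 0 := fun v => by
    rw [inner_sub_left, h v, h' v, sub_self]
  set k := g - g'
  have hk : Integrable k (volume.restrict Ω) := (Lp.memLp k).integrable (by norm_num)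
  have := hΩo.ae_eq_zero_of_integral_contDiff_smul_eq_zero (μ := volume) (f := k)
    (IntegrableOn.locallyIntegrableOn hk) ?_
  · rw [Lp.eq_zero_iff_ae_eq_zero]
    exact (ae_restrict_iff' hΩo.measurableSet).2 this
  · intro φ hφ hc hs
    have hm1 := memLp_of_continuous hΩo hΩb hφ.continuous
    have hgc : Continuous (gradient φ) := by
      unfold gradient
      exact (InnerProductSpace.toDual ℝ (Sp d)).symm.continuous.comp (hφ.continuous_fderiv (by simp))
    have hm2 := memLp_of_continuous hΩo hΩb hgc
    let v0 : WithLp 2 (L2 Ω × L2Vec Ω) := WithLp.toLp 2 (hm1.toLp, hm2.toLp)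
    have hv0 : v0 ∈ testPairs Ω := ⟨φ, hφ, hc, hs, hm1.coeFn_toLp, hm2.coeFn_toLp⟩
    let v : H01 Ω := ⟨v0, Submodule.le_topologicalClosure _ (Submodule.subset_span hv0)⟩
    have := hz v
    rw [L2.inner_def] at this
    rw [← this, ← setIntegral_eq_integral_of_tsupport hs]
    · refine integral_congr_ae ?_
      filter_upwards [hm1.coeFn_toLp] with x hx
      have : val v x = φ x := hx
      rw [this]
      simp
    · intro x hx
      simp [hx]

/-- The Poincaré inequality. -/
lemma exists_poincare (hd : 1 ≤ d) (hΩb : Bornology.IsBounded Ω) (hΩo : IsOpen Ω) :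
    ∃ C : ℝ, 0 ≤ C ∧ ∀ w : H01 Ω, ‖val w‖ ≤ C * ‖grad w‖ := by
  obtain ⟨R, hR⟩ := hΩb.exists_norm_le
  refine ⟨2 * |R|, by positivity, ?_⟩
  refine H01_induction ?_ ?_
  · exact isClosed_le (valL.continuous.norm) (continuous_const.mul gradL.continuous.norm)
  intro w φ h
  let i : Fin d := ⟨0, hd⟩
  have hX : ContDiff ℝ ∞ (fun x : Sp d => x i) := (EuclideanSpace.proj (𝕜 := ℝ) i).contDiff
  have hpX : ∀ x, pd i (fun x : Sp d => x i) x = 1 := by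
    intro x
    have : fderiv ℝ (fun x : Sp d => x i) x = EuclideanSpace.proj (𝕜 := ℝ) i :=
      (EuclideanSpace.proj (𝕜 := ℝ) i).fderiv
    rw [pd, this]
    simp
  have hm := memLp_of_continuous hΩo hΩb (hX.continuous.mul (contDiff_pd h.1 i).continuous)
  have hcs : HasCompactSupport (fun x => φ x * φ x) := h.2.1.mul_left
  -- Since `∂_i x_i = 1`, this reads `∫ φ² = -2 ∫ x_i φ ∂_i φ`. Cauchy-Schwarz with `|x_i| ≤ |R|` on
  -- `Ω` then gives the constant `2 |R|`.
  have h1 := integral_mul_pd hX (h.1.mul h.1) hcs i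
  simp_rw [hpX, one_mul] at h1
  have h2 : ∀ x, pd i (fun x => φ x * φ x) x = 2 * φ x * pd i φ x := by
    intro x
    have hdx := h.1.differentiable (by simp) x
    simp only [pd]
    rw [fderiv_fun_mul hdx hdx]
    simp
    ring
  have h3 : ⟪val w, val w⟫_ℝ = -2 * ⟪val w, hm.toLp⟫_ℝ := by
    rw [L2.inner_def, L2.inner_def]
    have e1 : ∫ x in Ω, ⟪val w x, val w x⟫_ℝ = ∫ x in Ω, φ x * φ x := by
      refine integral_congr_ae ?_
      filter_upwards [h.2.2.2.1] with x hx
      rw [hx]; simp [sq]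
    have e2 : ∫ x in Ω, ⟪val w x, (hm.toLp : L2 Ω) x⟫_ℝ = ∫ x in Ω, φ x * (x i * pd i φ x) := by
      refine integral_congr_ae ?_
      filter_upwards [h.2.2.2.1, hm.coeFn_toLp] with x hx hx2
      rw [hx, hx2]; simp [mul_comm]
    rw [e1, e2, setIntegral_eq_integral_of_forall_compl_eq_zero,
      setIntegral_eq_integral_of_forall_compl_eq_zero, ← integral_const_mul]
    · rw [← neg_eq_iff_eq_neg] at h1
      rw [← h1, ← integral_neg]
      refine integral_congr_ae (Filter.Eventually.of_forall fun x => ?_)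
      simp only [h2]
      ring
    · intro x hx
      rw [h.eq_zero hx, zero_mul]
    · intro x hx
      rw [h.eq_zero hx, zero_mul]
  have h4 : ‖hm.toLp‖ ≤ |R| * ‖grad w‖ := by
    refine Lp.norm_le_mul_norm_of_ae_le_mul ?_
    filter_upwards [hm.coeFn_toLp, h.2.2.2.2, ae_restrict_mem hΩo.measurableSet] with x e1 e2 e3
    rw [e1, e2, Pi.mul_apply, norm_mul]
    refine mul_le_mul ?_ ?_ (norm_nonneg _) (abs_nonneg _)
    · exact (PiLp.norm_apply_le x i).trans ((hR x e3).trans (le_abs_self R))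
    · rw [← gradient_apply]
      exact PiLp.norm_apply_le _ i
  rw [real_inner_self_eq_norm_sq] at h3
  have h5 := neg_le_of_abs_le (abs_real_inner_le_norm (val w) hm.toLp)
  by_cases h0 : ‖val w‖ = 0
  · rw [h0]; positivity
  have hpos : 0 < ‖val w‖ := lt_of_le_of_ne (norm_nonneg _) (Ne.symm h0)
  have h6 : ‖val w‖ * ‖val w‖ ≤ ‖val w‖ * (2 * |R| * ‖grad w‖) := by
    nlinarith [mul_le_mul_of_nonneg_left h4 hpos.le]
  exact le_of_mul_le_mul_left h6 hpos

end Space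

/-! ### The polynomial space and the projection in space as bounded operators. -/

section Proj

variable {d : ℕ} {Ω : Set (Sp d)}

lemma contDiff_mvPolynomial_eval (p : MvPolynomial (Fin d) ℝ) :
    ContDiff ℝ ∞ (fun x : Sp d => MvPolynomial.eval (fun i => x i) p) := by
  induction p using MvPolynomial.induction_on with
  | C a => simpa using contDiff_const
  | add p q hp hq => simpa using hp.add hq
  | mul_X p i hp =>
    simpa using hp.mul (EuclideanSpace.proj (𝕜 := ℝ) i).contDiff

lemma exists_hasLaplacian_of_mem (hΩo : IsOpen Ω) (hΩb : Bornology.IsBounded Ω) {M : ℕ}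
    {w : H01 Ω} (hw : w ∈ PM0 Ω M) : ∃ g, HasLaplacian w g := by
  obtain ⟨p, -, -, hp⟩ := hw
  obtain ⟨g, -, hg⟩ := exists_hasLaplacian hΩo hΩb w (contDiff_mvPolynomial_eval p) hp
  exact ⟨g, hg⟩

lemma hasLaplacian_lap (hΩo : IsOpen Ω) (hΩb : Bornology.IsBounded Ω) {M : ℕ}
    {w : H01 Ω} (hw : w ∈ PM0 Ω M) : HasLaplacian w (lap w) := by
  have h := exists_hasLaplacian_of_mem hΩo hΩb hw
  rw [lap, dif_pos h]
  exact h.choose_spec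

/-- Testing the Laplacian of `w` with `w` itself gives `‖∇w‖² = -(Δw, w)`, so a vanishing value
forces a vanishing gradient. -/
lemma eq_zero_of_val_eq_zero_of_mem (hΩo : IsOpen Ω) (hΩb : Bornology.IsBounded Ω) {M : ℕ}
    {w : H01 Ω} (hw : w ∈ PM0 Ω M) (h0 : val w = 0) : w = 0 := by
  have h := hasLaplacian_lap hΩo hΩb hw w
  rw [h0, inner_zero_right, real_inner_self_eq_norm_sq] at h
  have h2 := norm_sq_eq_val_add_grad w
  rw [h0, norm_zero] at h2
  have : ‖w‖ ^ 2 = 0 := by linarith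
  simpa using this

/-- An element is determined by its value in `L²(Ω)`, which lies in the image of the
finite-dimensional space of polynomials of total degree at most `M`. -/
lemma finiteDimensional_PM0 (hΩo : IsOpen Ω) (hΩb : Bornology.IsBounded Ω) (M : ℕ) :
    FiniteDimensional ℝ (PM0 Ω M) := by
  let Φ : MvPolynomial.restrictTotalDegree (Fin d) ℝ M →ₗ[ℝ] L2 Ω :=
    { toFun := fun p => (memLp_of_continuous hΩo hΩb
        (contDiff_mvPolynomial_eval (p : MvPolynomial (Fin d) ℝ)).continuous).toLp
      map_add' := fun p q => by
        rw [← MemLp.toLp_add]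
        congr 1
        ext x
        simp
      map_smul' := fun c p => by
        rw [RingHom.id_apply, ← MemLp.toLp_const_smul]
        congr 1
        ext x
        simp [MvPolynomial.smul_eval] }
  let Ψ : PM0 Ω M →ₗ[ℝ] LinearMap.range Φ :=
    LinearMap.codRestrict _ (valL.toLinearMap.comp (PM0 Ω M).subtype) (by
      rintro ⟨w, p, hp, -, hw⟩
      refine ⟨⟨p, (MvPolynomial.mem_restrictTotalDegree _ _ _).2 hp⟩, ?_⟩
      refine Lp.ext ?_
      refine (memLp_of_continuous hΩo hΩb
        (contDiff_mvPolynomial_eval p).continuous).coeFn_toLp.trans ?_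
      exact hw.symm)
  refine FiniteDimensional.of_injective Ψ ?_
  rw [← LinearMap.ker_eq_bot, LinearMap.ker_eq_bot']
  intro w hw
  have h1 : val (w : H01 Ω) = 0 := congrArg (fun z : LinearMap.range Φ => (z : L2 Ω)) hw
  exact Subtype.ext (eq_zero_of_val_eq_zero_of_mem hΩo hΩb w.2 h1)

lemma eq_zero_of_grad_eq_zero (hd : 1 ≤ d) (hΩo : IsOpen Ω) (hΩb : Bornology.IsBounded Ω)
    {w : H01 Ω} (h0 : grad w = 0) : w = 0 := by
  obtain ⟨C, -, hC⟩ := exists_poincare hd hΩb hΩo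
  have h1 := hC w
  rw [h0, norm_zero, mul_zero] at h1
  have h2 := norm_sq_eq_val_add_grad w
  have h3 : ‖val w‖ = 0 := le_antisymm h1 (norm_nonneg _)
  rw [h0, h3, norm_zero] at h2
  have : ‖w‖ ^ 2 = 0 := by linarith
  simpa using this

lemma IsSpaceProj.unique (hd : 1 ≤ d) (hΩo : IsOpen Ω) (hΩb : Bornology.IsBounded Ω) {M : ℕ}
    {w p q : H01 Ω} (hp : IsSpaceProj M w p) (hq : IsSpaceProj M w q) : p = q := by
  have hm : p - q ∈ PM0 Ω M := sub_mem hp.1 hq.1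
  have h1 := hp.2 _ hm
  have h2 := hq.2 _ hm
  have h3 : ⟪grad (p - q), grad (p - q)⟫_ℝ = 0 := by
    have : grad (p - q) = grad (p - w) - grad (q - w) := by
      simp only [← gradL_apply, map_sub]; abel
    nth_rewrite 1 [this]
    rw [inner_sub_left, h1, h2, sub_zero]
  rw [inner_self_eq_zero] at h3
  exact sub_eq_zero.1 (eq_zero_of_grad_eq_zero hd hΩo hΩb h3)

/-- The projection in space is a bounded linear operator. -/
lemma exists_spaceProjL (hd : 1 ≤ d) (hΩo : IsOpen Ω) (hΩb : Bornology.IsBounded Ω) (M : ℕ) :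
    ∃ P : H01 Ω →L[ℝ] H01 Ω, (∀ w, spaceProj M w = P w) ∧ ∀ w, IsSpaceProj M w (P w) := by
  have hfin := finiteDimensional_PM0 hΩo hΩb M
  -- By Poincaré, `grad` maps `PM0 Ω M` isomorphically onto the space `G` of its gradients. The
  -- projection is the orthogonal projection of the gradient to `G`, pulled back along this
  -- isomorphism.
  let G : Submodule ℝ (L2Vec Ω) := (PM0 Ω M).map (gradL (Ω := Ω)).toLinearMap
  have hGfin : FiniteDimensional ℝ G := inferInstance
  let e : PM0 Ω M →ₗ[ℝ] G := (gradL (Ω := Ω)).toLinearMap.submoduleMap (PM0 Ω M)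
  have he : Function.Bijective e := by
    refine ⟨?_, LinearMap.submoduleMap_surjective _ _⟩
    rw [← LinearMap.ker_eq_bot, LinearMap.ker_eq_bot']
    intro w hw
    have h1 : grad (w : H01 Ω) = 0 := congrArg (fun z : G => (z : L2Vec Ω)) hw
    exact Subtype.ext (eq_zero_of_grad_eq_zero hd hΩo hΩb h1)
  let E := LinearEquiv.ofBijective e he
  let P : H01 Ω →L[ℝ] H01 Ω := (PM0 Ω M).subtypeL.comp
    ((LinearMap.toContinuousLinearMap (E.symm : G →ₗ[ℝ] PM0 Ω M)).comp
      (G.orthogonalProjectionOnto.comp gradL))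
  have hP : ∀ w, IsSpaceProj M w (P w) := by
    intro w
    refine ⟨(E.symm (G.orthogonalProjectionOnto (gradL w))).2, fun v hv => ?_⟩
    have h1 : grad (P w) = G.orthogonalProjectionOnto (gradL w) := by
      have := E.apply_symm_apply (G.orthogonalProjectionOnto (gradL w))
      exact congrArg (fun z : G => (z : L2Vec Ω)) this
    have h2 : grad (P w - w) = grad (P w) - grad w := by
      simp only [← gradL_apply, map_sub]
    have h3 : grad v ∈ G := ⟨v, hv, rfl⟩
    have h4 := G.starProjection_inner_eq_zero (grad w) (grad v) h3
    rw [h2, h1, ← neg_sub, inner_neg_left]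
    rw [gradL_apply]
    exact neg_eq_zero.2 h4
  refine ⟨P, fun w => ?_, hP⟩
  have hex : ∃ p, IsSpaceProj M w p := ⟨_, hP w⟩
  rw [spaceProj, dif_pos hex]
  exact hex.choose_spec.unique hd hΩo hΩb (hP w)

/-- The defining orthogonality is tested with `p` itself, and Cauchy-Schwarz is applied. -/
lemma IsSpaceProj.norm_grad_le {M : ℕ} {w p : H01 Ω} (h : IsSpaceProj M w p) :
    ‖grad p‖ ≤ ‖grad w‖ := by
  have h1 := h.2 p h.1
  have h2 : grad (p - w) = grad p - grad w := by simp only [← gradL_apply, map_sub]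
  rw [h2, inner_sub_left, real_inner_self_eq_norm_sq] at h1
  have h3 := real_inner_le_norm (grad w) (grad p)
  by_contra! hlt
  nlinarith [norm_nonneg (grad w), norm_nonneg (grad p)]

/-- The Laplacian of the projection in space is a bounded linear operator. -/
lemma exists_lapL (hΩo : IsOpen Ω) (hΩb : Bornology.IsBounded Ω) (M : ℕ)
    (P : H01 Ω →L[ℝ] H01 Ω) (hP : ∀ w, P w ∈ PM0 Ω M) :
    ∃ Λ : H01 Ω →L[ℝ] L2 Ω, ∀ w, lap (P w) = Λ w := by
  have hfin := finiteDimensional_PM0 hΩo hΩb M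
  let ℓ : PM0 Ω M →ₗ[ℝ] L2 Ω :=
    { toFun := fun w => lap (w : H01 Ω)
      map_add' := fun v w => by
        refine (hasLaplacian_lap hΩo hΩb (v + w).2).unique hΩo hΩb fun φ => ?_
        have hg : grad ((v + w : PM0 Ω M) : H01 Ω) = grad (v : H01 Ω) + grad (w : H01 Ω) := rfl
        rw [inner_add_left, hg, inner_add_left, hasLaplacian_lap hΩo hΩb v.2,
          hasLaplacian_lap hΩo hΩb w.2]
        ring
      map_smul' := fun c w => by
        refine (hasLaplacian_lap hΩo hΩb (c • w).2).unique hΩo hΩb fun φ => ?_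
        have hg : grad ((c • w : PM0 Ω M) : H01 Ω) = c • grad (w : H01 Ω) := rfl
        rw [RingHom.id_apply, hg, real_inner_smul_left, real_inner_smul_left,
          hasLaplacian_lap hΩo hΩb w.2]
        ring }
  -- Continuity comes from finite dimension, so the operator norm may depend on `M`. It never enters
  -- an estimate: later arguments only use that `Λ` is continuous and commutes with integrals.
  exact ⟨(LinearMap.toContinuousLinearMap ℓ).comp (P.codRestrict _ hP), fun w => rfl⟩

end Proj

/-! ### The nonlinearity as a Lipschitz map of `L²(Ω)`. -/

section Nemytskii

variable {d : ℕ} {Ω : Set (Sp d)}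

/-- The superposition operator of a Lipschitz function on `L²(Ω)`. -/
lemma exists_superposition (hΩb : Bornology.IsBounded Ω) {f : ℝ → ℝ} {L : ℝ}
    (hf : Differentiable ℝ f) (hL : ∀ s, |deriv f s| < L) :
    ∃ F : L2 Ω → L2 Ω, (∀ w, F w =ᵐ[volume.restrict Ω] fun x => f (w x)) ∧
      (∀ v w, ‖F v - F w‖ ≤ L * ‖v - w‖) := by
  have : IsFiniteMeasure (volume.restrict Ω) := ⟨by simpa using hΩb.measure_lt_top⟩
  have hlip : ∀ s t, ‖f s - f t‖ ≤ L * ‖s - t‖ := fun s t =>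
    Convex.norm_image_sub_le_of_norm_deriv_le (s := univ) (fun x _ => hf x)
      (fun x _ => (hL x).le) convex_univ (mem_univ t) (mem_univ s)
  have hmem : ∀ w : L2 Ω, MemLp (fun x => f (w x)) 2 (volume.restrict Ω) := by
    intro w
    -- The difference to the constant `f 0` is dominated by `L |w|`; the constant is square
    -- integrable because `Ω` has finite measure.
    have h1 : MemLp (fun x => f (w x) - f 0) 2 (volume.restrict Ω) := by
      refine MemLp.of_le_mul (c := L) (Lp.memLp w) ?_ ?_
      · exact ((hf.continuous.comp_aestronglyMeasurable (Lp.aestronglyMeasurable w))).sub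
          aestronglyMeasurable_const
      · filter_upwards with x
        simpa using hlip (w x) 0
    have h2 := h1.add (memLp_const (f 0))
    have e : (fun x => f (w x) - f 0) + (fun _ => f 0) = fun x => f (w x) := by
      ext x; simp
    rwa [e] at h2
  refine ⟨fun w => (hmem w).toLp, fun w => (hmem w).coeFn_toLp, fun v w => ?_⟩
  refine Lp.norm_le_mul_norm_of_ae_le_mul ?_
  filter_upwards [Lp.coeFn_sub ((hmem v).toLp) ((hmem w).toLp), Lp.coeFn_sub v w,
    (hmem v).coeFn_toLp, (hmem w).coeFn_toLp] with x e1 e2 e3 e4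
  rw [e1, e2, Pi.sub_apply, Pi.sub_apply, e3, e4]
  exact hlip _ _

end Nemytskii

/-! ### Vector-valued polynomials in time. -/

section TimePoly

variable {X Y : Type*}

/-- Polynomials in time of degree less than `m` with coefficients in `S`. -/
def tpoly [AddCommGroup X] [Module ℝ X] (m : ℕ) (S : Submodule ℝ X) : Submodule ℝ (ℝ → X) where
  carrier := {g | ∃ c : ℕ → X, (∀ i, c i ∈ S) ∧ ∀ t, g t = ∑ i ∈ Finset.range m, t ^ i • c i}
  zero_mem' := ⟨0, fun _ => S.zero_mem, fun t => by simp⟩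
  add_mem' := by
    rintro g h ⟨c, hc, hg⟩ ⟨e, he, hh⟩
    refine ⟨c + e, fun i => S.add_mem (hc i) (he i), fun t => ?_⟩
    simp [hg, hh, Finset.sum_add_distrib]
  smul_mem' := by
    rintro r g ⟨c, hc, hg⟩
    refine ⟨r • c, fun i => S.smul_mem r (hc i), fun t => ?_⟩
    simp [hg, Finset.smul_sum, smul_comm r]

section Algebra

variable [AddCommGroup X] [Module ℝ X] [AddCommGroup Y] [Module ℝ Y] {m : ℕ} {S : Submodule ℝ X}

/-- `tpoly` counts coefficients rather than degree: degree at most `N` is `tpoly (N + 1)`, and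
derivatives of such functions lie in `tpoly N`, the space of the functions `w` in the error
equation. -/
lemma isTimePoly_iff {N : ℕ} {g : ℝ → X} : IsTimePoly N S g ↔ g ∈ tpoly (N + 1) S := Iff.rfl

lemma pow_smul_mem_tpoly {i : ℕ} (hi : i < m) {x : X} (hx : x ∈ S) :
    (fun t : ℝ => t ^ i • x) ∈ tpoly m S := by
  refine ⟨fun j => if j = i then x else 0, fun j => ?_, fun t => ?_⟩
  · dsimp only
    split_ifs
    · exact hx
    · exact S.zero_mem
  · simp [hi]

lemma const_mem_tpoly (hm : 0 < m) {x : X} (hx : x ∈ S) : (fun _ : ℝ => x) ∈ tpoly m S := by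
  simpa using pow_smul_mem_tpoly hm hx

lemma tpoly_le {W : Submodule ℝ (ℝ → X)}
    (h : ∀ i < m, ∀ x ∈ S, (fun t : ℝ => t ^ i • x) ∈ W) : tpoly m S ≤ W := by
  rintro g ⟨c, hc, hg⟩
  have : g = ∑ i ∈ Finset.range m, fun t : ℝ => t ^ i • c i := by
    ext t; simp [hg]
  rw [this]
  exact sum_mem fun i hi => h i (Finset.mem_range.1 hi) _ (hc i)

lemma eval_mem_of_tpoly {g : ℝ → X} (hg : g ∈ tpoly m S) (t : ℝ) : g t ∈ S := by
  obtain ⟨c, hc, hg⟩ := hg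
  rw [hg]
  exact sum_mem fun i _ => S.smul_mem _ (hc i)

lemma map_mem_tpoly {g : ℝ → X} (hg : g ∈ tpoly m S) (Λ : X →ₗ[ℝ] Y) {S' : Submodule ℝ Y}
    (h : ∀ x ∈ S, Λ x ∈ S') : (fun t => Λ (g t)) ∈ tpoly m S' := by
  obtain ⟨c, hc, hg⟩ := hg
  exact ⟨fun i => Λ (c i), fun i => h _ (hc i), fun t => by simp [hg]⟩

lemma smul_const_mem_tpoly {q : ℝ → ℝ} (hq : q ∈ tpoly m (⊤ : Submodule ℝ ℝ)) {x : X}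
    (hx : x ∈ S) : (fun t => q t • x) ∈ tpoly m S :=
  map_mem_tpoly hq (LinearMap.toSpanSingleton ℝ X x) fun r _ => S.smul_mem r hx

lemma polynomial_eval_mem_tpoly {p : Polynomial ℝ} (hp : p.natDegree < m) :
    (fun t => p.eval t) ∈ tpoly m (⊤ : Submodule ℝ ℝ) :=
  ⟨p.coeff, fun _ => trivial, fun t => by
    change p.eval t = _
    rw [Polynomial.eval_eq_sum_range' hp]
    exact Finset.sum_congr rfl fun i _ => mul_comm _ _⟩

lemma comp_affine_mem_tpoly {g : ℝ → X} (hg : g ∈ tpoly m S) (α β : ℝ) :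
    (fun t => g (α * t + β)) ∈ tpoly m S := by
  let Φ : (ℝ → X) →ₗ[ℝ] (ℝ → X) := LinearMap.funLeft ℝ X fun t => α * t + β
  have : tpoly m S ≤ (tpoly m S).comap Φ := by
    refine tpoly_le fun i hi x hx => ?_
    change (fun t => (α * t + β) ^ i • x) ∈ tpoly m S
    refine smul_const_mem_tpoly ?_ hx
    have h := polynomial_eval_mem_tpoly (m := m)
      (p := (Polynomial.C α * Polynomial.X + Polynomial.C β) ^ i) ?_
    · simpa using h
    · refine lt_of_le_of_lt (Polynomial.natDegree_pow_le_of_le i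
        (Polynomial.natDegree_linear_le)) ?_
      simpa using hi
  exact this hg

end Algebra

section Calculus

variable [NormedAddCommGroup X] [NormedSpace ℝ X] {m : ℕ} {S : Submodule ℝ X}

lemma continuous_of_tpoly {g : ℝ → X} (hg : g ∈ tpoly m S) : Continuous g := by
  obtain ⟨c, -, hg⟩ := hg
  rw [funext hg]
  fun_prop

lemma exists_hasDerivAt_of_tpoly {g : ℝ → X} (hg : g ∈ tpoly (m + 1) S) :
    ∃ g' ∈ tpoly m S, ∀ t, HasDerivAt g (g' t) t := by
  obtain ⟨c, hc, hg⟩ := hg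
  refine ⟨fun t => ∑ i ∈ Finset.range m, t ^ i • ((i + 1 : ℝ) • c (i + 1)),
    ⟨_, fun i => S.smul_mem _ (hc _), fun t => rfl⟩, fun t => ?_⟩
  rw [funext hg]
  have h := HasDerivAt.fun_sum (u := Finset.range (m + 1)) (A := fun i (s : ℝ) => s ^ i • c i)
    (A' := fun i => ((i : ℝ) * t ^ (i - 1)) • c i) (x := t)
    fun i _ => (hasDerivAt_pow i t).smul_const (c i)
  rw [Finset.sum_range_succ'] at h
  convert! h using 1
  simp [smul_smul, mul_comm]

lemma deriv_mem_tpoly {g : ℝ → X} (hg : g ∈ tpoly (m + 1) S) : deriv g ∈ tpoly m S := by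
  obtain ⟨g', h, h'⟩ := exists_hasDerivAt_of_tpoly hg
  rwa [show deriv g = g' from funext fun t => (h' t).deriv]

lemma hasDerivAt_of_tpoly {g : ℝ → X} (hg : g ∈ tpoly m S) (t : ℝ) :
    HasDerivAt g (deriv g t) t := by
  cases m with
  | zero =>
    obtain ⟨c, -, hg⟩ := hg
    have : g = fun _ => 0 := funext fun t => by simp [hg]
    subst this
    simpa using hasDerivAt_const t (0 : X)
  | succ k =>
    obtain ⟨g', -, h'⟩ := exists_hasDerivAt_of_tpoly hg
    rw [(h' t).deriv]
    exact h' t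

lemma integral_deriv_of_tpoly [CompleteSpace X] {g : ℝ → X} (hg : g ∈ tpoly (m + 1) S)
    (a b : ℝ) : ∫ t in a..b, deriv g t = g b - g a :=
  intervalIntegral.integral_eq_sub_of_hasDerivAt (fun t _ => hasDerivAt_of_tpoly hg t)
    ((continuous_of_tpoly (deriv_mem_tpoly hg)).intervalIntegrable a b)

lemma integral_mem_tpoly [CompleteSpace X] {g : ℝ → X} (hg : g ∈ tpoly m S) (a : ℝ) :
    (fun t => ∫ s in a..t, g s) ∈ tpoly (m + 1) S := by
  obtain ⟨c, hc, hg⟩ := hg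
  have h : (fun t => ∫ s in a..t, g s) = ∑ i ∈ Finset.range m,
      ((fun t : ℝ => t ^ (i + 1) • ((i + 1 : ℝ)⁻¹ • c i)) -
        fun _ => a ^ (i + 1) • ((i + 1 : ℝ)⁻¹ • c i)) := by
    ext t
    rw [funext hg, intervalIntegral.integral_finsetSum
      (fun i _ => (Continuous.intervalIntegrable (by fun_prop) _ _))]
    rw [Finset.sum_apply]
    refine Finset.sum_congr rfl fun i _ => ?_
    rw [intervalIntegral.integral_smul_const, integral_pow]
    simp only [Pi.sub_apply, ← sub_smul, smul_smul, div_eq_mul_inv, sub_mul]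
  rw [h]
  refine sum_mem fun i hi => Submodule.sub_mem _ ?_ ?_
  · exact pow_smul_mem_tpoly (by simpa using hi) (S.smul_mem _ (hc i))
  · exact const_mem_tpoly (Nat.succ_pos _) (S.smul_mem _ (S.smul_mem _ (hc i)))

end Calculus

end TimePoly

/-! ### Weighted Gram matrices and dual bases of the monomials. -/

section DualBasis

/-- The Gram matrix of the monomials for the weight `η` on `[a, b]`. -/
def gram (a b : ℝ) (η : ℝ → ℝ) (m : ℕ) : Matrix (Fin m) (Fin m) ℝ :=
  fun i j => ∫ s in a..b, η s * (s ^ (i : ℕ) * s ^ (j : ℕ))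

/-- If `c` is in the kernel, the quadratic form gives `∫ η p² = 0` for `p = ∑ c_i s^i`. Then `p`
vanishes on `(a, b)` and has infinitely many roots. The weight may vanish at the end points, as `η =
id` on `[0, 1]` does in `exists_kernel`. -/
lemma isUnit_gram {a b : ℝ} (hab : a < b) {η : ℝ → ℝ} (hη : Continuous η)
    (hnn : ∀ s ∈ Icc a b, 0 ≤ η s) (hpos : ∀ s ∈ Ioo a b, 0 < η s) (m : ℕ) :
    IsUnit (gram a b η m) := by
  rw [← Matrix.mulVec_injective_iff_isUnit, ← Matrix.coe_mulVecLin,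
    ← LinearMap.ker_eq_bot, LinearMap.ker_eq_bot']
  intro c hc
  rw [Matrix.mulVecLin_apply] at hc
  let p : ℝ → ℝ := fun s => ∑ i : Fin m, c i * s ^ (i : ℕ)
  have hpc : Continuous p := by fun_prop
  have h0 : ∫ s in a..b, η s * p s ^ 2 = 0 := by
    have h1 : ∀ i, ∑ j, gram a b η m i j * c j = 0 := fun i => congrFun hc i
    have h2 : ∑ i, c i * ∑ j, gram a b η m i j * c j = 0 := by simp [h1]
    rw [← h2]
    have h3 : ∀ s, η s * p s ^ 2 =
        ∑ i : Fin m, ∑ j : Fin m, c i * c j * (η s * (s ^ (i : ℕ) * s ^ (j : ℕ))) := by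
      intro s
      rw [sq, Finset.sum_mul_sum, Finset.mul_sum]
      refine Finset.sum_congr rfl fun i _ => ?_
      rw [Finset.mul_sum]
      exact Finset.sum_congr rfl fun j _ => by ring
    simp_rw [h3]
    rw [intervalIntegral.integral_finsetSum
      (fun i _ => (Continuous.intervalIntegrable (by fun_prop) _ _))]
    refine Finset.sum_congr rfl fun i _ => ?_
    rw [intervalIntegral.integral_finsetSum
      (fun i _ => (Continuous.intervalIntegrable (by fun_prop) _ _)), Finset.mul_sum]
    refine Finset.sum_congr rfl fun j _ => ?_
    rw [intervalIntegral.integral_const_mul, gram]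
    ring
  have hz : ∀ s ∈ Ioo a b, p s = 0 := by
    by_contra! hne
    obtain ⟨s, hs, hps⟩ := hne
    have : 0 < ∫ s in a..b, η s * p s ^ 2 :=
      intervalIntegral.integral_pos hab (by fun_prop)
        (fun x hx => mul_nonneg (hnn x (Ioc_subset_Icc_self hx)) (sq_nonneg _))
        ⟨s, Ioo_subset_Icc_self hs, mul_pos (hpos s hs) (by positivity)⟩
    linarith
  let P : Polynomial ℝ := ∑ i : Fin m, Polynomial.C (c i) * Polynomial.X ^ (i : ℕ)
  have hP : P = 0 := by
    refine Polynomial.eq_zero_of_infinite_isRoot P ((Ioo_infinite hab).mono fun s hs => ?_)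
    have := hz s hs
    simpa [P, p, Polynomial.IsRoot, Polynomial.eval_finsetSum] using this
  ext i
  have := congrArg (fun q => Polynomial.coeff q (i : ℕ)) hP
  simpa [P, Polynomial.finsetSum_coeff, Polynomial.coeff_C_mul, Polynomial.coeff_X_pow,
    Fin.val_inj] using this

/-- The dual basis of the monomials of degree less than `m` for the weight `η` on `[a, b]`. -/
def dualMonomial (a b : ℝ) (η : ℝ → ℝ) (m : ℕ) (i : Fin m) (s : ℝ) : ℝ :=
  ∑ j, (gram a b η m)⁻¹ i j * s ^ (j : ℕ)

variable {a b : ℝ} {η : ℝ → ℝ} {m : ℕ}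

lemma continuous_dualMonomial (i : Fin m) : Continuous (dualMonomial a b η m i) := by
  unfold dualMonomial
  fun_prop

lemma dualMonomial_mem (i : Fin m) :
    dualMonomial a b η m i ∈ tpoly m (⊤ : Submodule ℝ ℝ) := by
  have : dualMonomial a b η m i =
      ∑ j : Fin m, fun s : ℝ => s ^ (j : ℕ) • (gram a b η m)⁻¹ i j := by
    ext s
    simp [dualMonomial, mul_comm]
  rw [this]
  exact sum_mem fun j _ => pow_smul_mem_tpoly j.2 trivial

lemma integral_dualMonomial_mul (hab : a < b) (hη : Continuous η)
    (hnn : ∀ s ∈ Icc a b, 0 ≤ η s) (hpos : ∀ s ∈ Ioo a b, 0 < η s) (i j : Fin m) :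
    ∫ s in a..b, dualMonomial a b η m i s * (η s * s ^ (j : ℕ)) = if i = j then 1 else 0 := by
  have hu := isUnit_gram hab hη hnn hpos m
  have h := congrFun (congrFun (Matrix.nonsing_inv_mul (gram a b η m)
    ((Matrix.isUnit_iff_isUnit_det _).1 hu)) i) j
  rw [Matrix.mul_apply, Matrix.one_apply] at h
  rw [← h]
  simp_rw [dualMonomial, Finset.sum_mul]
  rw [intervalIntegral.integral_finsetSum
    (fun i _ => (Continuous.intervalIntegrable (by fun_prop) _ _))]
  refine Finset.sum_congr rfl fun k _ => ?_
  rw [gram, ← intervalIntegral.integral_const_mul]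
  congr 1
  ext s
  ring

lemma pow_eq_sum_dualMonomial (hab : a < b) (hη : Continuous η)
    (hnn : ∀ s ∈ Icc a b, 0 ≤ η s) (hpos : ∀ s ∈ Ioo a b, 0 < η s) (i : Fin m) (s : ℝ) :
    s ^ (i : ℕ) = ∑ j, gram a b η m i j * dualMonomial a b η m j s := by
  have hu := isUnit_gram hab hη hnn hpos m
  have h := Matrix.mul_nonsing_inv (gram a b η m) ((Matrix.isUnit_iff_isUnit_det _).1 hu)
  have h1 : ∀ k, ∑ j, gram a b η m i j * (gram a b η m)⁻¹ j k = if i = k then 1 else 0 := by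
    intro k
    have := congrFun (congrFun h i) k
    rwa [Matrix.mul_apply, Matrix.one_apply] at this
  simp_rw [dualMonomial, Finset.mul_sum, ← mul_assoc]
  rw [Finset.sum_comm]
  simp_rw [← Finset.sum_mul, h1]
  simp

end DualBasis

/-! ### The `L²`-projection to polynomials in time, for Banach space valued functions. -/

section PolyProj

variable {X Y : Type*} [NormedAddCommGroup X] [NormedSpace ℝ X]
  [NormedAddCommGroup Y] [NormedSpace ℝ Y] {a b : ℝ} {m : ℕ}

/-- The `L²(a, b)`-projection to the polynomials of degree less than `m`. -/
def polyProj (a b : ℝ) (m : ℕ) (g : ℝ → X) (t : ℝ) : X :=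
  ∑ j : Fin m, t ^ (j : ℕ) • ∫ s in a..b, dualMonomial a b (fun _ => 1) m j s • g s

lemma polyProj_mem (g : ℝ → X) : polyProj a b m g ∈ tpoly m (⊤ : Submodule ℝ X) := by
  have : polyProj a b m g = ∑ j : Fin m, fun t : ℝ =>
      t ^ (j : ℕ) • ∫ s in a..b, dualMonomial a b (fun _ => 1) m j s • g s := by
    ext t; simp [polyProj]
  rw [this]
  exact sum_mem fun j _ => pow_smul_mem_tpoly j.2 trivial

lemma intervalIntegrable_smul {q : ℝ → ℝ} {g : ℝ → X}
    (hg : IntervalIntegrable g volume a b) (hq : Continuous q) :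
    IntervalIntegrable (fun s => q s • g s) volume a b :=
  hg.continuousOn_smul hq.continuousOn

lemma integral_smul_sub {q : ℝ → ℝ} {g r : ℝ → X} (hq : Continuous q)
    (hg : IntervalIntegrable g volume a b) (hr : IntervalIntegrable r volume a b) :
    ∫ s in a..b, q s • (g s - r s) = (∫ s in a..b, q s • g s) - ∫ s in a..b, q s • r s := by
  simp_rw [smul_sub]
  exact intervalIntegral.integral_sub (intervalIntegrable_smul hg hq)
    (intervalIntegrable_smul hr hq)

/-- The projection is a finite combination of weighted integrals, so bounded operators commute with
it. This transfers orthogonality and best approximation to the images under `valL`, `gradL`, `Λ` and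
`P - id`. -/
lemma map_polyProj [CompleteSpace X] [CompleteSpace Y] {g : ℝ → X}
    (hg : IntervalIntegrable g volume a b) (Λ : X →L[ℝ] Y) (t : ℝ) :
    Λ (polyProj a b m g t) = polyProj a b m (fun s => Λ (g s)) t := by
  simp only [polyProj, map_sum, map_smul]
  refine Finset.sum_congr rfl fun j _ => ?_
  rw [← Λ.intervalIntegral_comp_comm (intervalIntegrable_smul hg (continuous_dualMonomial j))]
  simp

lemma integral_dualMonomial_smul_tpoly [CompleteSpace X] (hab : a < b) {c : ℕ → X} (i : Fin m) :
    ∫ s in a..b, dualMonomial a b (fun _ => 1) m i s • (∑ j ∈ Finset.range m, s ^ j • c j)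
      = c i := by
  simp_rw [Finset.smul_sum, smul_smul]
  refine (intervalIntegral.integral_finsetSum fun j _ => Continuous.intervalIntegrable
    (((continuous_dualMonomial i).mul (continuous_pow j)).smul continuous_const) _ _).trans ?_
  refine (Finset.sum_congr rfl fun j _ => intervalIntegral.integral_smul_const
    (fun s => dualMonomial a b (fun _ => 1) m i s * s ^ j) (c j)).trans ?_
  rw [Finset.sum_range]
  have h := integral_dualMonomial_mul (m := m) hab (η := fun _ => 1) continuous_const
    (fun _ _ => zero_le_one) (fun _ _ => zero_lt_one) i
  simp only [one_mul] at h
  simp [h]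

lemma polyProj_of_tpoly [CompleteSpace X] (hab : a < b) {r : ℝ → X}
    (hr : r ∈ tpoly m (⊤ : Submodule ℝ X)) : polyProj a b m r = r := by
  obtain ⟨c, -, hc⟩ := hr
  ext t
  rw [polyProj, hc, Finset.sum_range]
  simp_rw [hc]
  refine Finset.sum_congr rfl fun j _ => ?_
  rw [integral_dualMonomial_smul_tpoly hab]

/-- The coefficients of the projection are the moments of `g` against the dual basis. By
biorthogonality the projection has the same moments, and every polynomial is a combination of dual
basis elements. -/
lemma integral_smul_sub_polyProj [CompleteSpace X] (hab : a < b) {g : ℝ → X}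
    (hg : IntervalIntegrable g volume a b) {z : ℝ → ℝ} (hz : z ∈ tpoly m (⊤ : Submodule ℝ ℝ)) :
    ∫ s in a..b, z s • (g s - polyProj a b m g s) = 0 := by
  have hp := polyProj_mem (a := a) (b := b) (m := m) g
  have hpc := continuous_of_tpoly hp
  have hgp := hg.sub (hpc.intervalIntegrable a b)
  have h1 : ∀ i : Fin m, ∫ s in a..b,
      dualMonomial a b (fun _ => 1) m i s • (g s - polyProj a b m g s) = 0 := by
    intro i
    rw [integral_smul_sub (continuous_dualMonomial i) hg (hpc.intervalIntegrable _ _)]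
    have h2 := integral_dualMonomial_smul_tpoly (m := m) hab (i := i)
      -- The moments are indexed by `Fin m`; extending them by zero gives a coefficient sequence on
      -- `ℕ`, of which only the entries below `m` are used.
      (c := fun j => if h : j < m then
        ∫ s in a..b, dualMonomial a b (fun _ => 1) m ⟨j, h⟩ s • g s else 0)
    simp only [Finset.sum_range, Fin.is_lt, dif_pos, Fin.eta] at h2
    rw [sub_eq_zero]
    exact h2.symm
  obtain ⟨c, -, hc⟩ := hz
  have h3 : ∀ s, z s • (g s - polyProj a b m g s) = ∑ i : Fin m, ∑ j : Fin m,
      (c i * gram a b (fun _ => 1) m i j) •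
        (dualMonomial a b (fun _ => 1) m j s • (g s - polyProj a b m g s)) := by
    intro s
    rw [hc, Finset.sum_range, Finset.sum_smul]
    refine Finset.sum_congr rfl fun i _ => ?_
    rw [pow_eq_sum_dualMonomial hab (η := fun _ => 1) continuous_const
      (fun _ _ => zero_le_one) (fun _ _ => zero_lt_one) i s, smul_eq_mul, Finset.sum_mul,
      Finset.sum_smul]
    refine Finset.sum_congr rfl fun j _ => ?_
    rw [smul_smul]
    congr 1
    ring
  have hint : ∀ j : Fin m, IntervalIntegrable (fun s => dualMonomial a b (fun _ => 1) m j s •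
      (g s - polyProj a b m g s)) volume a b :=
    fun j => intervalIntegrable_smul hgp (continuous_dualMonomial j)
  simp_rw [h3]
  rw [intervalIntegral.integral_finsetSum]
  · refine Finset.sum_eq_zero fun i _ => ?_
    refine (intervalIntegral.integral_finsetSum fun j _ => (hint j).smul _).trans ?_
    refine Finset.sum_eq_zero fun j _ => ?_
    refine (intervalIntegral.integral_smul _ _).trans ?_
    rw [h1, smul_zero]
  · intro i _
    have := IntervalIntegrable.sum (μ := volume) (a := a) (b := b) (Finset.univ : Finset (Fin m))
      (f := fun j s => (c i * gram a b (fun _ => 1) m i j) •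
        (dualMonomial a b (fun _ => 1) m j s • (g s - polyProj a b m g s)))
      (fun j _ => (hint j).smul _)
    simpa [Finset.sum_fn] using this

/-- The projection is characterized by orthogonality. -/
lemma eq_polyProj [CompleteSpace X] (hab : a < b) {g r : ℝ → X}
    (hg : IntervalIntegrable g volume a b) (hr : r ∈ tpoly m (⊤ : Submodule ℝ X))
    (h : ∀ z ∈ tpoly m (⊤ : Submodule ℝ ℝ), ∫ s in a..b, z s • (g s - r s) = 0) :
    r = polyProj a b m g := by
  rw [← polyProj_of_tpoly hab hr]
  ext t
  rw [polyProj, polyProj]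
  refine Finset.sum_congr rfl fun j _ => ?_
  have h1 := h _ (dualMonomial_mem (a := a) (b := b) (η := fun _ => 1) j)
  rw [integral_smul_sub (continuous_dualMonomial j) hg
    ((continuous_of_tpoly hr).intervalIntegrable _ _), sub_eq_zero] at h1
  rw [h1]

end PolyProj

/-! ### Orthogonality and best approximation in Hilbert spaces. -/

section PolyProjInner

variable {Y : Type*} [NormedAddCommGroup Y] [InnerProductSpace ℝ Y] [CompleteSpace Y]
  {a b : ℝ} {m : ℕ}

lemma integral_inner_sub_polyProj (hab : a < b) {g w : ℝ → Y}
    (hg : IntervalIntegrable g volume a b) (hw : w ∈ tpoly m (⊤ : Submodule ℝ Y)) :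
    ∫ s in a..b, ⟪g s - polyProj a b m g s, w s⟫_ℝ = 0 := by
  have hp := polyProj_mem (a := a) (b := b) (m := m) g
  have hgp := hg.sub ((continuous_of_tpoly hp).intervalIntegrable a b)
  obtain ⟨c, -, hc⟩ := hw
  have h1 : ∀ s, ⟪g s - polyProj a b m g s, w s⟫_ℝ =
      ∑ i ∈ Finset.range m, innerSL ℝ (c i) (s ^ i • (g s - polyProj a b m g s)) := by
    intro s
    rw [hc, inner_sum]
    refine Finset.sum_congr rfl fun i _ => ?_
    rw [innerSL_apply_apply, real_inner_smul_right, real_inner_smul_right, real_inner_comm]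
  simp_rw [h1]
  have hint : ∀ i, IntervalIntegrable (fun s => s ^ i • (g s - polyProj a b m g s)) volume a b :=
    fun i => intervalIntegrable_smul hgp (continuous_pow i)
  rw [intervalIntegral.integral_finsetSum]
  · refine Finset.sum_eq_zero fun i hi => ?_
    rw [(innerSL ℝ (c i)).intervalIntegral_comp_comm (hint i)]
    have hz : (fun s : ℝ => s ^ i) ∈ tpoly m (⊤ : Submodule ℝ ℝ) := by
      simpa using pow_smul_mem_tpoly (S := (⊤ : Submodule ℝ ℝ)) (Finset.mem_range.1 hi)
        (x := 1) trivial
    rw [integral_smul_sub_polyProj hab hg hz, map_zero]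
  · intro i _
    exact ⟨(innerSL ℝ (c i)).integrable_comp (hint i).1,
      (innerSL ℝ (c i)).integrable_comp (hint i).2⟩

lemma memLp_intervalIntegrable {X : Type*} [NormedAddCommGroup X] {g : ℝ → X} (hab : a ≤ b)
    (hg : MemLp g 2 (volume.restrict (Ioc a b))) : IntervalIntegrable g volume a b :=
  (intervalIntegrable_iff_integrableOn_Ioc_of_le hab).2 (hg.integrable (by norm_num))

lemma memLp_intervalIntegrable_norm_sq {X : Type*} [NormedAddCommGroup X] {g : ℝ → X}
    (hab : a ≤ b) (hg : MemLp g 2 (volume.restrict (Ioc a b))) :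
    IntervalIntegrable (fun s => ‖g s‖ ^ 2) volume a b :=
  (intervalIntegrable_iff_integrableOn_Ioc_of_le hab).2 (hg.integrable_norm_pow (by norm_num))

lemma memLp_Ioc_of_continuous {X : Type*} [NormedAddCommGroup X] {g : ℝ → X}
    (hg : Continuous g) : MemLp g 2 (volume.restrict (Ioc a b)) := by
  obtain ⟨C, hC⟩ := (isCompact_Icc (a := a) (b := b)).exists_bound_of_continuousOn hg.continuousOn
  refine MemLp.of_bound hg.aestronglyMeasurable C ?_
  filter_upwards [ae_restrict_mem measurableSet_Ioc] with x hx
  exact hC x (Ioc_subset_Icc_self hx)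

lemma memLp_integrable_inner {Z : Type*} [NormedAddCommGroup Z] [InnerProductSpace ℝ Z]
    {α : Type*} [MeasurableSpace α] {μ : Measure α} {g w : α → Z}
    (hg : MemLp g 2 μ) (hw : MemLp w 2 μ) : Integrable (fun s => ⟪g s, w s⟫_ℝ) μ := by
  refine (L2.integrable_inner (𝕜 := ℝ) hg.toLp hw.toLp).congr ?_
  filter_upwards [hg.coeFn_toLp, hw.coeFn_toLp] with x h1 h2
  rw [h1, h2]

/-- Pythagoras: the cross term pairs the projection error with a polynomial of degree less than `m`.
Both best approximation and stability of the projection follow. -/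
lemma integral_inner_polyProj_add (hab : a < b) {g w : ℝ → Y}
    (hg : MemLp g 2 (volume.restrict (Ioc a b))) (hw : w ∈ tpoly m (⊤ : Submodule ℝ Y)) :
    ∫ s in a..b, ‖g s - w s‖ ^ 2 =
      (∫ s in a..b, ‖g s - polyProj a b m g s‖ ^ 2) +
      ∫ s in a..b, ‖polyProj a b m g s - w s‖ ^ 2 := by
  have hp := polyProj_mem (a := a) (b := b) (m := m) g
  have hpc := continuous_of_tpoly hp
  have hwc := continuous_of_tpoly hw
  have hgi := memLp_intervalIntegrable hab.le hg
  have h0 := integral_inner_sub_polyProj hab hgi (Submodule.sub_mem _ hp hw)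
  have h1 : ∀ s, ‖g s - w s‖ ^ 2 = ‖g s - polyProj a b m g s‖ ^ 2 +
      2 * ⟪g s - polyProj a b m g s, (polyProj a b m g - w) s⟫_ℝ +
      ‖polyProj a b m g s - w s‖ ^ 2 := by
    intro s
    rw [Pi.sub_apply, ← norm_add_sq_real]
    congr 2
    abel
  have hm := hg.sub (memLp_Ioc_of_continuous (a := a) (b := b) hpc)
  have i1 : IntervalIntegrable (fun s => ‖g s - polyProj a b m g s‖ ^ 2) volume a b :=
    memLp_intervalIntegrable_norm_sq hab.le hm
  have i2 : IntervalIntegrable (fun s =>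
      2 * ⟪g s - polyProj a b m g s, (polyProj a b m g - w) s⟫_ℝ) volume a b := by
    refine IntervalIntegrable.const_mul ?_ 2
    refine (intervalIntegrable_iff_integrableOn_Ioc_of_le hab.le).2 ?_
    exact memLp_integrable_inner hm (memLp_Ioc_of_continuous (hpc.sub hwc))
  have i3 : IntervalIntegrable (fun s => ‖polyProj a b m g s - w s‖ ^ 2) volume a b :=
    ((hpc.sub hwc).norm.pow 2).intervalIntegrable _ _
  simp_rw [h1]
  rw [intervalIntegral.integral_add (i1.add i2) i3, intervalIntegral.integral_add i1 i2,
    intervalIntegral.integral_const_mul, h0]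
  ring

lemma integral_norm_sub_polyProj_sq_le (hab : a < b) {g w : ℝ → Y}
    (hg : MemLp g 2 (volume.restrict (Ioc a b))) (hw : w ∈ tpoly m (⊤ : Submodule ℝ Y)) :
    ∫ s in a..b, ‖g s - polyProj a b m g s‖ ^ 2 ≤ ∫ s in a..b, ‖g s - w s‖ ^ 2 := by
  rw [integral_inner_polyProj_add hab hg hw, le_add_iff_nonneg_right]
  exact intervalIntegral.integral_nonneg hab.le fun s _ => sq_nonneg _

lemma integral_norm_polyProj_sq_le (hab : a < b) {g : ℝ → Y}
    (hg : MemLp g 2 (volume.restrict (Ioc a b))) :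
    ∫ s in a..b, ‖polyProj a b m g s‖ ^ 2 ≤ ∫ s in a..b, ‖g s‖ ^ 2 := by
  have h := integral_inner_polyProj_add (m := m) hab hg (Submodule.zero_mem _)
  simp only [Pi.zero_apply, sub_zero] at h
  rw [h, le_add_iff_nonneg_left]
  exact intervalIntegral.integral_nonneg hab.le fun s _ => sq_nonneg _

end PolyProjInner

/-! ### Primitives of square integrable functions. -/

section Primitive

variable {X Y : Type*} [NormedAddCommGroup X] [NormedSpace ℝ X]
  [NormedAddCommGroup Y] [NormedSpace ℝ Y] {a b : ℝ} {v dv w dw : ℝ → X}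

/-- `v` is on `[a, b]` a primitive of the square integrable function `dv`. -/
def IsPrim (a b : ℝ) (v dv : ℝ → X) : Prop :=
  MemLp dv 2 (volume.restrict (Ioc a b)) ∧ ∀ t ∈ Icc a b, v t = v a + ∫ s in a..t, dv s

lemma IsPrim.intervalIntegrable (h : IsPrim a b v dv) (hab : a ≤ b) :
    IntervalIntegrable dv volume a b := memLp_intervalIntegrable hab h.1

lemma IsPrim.mono (h : IsPrim a b v dv) {a' b' : ℝ} (ha : a ≤ a') (hab : a' ≤ b') (hb : b' ≤ b) :
    IsPrim a' b' v dv := by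
  refine ⟨h.1.mono_measure (Measure.restrict_mono (Ioc_subset_Ioc ha hb) le_rfl), fun t ht => ?_⟩
  have hi := h.intervalIntegrable (ha.trans (hab.trans hb))
  rw [h.2 t ⟨ha.trans ht.1, ht.2.trans hb⟩, h.2 a' ⟨ha, hab.trans hb⟩, add_assoc,
    intervalIntegral.integral_add_adjacent_intervals]
  · exact hi.mono_set (by rw [uIcc_of_le ha, uIcc_of_le (ha.trans (hab.trans hb))]
                          exact Icc_subset_Icc_right (hab.trans hb))
  · exact hi.mono_set (by rw [uIcc_of_le ht.1, uIcc_of_le (ha.trans (hab.trans hb))]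
                          exact Icc_subset_Icc ha (ht.2.trans hb))

lemma IsPrim.integral_eq (h : IsPrim a b v dv) (hab : a ≤ b) :
    ∫ s in a..b, dv s = v b - v a := by
  rw [h.2 b ⟨hab, le_rfl⟩]; abel

/-- Lebesgue differentiation. The primitive formula is known only on `[a, b]`, so the end points, a
null set, are discarded to have it in a neighbourhood. -/
lemma IsPrim.ae_hasDerivAt [CompleteSpace X] (h : IsPrim a b v dv) (hab : a ≤ b) :
    ∀ᵐ t ∂(volume.restrict (Ioc a b)), HasDerivAt v (dv t) t := by
  rw [← restrict_Ioo_eq_restrict_Ioc, ae_restrict_iff' measurableSet_Ioo]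
  filter_upwards [(h.intervalIntegrable hab).ae_hasDerivAt_integral] with t ht hmem
  have h1 := (ht (by rw [uIcc_of_le hab]; exact Ioo_subset_Icc_self hmem) a left_mem_uIcc).const_add
    (v a)
  refine h1.congr_of_eventuallyEq ?_
  filter_upwards [Ioo_mem_nhds hmem.1 hmem.2] with s hs
  exact h.2 s (Ioo_subset_Icc_self hs)

lemma IsPrim.ae_deriv_eq [CompleteSpace X] (h : IsPrim a b v dv) (hab : a ≤ b) :
    ∀ᵐ t ∂(volume.restrict (Ioc a b)), deriv v t = dv t := by
  filter_upwards [h.ae_hasDerivAt hab] with t ht using ht.deriv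

lemma integral_congr_ae_Ioc {E : Type*} [NormedAddCommGroup E] [NormedSpace ℝ E] {g g' : ℝ → E}
    (hab : a ≤ b) (h : ∀ᵐ t ∂(volume.restrict (Ioc a b)), g t = g' t) :
    ∫ t in a..b, g t = ∫ t in a..b, g' t := by
  rw [intervalIntegral.integral_of_le hab, intervalIntegral.integral_of_le hab]
  exact integral_congr_ae h

lemma IsPrim.map [CompleteSpace X] [CompleteSpace Y] (h : IsPrim a b v dv) (Λ : X →L[ℝ] Y) :
    IsPrim a b (fun t => Λ (v t)) (fun t => Λ (dv t)) := by
  refine ⟨Λ.comp_memLp' h.1, fun t ht => ?_⟩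
  have hab := ht.1.trans ht.2
  dsimp only
  rw [Λ.intervalIntegral_comp_comm, h.2 t ht, map_add]
  refine (h.intervalIntegrable hab).mono_set ?_
  rw [uIcc_of_le ht.1, uIcc_of_le hab]
  exact Icc_subset_Icc_right ht.2

lemma IsPrim.sub (h : IsPrim a b v dv) (h' : IsPrim a b w dw) :
    IsPrim a b (fun t => v t - w t) (fun t => dv t - dw t) := by
  refine ⟨h.1.sub h'.1, fun t ht => ?_⟩
  have hab := ht.1.trans ht.2
  have hs : uIcc a t ⊆ uIcc a b := by
    rw [uIcc_of_le ht.1, uIcc_of_le hab]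
    exact Icc_subset_Icc_right ht.2
  dsimp only
  rw [intervalIntegral.integral_sub ((h.intervalIntegrable hab).mono_set hs)
    ((h'.intervalIntegrable hab).mono_set hs), h.2 t ht, h'.2 t ht]
  abel

lemma IsPrim.continuousOn (h : IsPrim a b v dv) (hab : a ≤ b) : ContinuousOn v (Icc a b) := by
  have h1 := intervalIntegral.continuousOn_primitive_interval (μ := volume) (a := a) (b := b)
    (f := dv) (by
      rw [uIcc_of_le hab]
      exact (integrableOn_Icc_iff_integrableOn_Ioc).2
        ((intervalIntegrable_iff_integrableOn_Ioc_of_le hab).1 (h.intervalIntegrable hab)))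
  rw [uIcc_of_le hab] at h1
  exact (continuousOn_const.add h1).congr h.2

lemma isPrim_of_continuous_deriv [CompleteSpace X] {g g' : ℝ → X}
    (hg : ∀ t, HasDerivAt g (g' t) t) (hc : Continuous g') (a b : ℝ) : IsPrim a b g g' := by
  refine ⟨memLp_Ioc_of_continuous hc, fun t _ => ?_⟩
  rw [intervalIntegral.integral_eq_sub_of_hasDerivAt (fun t _ => hg t)
    (hc.intervalIntegrable _ _)]
  abel

lemma isPrim_of_tpoly [CompleteSpace X] {m : ℕ} {S : Submodule ℝ X} {g : ℝ → X}
    (hg : g ∈ tpoly (m + 1) S) (a b : ℝ) : IsPrim a b g (deriv g) :=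
  isPrim_of_continuous_deriv (hasDerivAt_of_tpoly hg) (continuous_of_tpoly (deriv_mem_tpoly hg)) a b

/-- Cauchy-Schwarz against the constant `1`, obtained by expanding `∫ ((b - a) g - ∫ g)² ≥ 0`. -/
lemma sq_integral_le {g : ℝ → ℝ} (hab : a ≤ b) (hg : MemLp g 2 (volume.restrict (Ioc a b))) :
    (∫ s in a..b, g s) ^ 2 ≤ (b - a) * ∫ s in a..b, g s ^ 2 := by
  rcases eq_or_lt_of_le hab with rfl | hlt
  · simp
  have hi := memLp_intervalIntegrable hab hg
  have hi2 : IntervalIntegrable (fun s => g s ^ 2) volume a b := by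
    simpa using memLp_intervalIntegrable_norm_sq hab hg
  set I := ∫ s in a..b, g s
  have hpos : 0 < b - a := sub_pos.2 hlt
  have h0 : 0 ≤ ∫ s in a..b, ((b - a) * g s - I) ^ 2 :=
    intervalIntegral.integral_nonneg hab fun s _ => sq_nonneg _
  have h1 : ∫ s in a..b, ((b - a) * g s - I) ^ 2 =
      (b - a) ^ 2 * (∫ s in a..b, g s ^ 2) - 2 * (b - a) * I * I + (b - a) * I ^ 2 := by
    have e : ∀ s, ((b - a) * g s - I) ^ 2 =
        (b - a) ^ 2 * g s ^ 2 - 2 * (b - a) * I * g s + I ^ 2 := fun s => by ring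
    simp_rw [e]
    rw [intervalIntegral.integral_add ((hi2.const_mul _).sub (hi.const_mul _))
      intervalIntegrable_const, intervalIntegral.integral_sub (hi2.const_mul _) (hi.const_mul _),
      intervalIntegral.integral_const_mul, intervalIntegral.integral_const_mul,
      intervalIntegral.integral_const, smul_eq_mul]
  rw [h1] at h0
  have : 0 ≤ (b - a) * ((b - a) * (∫ s in a..b, g s ^ 2) - I ^ 2) := by linarith
  linarith [nonneg_of_mul_nonneg_right this hpos]

lemma IsPrim.norm_sub_sq_le (h : IsPrim a b v dv) {t : ℝ} (ht : t ∈ Icc a b) :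
    ‖v t - v a‖ ^ 2 ≤ (b - a) * ∫ s in a..b, ‖dv s‖ ^ 2 := by
  have hab := ht.1.trans ht.2
  have h' := h.mono le_rfl ht.1 ht.2
  have h1 : ‖v t - v a‖ ≤ ∫ s in a..t, ‖dv s‖ := by
    rw [h.2 t ht, add_sub_cancel_left]
    exact intervalIntegral.norm_integral_le_integral_norm ht.1
  have h2 := sq_integral_le ht.1 h'.1.norm
  have h3 : ∫ s in a..t, ‖dv s‖ ^ 2 ≤ ∫ s in a..b, ‖dv s‖ ^ 2 :=
    intervalIntegral.integral_mono_interval le_rfl ht.1 ht.2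
      (Filter.Eventually.of_forall fun s => sq_nonneg _)
      (memLp_intervalIntegrable_norm_sq hab h.1)
  have h4 : 0 ≤ ∫ s in a..t, ‖dv s‖ ^ 2 :=
    intervalIntegral.integral_nonneg ht.1 fun s _ => sq_nonneg _
  calc ‖v t - v a‖ ^ 2 ≤ (∫ s in a..t, ‖dv s‖) ^ 2 := by gcongr
    _ ≤ (t - a) * ∫ s in a..t, ‖dv s‖ ^ 2 := h2
    _ ≤ (b - a) * ∫ s in a..b, ‖dv s‖ ^ 2 := by
      refine mul_le_mul ?_ h3 h4 (by linarith)
      linarith [ht.2]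

end Primitive

/-! ### The projection in time and its approximation property. -/

section TimeProj

variable {X : Type*} [NormedAddCommGroup X] [NormedSpace ℝ X]
  {a b : ℝ} {N : ℕ} {w dw : ℝ → X}

lemma linInterp_mem (hN : 1 ≤ N) (w : ℝ → X) :
    linInterp a b w ∈ tpoly (N + 1) (⊤ : Submodule ℝ X) := by
  have e : linInterp a b w = (fun t : ℝ => t ^ 1 • ((b - a)⁻¹ • (w b - w a))) +
      fun t => (b / (b - a)) • w a - (a / (b - a)) • w b := by
    ext t
    simp only [linInterp, Pi.add_apply, pow_one, div_eq_mul_inv]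
    module
  rw [e]
  exact Submodule.add_mem _ (pow_smul_mem_tpoly (by omega) trivial)
    (const_mem_tpoly (Nat.succ_pos _) trivial)

lemma linInterp_left (hab : a < b) (w : ℝ → X) : linInterp a b w a = w a := by
  simp [linInterp, div_self (sub_pos.2 hab).ne']

lemma linInterp_right (hab : a < b) (w : ℝ → X) : linInterp a b w b = w b := by
  simp [linInterp, div_self (sub_pos.2 hab).ne']

variable [CompleteSpace X]

lemma integral_polyProj (hab : a < b) (hN : 1 ≤ N) {g : ℝ → X}
    (hg : IntervalIntegrable g volume a b) :
    ∫ s in a..b, polyProj a b N g s = ∫ s in a..b, g s := by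
  have h := integral_smul_sub_polyProj hab hg (m := N) (z := fun _ => 1)
    (const_mem_tpoly hN trivial)
  simp only [one_smul] at h
  rw [intervalIntegral.integral_sub hg
    ((continuous_of_tpoly (polyProj_mem g)).intervalIntegrable _ _), sub_eq_zero] at h
  exact h.symm

/-- The projection in time is the primitive of the `L²`-projection of the derivative. -/
lemma timeProj_eq (hab : a < b) (hN : 1 ≤ N) (hw : IsPrim a b w dw) :
    timeProj N a b w = fun t => w a + ∫ s in a..t, polyProj a b N dw s := by
  have hi := hw.intervalIntegrable hab.le
  set P : ℝ → X := fun t => w a + ∫ s in a..t, polyProj a b N dw s with hPdef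
  have hQ := polyProj_mem (a := a) (b := b) (m := N) dw
  have hPm : P ∈ tpoly (N + 1) (⊤ : Submodule ℝ X) :=
    Submodule.add_mem _ (const_mem_tpoly (Nat.succ_pos _) trivial) (integral_mem_tpoly hQ a)
  have hPa : P a = w a := by simp [P]
  have hPb : P b = w b := by
    simp only [P]
    rw [integral_polyProj hab hN hi, hw.integral_eq hab.le]
    abel
  have hPd : ∀ t, HasDerivAt P (polyProj a b N dw t) t := fun t =>
    ((continuous_of_tpoly hQ).integral_hasStrictDerivAt a t).hasDerivAt.const_add (w a)
  have hlin := linInterp_mem (a := a) (b := b) hN w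
  set w0 : ℝ → X := fun s => w s - linInterp a b w s
  have hex : ∃ p, IsTimeProj0 N a b w0 p := by
    refine ⟨P - linInterp a b w, isTimePoly_iff.2 (Submodule.sub_mem _ hPm hlin), ?_, ?_, ?_⟩
    · rw [Pi.sub_apply, hPa, linInterp_left hab, sub_self]
    · rw [Pi.sub_apply, hPb, linInterp_right hab, sub_self]
    · intro q hq _ _
      have e : (fun s => w0 s - (P - linInterp a b w) s) = fun s => w s - P s := by
        ext s; simp [w0]
      rw [e, ← integral_smul_sub_polyProj hab hi (m := N) (deriv_mem_tpoly (isTimePoly_iff.1 hq))]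
      refine integral_congr_ae_Ioc hab.le ?_
      filter_upwards [hw.ae_hasDerivAt hab.le] with t ht
      rw [(ht.fun_sub (hPd t)).deriv]
  have hspec : IsTimeProj0 N a b w0 (timeProj0 N a b w0) := by
    rw [timeProj0, dif_pos hex]
    exact hex.choose_spec
  set p := timeProj0 N a b w0
  obtain ⟨h1, h2, h3, h4⟩ := hspec
  rw [isTimePoly_iff] at h1
  have hR : timeProj N a b w ∈ tpoly (N + 1) (⊤ : Submodule ℝ X) :=
    Submodule.add_mem _ hlin h1
  have hRa : timeProj N a b w a = w a := by
    change linInterp a b w a + p a = _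
    rw [h2, linInterp_left hab, add_zero]
  have hRb : timeProj N a b w b = w b := by
    change linInterp a b w b + p b = _
    rw [h3, linInterp_right hab, add_zero]
  have hRd : deriv (timeProj N a b w) = polyProj a b N dw := by
    have hRc := continuous_of_tpoly (deriv_mem_tpoly hR)
    refine eq_polyProj hab hi (deriv_mem_tpoly hR) fun z hz => ?_
    have hzc := continuous_of_tpoly hz
    set κ := (∫ s in a..b, z s) / (b - a) with hκ
    -- Admissible test polynomials vanish at both ends, so their derivatives have mean zero.
    -- Subtracting the mean `κ` of `z` makes the primitive admissible.
    let q : ℝ → ℝ := (fun t => ∫ s in a..t, z s) - fun t => ∫ s in a..t, κ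
    have hq : q ∈ tpoly (N + 1) (⊤ : Submodule ℝ ℝ) :=
      Submodule.sub_mem _ (integral_mem_tpoly hz a)
        (integral_mem_tpoly (const_mem_tpoly hN (Submodule.mem_top (x := κ))) a)
    have hqd : ∀ t, HasDerivAt q (z t - κ) t := fun t =>
      ((hzc.integral_hasStrictDerivAt a t).hasDerivAt).sub
        (((continuous_const (y := κ)).integral_hasStrictDerivAt a t).hasDerivAt)
    have h5 := h4 q hq (by simp [q]) (by
      have : b - a ≠ 0 := (sub_pos.2 hab).ne'
      simp only [q, Pi.sub_apply, intervalIntegral.integral_const, smul_eq_mul, hκ]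
      field_simp
      simp)
    have h6 : ∫ t in a..b, (z t - κ) • (dw t - deriv (timeProj N a b w) t) = 0 := by
      rw [← h5]
      refine integral_congr_ae_Ioc hab.le ?_
      filter_upwards [hw.ae_hasDerivAt hab.le] with t ht
      have e : (fun s => w0 s - p s) = fun s => w s - timeProj N a b w s := by
        ext s
        change w s - linInterp a b w s - p s = w s - (linInterp a b w s + p s)
        abel
      rw [(hqd t).deriv, e, (ht.fun_sub (hasDerivAt_of_tpoly hR t)).deriv]
    have hsub := hi.sub (hRc.intervalIntegrable a b)
    -- The constant direction missing from the tests is supplied by the agreement of the end point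
    -- values.
    have h7 : ∫ t in a..b, κ • (dw t - deriv (timeProj N a b w) t) = 0 := by
      rw [intervalIntegral.integral_smul, intervalIntegral.integral_sub hi
        (hRc.intervalIntegrable a b), hw.integral_eq hab.le, integral_deriv_of_tpoly hR, hRa, hRb]
      simp
    simp_rw [sub_smul] at h6
    have h8 := intervalIntegral.integral_sub (intervalIntegrable_smul hsub hzc)
      (intervalIntegrable_smul hsub (continuous_const (y := κ)))
    rw [h7, sub_zero] at h8
    exact h8.symm.trans h6
  ext t
  have h8 := integral_deriv_of_tpoly hR a t
  rw [hRd, hRa] at h8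
  rw [hPdef]
  simp [h8]

lemma timeProj_mem (hab : a < b) (hN : 1 ≤ N) (hw : IsPrim a b w dw) :
    timeProj N a b w ∈ tpoly (N + 1) (⊤ : Submodule ℝ X) := by
  rw [timeProj_eq hab hN hw]
  exact Submodule.add_mem _ (const_mem_tpoly (Nat.succ_pos _) trivial)
    (integral_mem_tpoly (polyProj_mem dw) a)

lemma timeProj_left (hab : a < b) (hN : 1 ≤ N) (hw : IsPrim a b w dw) :
    timeProj N a b w a = w a := by
  simp [timeProj_eq hab hN hw]

lemma timeProj_right (hab : a < b) (hN : 1 ≤ N) (hw : IsPrim a b w dw) :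
    timeProj N a b w b = w b := by
  have hi := hw.intervalIntegrable hab.le
  simp only [timeProj_eq hab hN hw]
  rw [integral_polyProj hab hN hi, hw.integral_eq hab.le]
  abel

lemma deriv_timeProj (hab : a < b) (hN : 1 ≤ N) (hw : IsPrim a b w dw) :
    deriv (timeProj N a b w) = polyProj a b N dw := by
  ext t
  rw [timeProj_eq hab hN hw]
  exact (((continuous_of_tpoly (polyProj_mem dw)).integral_hasStrictDerivAt
    a t).hasDerivAt.const_add (w a)).deriv

lemma isPrim_timeProj (hab : a < b) (hN : 1 ≤ N) (hw : IsPrim a b w dw) :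
    IsPrim a b (timeProj N a b w) (polyProj a b N dw) := by
  rw [← deriv_timeProj hab hN hw]
  exact isPrim_of_tpoly (timeProj_mem hab hN hw) a b

lemma map_timeProj {Y : Type*} [NormedAddCommGroup Y] [NormedSpace ℝ Y] [CompleteSpace Y]
    (hab : a < b) (hN : 1 ≤ N) (hw : IsPrim a b w dw) (Λ : X →L[ℝ] Y) (t : ℝ) :
    timeProj N a b (fun s => Λ (w s)) t = Λ (timeProj N a b w t) := by
  have hi := hw.intervalIntegrable hab.le
  rw [timeProj_eq hab hN hw, timeProj_eq hab hN (hw.map Λ), map_add,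
    ← Λ.intervalIntegral_comp_comm
      ((continuous_of_tpoly (polyProj_mem dw)).intervalIntegrable _ _)]
  simp_rw [map_polyProj hi Λ]

variable {Y : Type*} [NormedAddCommGroup Y] [InnerProductSpace ℝ Y] [CompleteSpace Y]

/-- The projection in time is as accurate as the best approximation of the derivative. -/
lemma norm_map_timeProj_sub_sq_le (hab : a < b) (hN : 1 ≤ N) (hw : IsPrim a b w dw)
    (Λ : X →L[ℝ] Y) {p : ℝ → X} (hp : p ∈ tpoly N (⊤ : Submodule ℝ X)) {t : ℝ}
    (ht : t ∈ Icc a b) :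
    ‖Λ (timeProj N a b w t - w t)‖ ^ 2 ≤ (b - a) * ∫ s in a..b, ‖Λ (dw s - p s)‖ ^ 2 := by
  have hi := hw.intervalIntegrable hab.le
  have h1 := ((hw.sub (isPrim_timeProj hab hN hw)).map Λ).norm_sub_sq_le ht
  rw [timeProj_left hab hN hw, sub_self, map_zero, sub_zero] at h1
  rw [← norm_neg, ← map_neg, neg_sub]
  refine h1.trans ?_
  have h2 := integral_norm_sub_polyProj_sq_le hab (Λ.comp_memLp' hw.1)
    (map_mem_tpoly hp Λ.toLinearMap (S' := ⊤) fun _ _ => trivial)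
  refine mul_le_mul_of_nonneg_left ?_ (sub_pos.2 hab).le
  simp_rw [map_sub, map_polyProj hi Λ]
  exact h2

/-- The error of the projection in time is orthogonal to polynomials of lower degree. -/
lemma integral_inner_timeProj_sub (hab : a < b) (hN : 1 ≤ N) (hw : IsPrim a b w dw)
    (Λ : X →L[ℝ] Y) {p : ℝ → Y} (hp : p ∈ tpoly N (⊤ : Submodule ℝ Y)) :
    ∫ s in a..b, ⟪Λ (dw s - deriv (timeProj N a b w) s), p s⟫_ℝ = 0 := by
  have hi := hw.intervalIntegrable hab.le
  rw [deriv_timeProj hab hN hw]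
  simp_rw [map_sub, map_polyProj hi Λ]
  exact integral_inner_sub_polyProj hab (hw.map Λ |>.intervalIntegrable hab.le) hp

end TimeProj

/-! ### The equation for the difference of the discrete solution and the space-time projection. -/

section ErrorEquation

variable {d : ℕ} {Ω : Set (Sp d)}

/-- The operators in space that enter the analysis of the scheme. -/
structure SpaceOps (Ω : Set (Sp d)) (f : ℝ → ℝ) (L : ℝ) (M : ℕ) where
  /-- the projection in space -/
  P : H01 Ω →L[ℝ] H01 Ω
  /-- the Laplacian of the projection -/
  Λ : H01 Ω →L[ℝ] L2 Ω
  /-- the superposition operator of `f` -/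
  F : L2 Ω → L2 Ω
  spaceProj_eq : ∀ w, spaceProj M w = P w
  isSpaceProj : ∀ w, IsSpaceProj M w (P w)
  lap_eq : ∀ w, lap (P w) = Λ w
  hasLaplacian : ∀ w, HasLaplacian (P w) (Λ w)
  F_ae : ∀ w, F w =ᵐ[volume.restrict Ω] fun x => f (w x)
  F_lip : ∀ v w, ‖F v - F w‖ ≤ L * ‖v - w‖

lemma nonempty_spaceOps (hd : 1 ≤ d) (hΩo : IsOpen Ω) (hΩb : Bornology.IsBounded Ω)
    {f : ℝ → ℝ} {L : ℝ} (hf : Differentiable ℝ f) (hL : ∀ s, |deriv f s| < L) (M : ℕ) :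
    Nonempty (SpaceOps Ω f L M) := by
  obtain ⟨P, h1, h2⟩ := exists_spaceProjL hd hΩo hΩb M
  obtain ⟨Λ, h3⟩ := exists_lapL hΩo hΩb M P fun w => (h2 w).1
  obtain ⟨F, h4, h5⟩ := exists_superposition hΩb hf hL
  exact ⟨⟨P, Λ, F, h1, h2, h3, fun w => h3 w ▸ hasLaplacian_lap hΩo hΩb (h2 w).1, h4, h5⟩⟩

/-- The integrand of the weak form for the time derivative `dy` of `y` and the time derivative
`w` of the test function. -/
def weakIntegrand (ε : ℝ) (F : L2 Ω → L2 Ω) (y dy w : H01 Ω) : ℝ :=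
  ⟪val dy, val w⟫_ℝ + ε * ⟪grad y, grad w⟫_ℝ + 1 / ε * ⟪F (val y), val w⟫_ℝ

namespace SpaceOps

variable {f : ℝ → ℝ} {L : ℝ} {M : ℕ} (O : SpaceOps Ω f L M)

lemma inner_F (v w : L2 Ω) : ⟪O.F v, w⟫_ℝ = ∫ x in Ω, f (v x) * w x := by
  rw [L2.inner_def]
  refine integral_congr_ae ?_
  filter_upwards [O.F_ae v] with x hx
  rw [hx]
  simp [mul_comm]

lemma weakForm_eq (ε a b : ℝ) (y v : ℝ → H01 Ω) :
    weakForm ε f a b y v = ∫ t in a..b, weakIntegrand ε O.F (y t) (deriv y t) (deriv v t) := by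
  simp only [weakForm, weakIntegrand, O.inner_F]

lemma continuous_F (hL : 0 < L) : Continuous O.F :=
  LipschitzWith.continuous (K := ⟨L, hL.le⟩)
    (LipschitzWith.of_dist_le_mul fun v w => by
      rw [dist_eq_norm, dist_eq_norm]; exact O.F_lip v w)

/-- The equation for `u`, localized in time. -/
lemma integral_weakIntegrand_of_isWeakSolution {ε T : ℝ} {u du : ℝ → H01 Ω}
    (hu : IsWeakSolution ε f T u) (hdu : IsPrim 0 T u du)
    {a b : ℝ} (ha : 0 ≤ a) (hab : a ≤ b) (hb : b ≤ T) {w : ℝ → H01 Ω} (hw : Continuous w) :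
    ∫ t in a..b, weakIntegrand ε O.F (u t) (du t) (w t) = 0 := by
  have hT : 0 ≤ T := ha.trans (hab.trans hb)
  -- The test function has derivative `w` on `(a, b]` and `0` elsewhere; the jumps are allowed
  -- because only square integrability is required.
  let dv : ℝ → H01 Ω := (Ioc a b).indicator w
  let v : ℝ → H01 Ω := fun t => u 0 + ∫ s in 0..t, dv s
  have hv : IsPrim 0 T v dv :=
    ⟨(memLp_Ioc_of_continuous hw).indicator measurableSet_Ioc, fun t _ => by simp [v]⟩
  have h0 := hu.2 v ⟨dv, hv⟩ (by simp [v])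
  rw [O.weakForm_eq, intervalIntegral.integral_of_le hT] at h0
  rw [intervalIntegral.integral_of_le hab, ← h0]
  have hsub : Ioc 0 T ∩ Ioc a b = Ioc a b := inter_eq_right.2 (Ioc_subset_Ioc ha hb)
  rw [← hsub, ← setIntegral_indicator measurableSet_Ioc]
  refine integral_congr_ae ?_
  filter_upwards [hdu.ae_deriv_eq hT, hv.ae_deriv_eq hT] with t h1 h2
  rw [h1, h2]
  by_cases ht : t ∈ Ioc a b
  · rw [indicator_of_mem ht]
    simp only [dv, indicator_of_mem ht]
  · rw [indicator_of_notMem ht]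
    have e1 : val (0 : H01 Ω) = 0 := rfl
    have e2 : grad (0 : H01 Ω) = 0 := rfl
    simp [dv, indicator_of_notMem ht, weakIntegrand, e1, e2]

/-- The residual of the space-time projection. -/
def residual (ε : ℝ) (N : ℕ) (a b : ℝ) (u h : ℝ → H01 Ω) (t : ℝ) : L2 Ω :=
  -val (O.P (deriv (timeProj N a b u) t) - deriv (timeProj N a b u) t)
    + ε • O.Λ (timeProj N a b u t - u t) - (1 / ε) • (O.F (val (h t)) - O.F (val (u t)))

/-- Writing `h - u = (P Π_N u - u) + ρ` splits the nonlinear term into a projection error and a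
multiple of `‖ρ‖`, so the only unknown on the right is `ρ`. -/
lemma norm_residual_le {ε : ℝ} (hε : 0 < ε) (hL : 0 < L) (N : ℕ) (a b : ℝ)
    (u h : ℝ → H01 Ω) (t : ℝ) :
    ‖O.residual ε N a b u h t‖ ≤
      ‖val (O.P (deriv (timeProj N a b u) t) - deriv (timeProj N a b u) t)‖
      + ε * ‖O.Λ (timeProj N a b u t - u t)‖
      + L / ε * (‖val (O.P (timeProj N a b u t) - u t)‖
        + ‖val (h t - O.P (timeProj N a b u t))‖) := by
  have h1 := O.F_lip (val (h t)) (val (u t))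
  have h2 : val (h t) - val (u t) = val (O.P (timeProj N a b u t) - u t) +
      val (h t - O.P (timeProj N a b u t)) := by
    simp only [← valL_apply, map_sub]; abel
  rw [h2] at h1
  have h3 := h1.trans (mul_le_mul_of_nonneg_left (norm_add_le _ _) hL.le)
  rw [residual]
  refine (norm_sub_le _ _).trans (add_le_add ((norm_add_le _ _).trans (add_le_add ?_ ?_)) ?_)
  · rw [norm_neg]
  · rw [norm_smul, Real.norm_of_nonneg hε.le]
  · rw [norm_smul, Real.norm_of_nonneg (by positivity), div_mul_eq_mul_div, one_mul,
      div_mul_eq_mul_div]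
    gcongr

variable {ε a b : ℝ} {N : ℕ} {u du h : ℝ → H01 Ω}

lemma continuousOn_residual (hL : 0 < L) (hab : a < b) (hN : 1 ≤ N) (hu : IsPrim a b u du)
    {m : ℕ} {S : Submodule ℝ (H01 Ω)} (hh : h ∈ tpoly m S) :
    ContinuousOn (O.residual ε N a b u h) (Icc a b) := by
  have hc := hu.continuousOn hab.le
  have hm := timeProj_mem hab hN hu
  have c1 := (continuous_of_tpoly hm).continuousOn (s := Icc a b)
  have c2 := (continuous_of_tpoly (deriv_mem_tpoly hm)).continuousOn (s := Icc a b)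
  have c3 := (continuous_of_tpoly hh).continuousOn (s := Icc a b)
  have e1 : ContinuousOn (fun t => valL (O.P (deriv (timeProj N a b u) t) -
      deriv (timeProj N a b u) t)) (Icc a b) :=
    valL.continuous.comp_continuousOn ((O.P.continuous.comp_continuousOn c2).sub c2)
  have e2 : ContinuousOn (fun t => O.Λ (timeProj N a b u t - u t)) (Icc a b) :=
    O.Λ.continuous.comp_continuousOn (c1.sub hc)
  have e3 : ContinuousOn (fun t => O.F (valL (h t))) (Icc a b) :=
    (O.continuous_F hL).comp_continuousOn (valL.continuous.comp_continuousOn c3)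
  have e4 : ContinuousOn (fun t => O.F (valL (u t))) (Icc a b) :=
    (O.continuous_F hL).comp_continuousOn (valL.continuous.comp_continuousOn hc)
  exact (e1.neg.add (e2.const_smul ε)).sub ((e3.sub e4).const_smul (1 / ε))

/-- The space-time projection of `u` on `[a, b]`. -/
lemma stProj_eq (hab : a < b) (hN : 1 ≤ N) (hu : IsPrim a b u du) (t : ℝ) :
    stProj N M a b u t = O.P (timeProj N a b u t) := by
  simp only [stProj, O.spaceProj_eq]
  exact map_timeProj hab hN hu O.P t

lemma intervalIntegrable_weakIntegrand (hL : 0 < L) (hab : a ≤ b) {y dy w : ℝ → H01 Ω}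
    (hy : IsPrim a b y dy) (hw : Continuous w) :
    IntervalIntegrable (fun t => weakIntegrand ε O.F (y t) (dy t) (w t)) volume a b := by
  have hc := hy.continuousOn hab
  have hcv : Continuous fun t => valL (w t) := valL.continuous.comp hw
  have hcg : Continuous fun t => gradL (w t) := gradL.continuous.comp hw
  refine IntervalIntegrable.add (IntervalIntegrable.add ?_ ?_) ?_
  · refine (intervalIntegrable_iff_integrableOn_Ioc_of_le hab).2 ?_
    exact memLp_integrable_inner (valL.comp_memLp' hy.1) (memLp_Ioc_of_continuous hcv)
  · refine ContinuousOn.intervalIntegrable ?_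
    rw [uIcc_of_le hab]
    exact continuousOn_const.mul
      ((gradL.continuous.comp_continuousOn hc).inner hcg.continuousOn)
  · refine ContinuousOn.intervalIntegrable ?_
    rw [uIcc_of_le hab]
    exact continuousOn_const.mul
      (((O.continuous_F hL).comp_continuousOn (valL.continuous.comp_continuousOn hc)).inner
        hcv.continuousOn)

/-- The error equation. -/
lemma error_equation (hL : 0 < L) (hab : a < b) (hN : 1 ≤ N) (hu : IsPrim a b u du)
    (hueq : ∀ w : ℝ → H01 Ω, Continuous w →
      ∫ t in a..b, weakIntegrand ε O.F (u t) (du t) (w t) = 0)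
    (hh : h ∈ tpoly (N + 1) (PM0 Ω M))
    (hheq : ∀ w ∈ tpoly N (PM0 Ω M),
      ∫ t in a..b, weakIntegrand ε O.F (h t) (deriv h t) (w t) = 0)
    {ρ : ℝ → H01 Ω} (hρ : ∀ t, ρ t = h t - O.P (timeProj N a b u t))
    {w : ℝ → H01 Ω} (hw : w ∈ tpoly N (PM0 Ω M)) :
    ∫ t in a..b, (⟪val (deriv ρ t), val (w t)⟫_ℝ + ε * ⟪grad (ρ t), grad (w t)⟫_ℝ) =
      ∫ t in a..b, ⟪O.residual ε N a b u h t, val (w t)⟫_ℝ := by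
  have hm := timeProj_mem hab hN hu
  have hwc := continuous_of_tpoly hw
  have h1 := hheq w hw
  have h2 := hueq w hwc
  have h3 := integral_inner_timeProj_sub hab hN hu valL (p := fun t => valL (w t))
    (map_mem_tpoly hw valL.toLinearMap fun _ _ => trivial)
  have i1 := O.intervalIntegrable_weakIntegrand (ε := ε) hL hab.le (isPrim_of_tpoly hh a b) hwc
  have i2 := O.intervalIntegrable_weakIntegrand (ε := ε) hL hab.le hu hwc
  have hdm := continuous_of_tpoly (deriv_mem_tpoly hm)
  have hcv : Continuous fun t => valL (w t) := valL.continuous.comp hwc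
  have i3 : IntervalIntegrable (fun t => ⟪valL (du t - deriv (timeProj N a b u) t),
      valL (w t)⟫_ℝ) volume a b := by
    refine (intervalIntegrable_iff_integrableOn_Ioc_of_le hab.le).2 ?_
    exact memLp_integrable_inner
      (valL.comp_memLp' (hu.1.sub (memLp_Ioc_of_continuous hdm))) (memLp_Ioc_of_continuous hcv)
  have i4 : IntervalIntegrable (fun t => ⟪O.residual ε N a b u h t, val (w t)⟫_ℝ) volume a b := by
    refine ContinuousOn.intervalIntegrable ?_
    rw [uIcc_of_le hab.le]
    exact (O.continuousOn_residual hL hab hN hu hh).inner hcv.continuousOn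
  have hdρ : ∀ t, deriv ρ t = deriv h t - O.P (deriv (timeProj N a b u) t) := by
    intro t
    rw [show ρ = fun t => h t - O.P (timeProj N a b u t) from funext hρ]
    exact ((hasDerivAt_of_tpoly hh t).fun_sub
      (O.P.hasFDerivAt.comp_hasDerivAt t (hasDerivAt_of_tpoly hm t))).deriv
  -- Pointwise identity: `e1` removes `∇(P u - u)`, and `e2` replaces `∇P(Π_N u - u)` by the
  -- Laplacian contained in the residual. After integration the first three terms vanish by `h1`,
  -- `h2` and `h3`.
  have key : ∀ t, ⟪val (deriv ρ t), val (w t)⟫_ℝ + ε * ⟪grad (ρ t), grad (w t)⟫_ℝ =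
      weakIntegrand ε O.F (h t) (deriv h t) (w t) - weakIntegrand ε O.F (u t) (du t) (w t) +
      ⟪valL (du t - deriv (timeProj N a b u) t), valL (w t)⟫_ℝ +
      ⟪O.residual ε N a b u h t, val (w t)⟫_ℝ := by
    intro t
    have hwt := eval_mem_of_tpoly hw t
    have e1 := (O.isSpaceProj (u t)).2 (w t) hwt
    have e2 := O.hasLaplacian (timeProj N a b u t - u t) (w t)
    rw [hdρ, hρ]
    simp only [weakIntegrand, residual, ← valL_apply, ← gradL_apply, map_sub, inner_sub_left,
      inner_add_left, inner_neg_left, real_inner_smul_left] at e1 e2 ⊢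
    linear_combination -ε * e1 - ε * e2
  simp_rw [key]
  rw [intervalIntegral.integral_add ((i1.sub i2).add i3) i4,
    intervalIntegral.integral_add (i1.sub i2) i3, intervalIntegral.integral_sub i1 i2, h1, h2, h3]
  simp

end SpaceOps

end ErrorEquation

/-! ### The energy estimate on a single time interval. -/

section Energy

variable {d : ℕ} {Ω : Set (Sp d)}

/-- The energy that is controlled at the nodes. -/
def energy (ε L : ℝ) (w : H01 Ω) : ℝ := ‖val w‖ ^ 2 + ε ^ 2 / (2 * L) * ‖grad w‖ ^ 2

lemma energy_nonneg {ε L : ℝ} (hL : 0 < L) (w : H01 Ω) : 0 ≤ energy ε L w := by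
  unfold energy; positivity

lemma continuous_val {g : ℝ → H01 Ω} (hg : Continuous g) : Continuous fun t => val (g t) :=
  valL.continuous.comp hg

lemma continuous_grad {g : ℝ → H01 Ω} (hg : Continuous g) : Continuous fun t => grad (g t) :=
  gradL.continuous.comp hg

lemma energy_sub_energy {ε L : ℝ} {m : ℕ} {S : Submodule ℝ (H01 Ω)} {ρ : ℝ → H01 Ω}
    (hρ : ρ ∈ tpoly (m + 1) S) (a b : ℝ) :
    energy ε L (ρ b) - energy ε L (ρ a) =
      ∫ t in a..b, (2 * ⟪val (ρ t), val (deriv ρ t)⟫_ℝ +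
        ε ^ 2 / L * ⟪grad (ρ t), grad (deriv ρ t)⟫_ℝ) := by
  have hc := continuous_of_tpoly hρ
  have hc' := continuous_of_tpoly (deriv_mem_tpoly hρ)
  refine (intervalIntegral.integral_eq_sub_of_hasDerivAt (f := fun t => energy ε L (ρ t))
    (fun t _ => ?_) (Continuous.intervalIntegrable ?_ a b)).symm
  · have h := hasDerivAt_of_tpoly hρ t
    have h1 := ((valL (Ω := Ω)).hasFDerivAt.comp_hasDerivAt t h).norm_sq
    have h2 := ((gradL (Ω := Ω)).hasFDerivAt.comp_hasDerivAt t h).norm_sq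
    refine (h1.add (h2.const_mul (ε ^ 2 / (2 * L)))).congr_deriv ?_
    simp only [Function.comp_apply, valL_apply, gradL_apply]
    ring
  · exact (((continuous_val hc).inner (continuous_val hc')).const_mul _).add
      (((continuous_grad hc).inner (continuous_grad hc')).const_mul _)

/-- Follows from `‖ρ(t)‖ ≤ ‖ρ(a)‖ + ‖ρ(t) - ρ(a)‖`. The derivative enters with the factor `(b -
a)²`, so for small steps it is absorbed by the dissipation; the value at `a` feeds the Gronwall
factor. -/
lemma integral_norm_val_sq_le {m : ℕ} {S : Submodule ℝ (H01 Ω)} {ρ : ℝ → H01 Ω}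
    (hρ : ρ ∈ tpoly (m + 1) S) {a b : ℝ} (hab : a ≤ b) :
    ∫ t in a..b, ‖val (ρ t)‖ ^ 2 ≤ (b - a) * (2 * ‖val (ρ a)‖ ^ 2 +
      2 * ((b - a) * ∫ t in a..b, ‖val (deriv ρ t)‖ ^ 2)) := by
  have hc := continuous_val (continuous_of_tpoly hρ)
  have : ∫ t in a..b, ‖val (ρ t)‖ ^ 2 ≤ ∫ t in a..b, (2 * ‖val (ρ a)‖ ^ 2 +
      2 * ((b - a) * ∫ t in a..b, ‖val (deriv ρ t)‖ ^ 2)) := by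
    refine intervalIntegral.integral_mono_on hab ((hc.norm.pow 2).intervalIntegrable _ _)
      intervalIntegrable_const fun t ht => ?_
    have p1 := ((isPrim_of_tpoly hρ a b).map valL).norm_sub_sq_le ht
    simp only [valL_apply] at p1
    have p2 : ‖val (ρ t)‖ ≤ ‖val (ρ a)‖ + ‖val (ρ t) - val (ρ a)‖ := by
      simpa using norm_add_le (val (ρ a)) (val (ρ t) - val (ρ a))
    have p3 : ‖val (ρ t)‖ ^ 2 ≤ (‖val (ρ a)‖ + ‖val (ρ t) - val (ρ a)‖) ^ 2 := by gcongr
    nlinarith [sq_nonneg (‖val (ρ a)‖ - ‖val (ρ t) - val (ρ a)‖)]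
  refine this.trans (le_of_eq ?_)
  rw [intervalIntegral.integral_const, smul_eq_mul]

/-- With `q = ε / L`, the dissipation `q r²` can spare `3/4 q r²`: `1/8` goes to the consistency
terms, where `S r ≤ 2 S² + r² / 8` and `S² ≤ 3 (A² + (ε B)² + (L C / ε)²)` explain the `6` in `Ep`,
and `5/8` goes to `3 ρn r`. -/
lemma young_step {ε L A B C r ρn R : ℝ} (hε : 0 < ε) (hL : 0 < L)
    (hr : 0 ≤ r) (hR : R ≤ A + ε * B + L / ε * (C + ρn)) :
    2 * (ρn * r) + ε / L * (R * r) ≤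
      ε / L * (6 * A ^ 2 + 6 * ε ^ 2 * B ^ 2 + 6 * L ^ 2 / ε ^ 2 * C ^ 2) +
        3 * ε / (4 * L) * r ^ 2 + 18 * L / (5 * ε) * ρn ^ 2 := by
  set q := ε / L with hq
  have hq0 : 0 < q := div_pos hε hL
  set D := L / ε * C with hD
  have e1 : 6 * L ^ 2 / ε ^ 2 * C ^ 2 = 6 * D ^ 2 := by rw [hD]; ring
  have e2 : 3 * ε / (4 * L) = 3 / 4 * q := by rw [hq]; ring
  have e3 : 18 * L / (5 * ε) = 18 / 5 * q⁻¹ := by rw [hq, inv_div]; ring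
  have e4 : L / ε = q⁻¹ := by rw [hq, inv_div]
  rw [e1, e2, e3]
  have h1 : q * (R * r) ≤ q * ((A + ε * B + D) * r) + ρn * r := by
    have : R * r ≤ (A + ε * B + L / ε * (C + ρn)) * r := mul_le_mul_of_nonneg_right hR hr
    calc q * (R * r) ≤ q * ((A + ε * B + L / ε * (C + ρn)) * r) := by gcongr
      _ = q * ((A + ε * B + D) * r) + q * q⁻¹ * (ρn * r) := by rw [hD, e4]; ring
      _ = _ := by rw [mul_inv_cancel₀ hq0.ne', one_mul]
  have h2 : (A + ε * B + D) * r ≤ 6 * A ^ 2 + 6 * ε ^ 2 * B ^ 2 + 6 * D ^ 2 + r ^ 2 / 8 := by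
    nlinarith [sq_nonneg (4 * (A + ε * B + D) - r), sq_nonneg (A - ε * B), sq_nonneg (A - D),
      sq_nonneg (ε * B - D)]
  -- The `3` adds the `2` from `∂_t ‖ρ‖²` to the `1` left by the Lipschitz term, since `q L / ε =
  -- 1`. The constant `18/5 = 9 / (4 · 5/8)` is smaller than the `4` that corresponds to `D_τ` and
  -- `D_2`, which provides the margin used for the rates.
  have h3 : 3 * (ρn * r) ≤ 5 / 8 * (q * r ^ 2) + 18 / 5 * (q⁻¹ * ρn ^ 2) := by
    have : 0 ≤ q * (5 / 8) * (r - 12 / 5 * (q⁻¹ * ρn)) ^ 2 := by positivity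
    have e : q * (5 / 8) * (r - 12 / 5 * (q⁻¹ * ρn)) ^ 2 =
        5 / 8 * (q * r ^ 2) - 3 * (q * q⁻¹) * (ρn * r) + 18 / 5 * (q * q⁻¹) * (q⁻¹ * ρn ^ 2) := by
      ring
    rw [e, mul_inv_cancel₀ hq0.ne'] at this
    linarith
  have h4 := mul_le_mul_of_nonneg_left h2 hq0.le
  nlinarith

/-- The contribution of one time interval to the consistency error. -/
lemma Ep_eq {f : ℝ → ℝ} {L : ℝ} {M N : ℕ} (O : SpaceOps Ω f L M) {ε τ : ℝ} {u du : ℝ → H01 Ω}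
    {n : ℕ} (hτ : 0 < τ) (hN : 1 ≤ N) (hu : IsPrim (((n : ℝ) - 1) * τ) (n * τ) u du) :
    Ep ε L τ N M u n =
      6 * (∫ t in (((n : ℝ) - 1) * τ)..(n * τ),
        ‖val (O.P (deriv (timeProj N (((n : ℝ) - 1) * τ) (n * τ) u) t) -
          deriv (timeProj N (((n : ℝ) - 1) * τ) (n * τ) u) t)‖ ^ 2)
      + 6 * ε ^ 2 * (∫ t in (((n : ℝ) - 1) * τ)..(n * τ),
        ‖O.Λ (timeProj N (((n : ℝ) - 1) * τ) (n * τ) u t - u t)‖ ^ 2)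
      + 6 * L ^ 2 / ε ^ 2 * (∫ t in (((n : ℝ) - 1) * τ)..(n * τ),
        ‖val (O.P (timeProj N (((n : ℝ) - 1) * τ) (n * τ) u t) - u t)‖ ^ 2) := by
  have hab : ((n : ℝ) - 1) * τ < n * τ := by nlinarith
  have hm := timeProj_mem hab hN hu
  rw [Ep]
  simp only [O.stProj_eq hab hN hu, O.spaceProj_eq]
  congr 2
  · congr 2
    ext t
    congr 3
    exact ((O.P.hasFDerivAt.comp_hasDerivAt t (hasDerivAt_of_tpoly hm t)).fun_sub
      (hasDerivAt_of_tpoly hm t)).deriv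
  · congr 2
    ext t
    rw [← map_sub, O.lap_eq]

namespace SpaceOps

variable {f : ℝ → ℝ} {L : ℝ} {M : ℕ} (O : SpaceOps Ω f L M)
  {ε a b : ℝ} {N : ℕ} {u du h ρ : ℝ → H01 Ω}

lemma continuousOn_timeProj_terms (hab : a < b) (hN : 1 ≤ N) (hu : IsPrim a b u du) :
    (Continuous fun t => ‖val (O.P (deriv (timeProj N a b u) t) -
      deriv (timeProj N a b u) t)‖) ∧
    ContinuousOn (fun t => ‖O.Λ (timeProj N a b u t - u t)‖) (Icc a b) ∧
    ContinuousOn (fun t => ‖val (O.P (timeProj N a b u t) - u t)‖) (Icc a b) := by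
  have hm := timeProj_mem hab hN hu
  have hc := hu.continuousOn hab.le
  have c1 := continuous_of_tpoly hm
  have c2 := continuous_of_tpoly (deriv_mem_tpoly hm)
  refine ⟨(continuous_val ((O.P.continuous.comp c2).sub c2)).norm, ?_, ?_⟩
  · exact (O.Λ.continuous.comp_continuousOn (c1.continuousOn.sub hc)).norm
  · exact (valL.continuous.comp_continuousOn
      ((O.P.continuous.comp c1).continuousOn.sub hc)).norm

/-- The energy estimate on one time interval. -/
lemma energy_step (hε : 0 < ε) (hL : 0 < L) (hab : a < b) (hN : 1 ≤ N) (hu : IsPrim a b u du)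
    (hueq : ∀ w : ℝ → H01 Ω, Continuous w →
      ∫ t in a..b, weakIntegrand ε O.F (u t) (du t) (w t) = 0)
    (hh : h ∈ tpoly (N + 1) (PM0 Ω M))
    (hheq : ∀ w ∈ tpoly N (PM0 Ω M),
      ∫ t in a..b, weakIntegrand ε O.F (h t) (deriv h t) (w t) = 0)
    (hρ : ∀ t, ρ t = h t - O.P (timeProj N a b u t)) (hρm : ρ ∈ tpoly (N + 1) (PM0 Ω M)) :
    energy ε L (ρ b) + (ε / (4 * L) - 36 * (b - a) ^ 2 * L / (5 * ε)) *
        (∫ t in a..b, ‖val (deriv ρ t)‖ ^ 2) ≤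
      (1 + 8 * L / ε * (b - a)) * energy ε L (ρ a) + ε / L *
      (6 * (∫ t in a..b, ‖val (O.P (deriv (timeProj N a b u) t) -
          deriv (timeProj N a b u) t)‖ ^ 2)
      + 6 * ε ^ 2 * (∫ t in a..b, ‖O.Λ (timeProj N a b u t - u t)‖ ^ 2)
      + 6 * L ^ 2 / ε ^ 2 * (∫ t in a..b, ‖val (O.P (timeProj N a b u t) - u t)‖ ^ 2)) := by
  have hρ' := deriv_mem_tpoly hρm
  have cρ := continuous_of_tpoly hρm
  have cρ' := continuous_of_tpoly hρ'
  have cv := continuous_val cρ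
  have cv' := continuous_val cρ'
  have hba : 0 < b - a := sub_pos.2 hab
  obtain ⟨k1, k2, k3⟩ := O.continuousOn_timeProj_terms hab hN hu
  have kR : ContinuousOn (fun t => ⟪O.residual ε N a b u h t, val (deriv ρ t)⟫_ℝ) (Icc a b) :=
    (O.continuousOn_residual hL hab hN hu hh).inner cv'.continuousOn
  have ii : ∀ {g : ℝ → ℝ}, ContinuousOn g (Icc a b) → IntervalIntegrable g volume a b := by
    intro g hg
    refine ContinuousOn.intervalIntegrable ?_
    rwa [uIcc_of_le hab.le]
  -- Tested with `w = ρ_t`, which has degree less than `N` and values in `PM0 Ω M`.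
  have h1 := O.error_equation (ε := ε) hL hab hN hu hueq hh hheq hρ hρ'
  have h2 := energy_sub_energy (ε := ε) (L := L) hρm a b
  set R2 := ∫ t in a..b, ‖val (deriv ρ t)‖ ^ 2 with hR2
  have h3 : energy ε L (ρ b) - energy ε L (ρ a) + ε / L * R2 =
      ∫ t in a..b, (2 * ⟪val (ρ t), val (deriv ρ t)⟫_ℝ +
        ε / L * ⟪O.residual ε N a b u h t, val (deriv ρ t)⟫_ℝ) := by
    have j1 : IntervalIntegrable (fun t => 2 * ⟪val (ρ t), val (deriv ρ t)⟫_ℝ) volume a b :=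
      ((cv.inner cv').const_mul _).intervalIntegrable _ _
    have j2 : IntervalIntegrable (fun t => ⟪grad (ρ t), grad (deriv ρ t)⟫_ℝ) volume a b :=
      ((continuous_grad cρ).inner (continuous_grad cρ')).intervalIntegrable _ _
    have j3 : IntervalIntegrable (fun t => ‖val (deriv ρ t)‖ ^ 2) volume a b :=
      (cv'.norm.pow 2).intervalIntegrable _ _
    rw [intervalIntegral.integral_add j1 (j2.const_mul _),
      intervalIntegral.integral_const_mul (ε ^ 2 / L)] at h2
    simp_rw [real_inner_self_eq_norm_sq] at h1
    rw [intervalIntegral.integral_add j3 (j2.const_mul _),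
      intervalIntegral.integral_const_mul] at h1
    rw [intervalIntegral.integral_add j1 ((ii kR).const_mul _),
      intervalIntegral.integral_const_mul (ε / L), ← h1, h2]
    ring
  have m1 : IntervalIntegrable (fun t => ‖val (O.P (deriv (timeProj N a b u) t) -
          deriv (timeProj N a b u) t)‖ ^ 2) volume a b := (k1.pow 2).intervalIntegrable _ _
  have m2 : IntervalIntegrable (fun t => ‖O.Λ (timeProj N a b u t - u t)‖ ^ 2) volume a b :=
    ii (k2.pow 2)
  have m3 : IntervalIntegrable (fun t => ‖val (O.P (timeProj N a b u t) - u t)‖ ^ 2) volume a b :=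
    ii (k3.pow 2)
  have m4 : IntervalIntegrable (fun t => ‖val (deriv ρ t)‖ ^ 2) volume a b :=
    (cv'.norm.pow 2).intervalIntegrable _ _
  have m5 : IntervalIntegrable (fun t => ‖val (ρ t)‖ ^ 2) volume a b :=
    (cv.norm.pow 2).intervalIntegrable _ _
  have h4 : ∫ t in a..b, (2 * ⟪val (ρ t), val (deriv ρ t)⟫_ℝ +
        ε / L * ⟪O.residual ε N a b u h t, val (deriv ρ t)⟫_ℝ) ≤
      ∫ t in a..b, (ε / L * (6 * ‖val (O.P (deriv (timeProj N a b u) t) -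
          deriv (timeProj N a b u) t)‖ ^ 2
        + 6 * ε ^ 2 * ‖O.Λ (timeProj N a b u t - u t)‖ ^ 2
        + 6 * L ^ 2 / ε ^ 2 * ‖val (O.P (timeProj N a b u t) - u t)‖ ^ 2)
        + 3 * ε / (4 * L) * ‖val (deriv ρ t)‖ ^ 2 + 18 * L / (5 * ε) * ‖val (ρ t)‖ ^ 2) := by
    refine intervalIntegral.integral_mono_on hab.le ?_ ?_ fun t _ => ?_
    · exact (((cv.inner cv').const_mul _).intervalIntegrable _ _).add ((ii kR).const_mul _)
    · exact (((((m1.const_mul _).add (m2.const_mul _)).add (m3.const_mul _)).const_mul _).add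
        (m4.const_mul _)).add (m5.const_mul _)
    · have hr := O.norm_residual_le (ε := ε) hε hL N a b u h t
      rw [← hρ] at hr
      refine le_trans ?_ (young_step hε hL (norm_nonneg (val (deriv ρ t))) hr)
      refine add_le_add ?_ ?_
      · exact mul_le_mul_of_nonneg_left (real_inner_le_norm _ _) zero_le_two
      · exact mul_le_mul_of_nonneg_left (real_inner_le_norm _ _) (by positivity)
  rw [intervalIntegral.integral_add ((((((m1.const_mul _).add (m2.const_mul _)).add
      (m3.const_mul _)).const_mul _).add (m4.const_mul _))) (m5.const_mul _),
    intervalIntegral.integral_add (((((m1.const_mul _).add (m2.const_mul _)).add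
      (m3.const_mul _)).const_mul _)) (m4.const_mul _),
    intervalIntegral.integral_const_mul,
    intervalIntegral.integral_add ((m1.const_mul _).add (m2.const_mul _)) (m3.const_mul _),
    intervalIntegral.integral_add (m1.const_mul _) (m2.const_mul _),
    intervalIntegral.integral_const_mul, intervalIntegral.integral_const_mul,
    intervalIntegral.integral_const_mul, intervalIntegral.integral_const_mul,
    intervalIntegral.integral_const_mul] at h4
  have h5 : ∫ t in a..b, ‖val (ρ t)‖ ^ 2 ≤
      (b - a) * (2 * ‖val (ρ a)‖ ^ 2 + 2 * ((b - a) * R2)) :=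
    integral_norm_val_sq_le hρm hab.le
  have h6 : 18 * L / (5 * ε) * (∫ t in a..b, ‖val (ρ t)‖ ^ 2) ≤
      18 * L / (5 * ε) * ((b - a) * (2 * ‖val (ρ a)‖ ^ 2 + 2 * ((b - a) * R2))) := by gcongr
  have h7 : 36 * L / (5 * ε) * (b - a) * ‖val (ρ a)‖ ^ 2 ≤
      8 * L / ε * (b - a) * energy ε L (ρ a) := by
    have q1 : ‖val (ρ a)‖ ^ 2 ≤ energy ε L (ρ a) := by
      rw [energy, le_add_iff_nonneg_right]; positivity
    have q2 : 36 * L / (5 * ε) ≤ 8 * L / ε := by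
      rw [div_le_div_iff₀ (by positivity) hε]
      nlinarith [mul_pos hL hε]
    gcongr
  have e1 : 18 * L / (5 * ε) * ((b - a) * (2 * ‖val (ρ a)‖ ^ 2 + 2 * ((b - a) * R2))) =
      36 * L / (5 * ε) * (b - a) * ‖val (ρ a)‖ ^ 2 + 36 * (b - a) ^ 2 * L / (5 * ε) * R2 := by
    ring
  have e2 : ε / L * R2 - 3 * ε / (4 * L) * R2 = ε / (4 * L) * R2 := by ring
  linarith

end SpaceOps

end Energy

/-! ### Chaining the steps: discrete Gronwall and the error inequality. -/

section Scheme

variable {d : ℕ} {Ω : Set (Sp d)} {f : ℝ → ℝ} {L : ℝ} {M : ℕ}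

namespace SpaceOps

variable (O : SpaceOps Ω f L M) {ε τ : ℝ} {N K : ℕ} {u du : ℝ → H01 Ω} {u0 : H01 Ω}
  {h : ℕ → ℝ → H01 Ω}

/-- The scheme, tested with polynomials of degree less than `N`. -/
lemma integral_weakIntegrand_of_isESET (hh : IsESET ε f τ K N M u0 h) {n : ℕ}
    (hn : n ∈ Finset.Icc 1 K) {w : ℝ → H01 Ω} (hw : w ∈ tpoly N (PM0 Ω M)) :
    ∫ t in (((n : ℝ) - 1) * τ)..(n * τ),
      weakIntegrand ε O.F (h n t) (deriv (h n) t) (w t) = 0 := by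
  obtain ⟨h1, h2, h3⟩ := hh n hn
  -- The starting value equals a value of `h n`, so it lies in `PM0 Ω M` without an induction over
  -- the earlier steps. Adding a primitive of `w` then gives an admissible test function.
  have hmem := eval_mem_of_tpoly (isTimePoly_iff.1 h1) (((n : ℝ) - 1) * τ)
  rw [h2] at hmem
  have h4 := h3 (fun t => nodal τ u0 h (n - 1) + ∫ s in (((n : ℝ) - 1) * τ)..t, w s)
    (isTimePoly_iff.2 (Submodule.add_mem _ (const_mem_tpoly (Nat.succ_pos _) hmem)
      (integral_mem_tpoly hw _))) (by simp)
  rw [O.weakForm_eq] at h4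
  rw [← h4]
  congr 1
  ext t
  congr 1
  exact (((continuous_of_tpoly hw).integral_hasStrictDerivAt _
    t).hasDerivAt.const_add _).deriv.symm

lemma rho_eq (hτ : 0 < τ) (hN : 1 ≤ N) {n : ℕ}
    (hu : IsPrim (((n : ℝ) - 1) * τ) (n * τ) u du) (t : ℝ) :
    rho τ N M u h n t =
      h n t - O.P (timeProj N (((n : ℝ) - 1) * τ) (n * τ) u t) := by
  rw [rho, O.stProj_eq (by nlinarith) hN hu]

lemma rho_mem (O : SpaceOps Ω f L M) (hτ : 0 < τ) (hN : 1 ≤ N) (hh : IsESET ε f τ K N M u0 h) {n : ℕ}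
    (hn : n ∈ Finset.Icc 1 K) (hu : IsPrim (((n : ℝ) - 1) * τ) (n * τ) u du) :
    rho τ N M u h n ∈ tpoly (N + 1) (PM0 Ω M) := by
  have e : rho τ N M u h n = h n - fun t =>
      O.P (timeProj N (((n : ℝ) - 1) * τ) (n * τ) u t) := by
    ext1 t
    exact O.rho_eq hτ hN hu t
  rw [e]
  exact Submodule.sub_mem _ (isTimePoly_iff.1 (hh n hn).1)
    (map_mem_tpoly (timeProj_mem (by nlinarith) hN hu) O.P.toLinearMap
      fun w _ => (O.isSpaceProj w).1)

/-- The projection in time interpolates at both ends, so `ρ` at a node is the nodal value minus `P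
u`. Neighbouring intervals share this value, and their energy estimates telescope. -/
lemma rho_left (hτ : 0 < τ) (hN : 1 ≤ N) (hh : IsESET ε f τ K N M u0 h) {n : ℕ}
    (hn : n ∈ Finset.Icc 1 K) (hu : IsPrim (((n : ℝ) - 1) * τ) (n * τ) u du) :
    rho τ N M u h n (((n : ℝ) - 1) * τ) =
      nodal τ u0 h (n - 1) - O.P (u (((n : ℝ) - 1) * τ)) := by
  rw [O.rho_eq hτ hN hu, timeProj_left (by nlinarith) hN hu, (hh n hn).2.1]

lemma rho_right (hτ : 0 < τ) (hN : 1 ≤ N) {n : ℕ} (hn : 1 ≤ n)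
    (hu : IsPrim (((n : ℝ) - 1) * τ) (n * τ) u du) :
    rho τ N M u h n (n * τ) = nodal τ u0 h n - O.P (u (n * τ)) := by
  rw [O.rho_eq hτ hN hu, timeProj_right (by nlinarith) hN hu]
  obtain ⟨m, rfl⟩ := Nat.exists_eq_add_of_le' hn
  rfl

end SpaceOps

/-- Everything about the time grid and the solution that the error analysis uses. -/
structure GridSolution (ε : ℝ) (f : ℝ → ℝ) (T τ L : ℝ) (N K : ℕ) (u du : ℝ → H01 Ω) : Prop where
  eps_pos : 0 < ε
  L_pos : 0 < L
  tau_pos : 0 < τ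
  tau_mul : (K : ℝ) * τ = T
  one_le : 1 ≤ N
  isWeakSolution : IsWeakSolution ε f T u
  isPrim : IsPrim 0 T u du

namespace GridSolution

variable {ε T τ : ℝ} {N K : ℕ} {u du : ℝ → H01 Ω}

lemma interval_bounds {τ T : ℝ} (hτ : 0 < τ) (hT : (K : ℝ) * τ = T) {n : ℕ}
    (hn : n ∈ Finset.Icc 1 K) :
    0 ≤ ((n : ℝ) - 1) * τ ∧ ((n : ℝ) - 1) * τ < n * τ ∧ n * τ ≤ T := by
  rw [Finset.mem_Icc] at hn
  have h1 : (1 : ℝ) ≤ n := by exact_mod_cast hn.1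
  have h2 : (n : ℝ) ≤ K := by exact_mod_cast hn.2
  refine ⟨mul_nonneg (by linarith) hτ.le, by nlinarith, ?_⟩
  rw [← hT]
  gcongr

lemma isPrim_interval
    (G : GridSolution ε f T τ L N K u du) {n : ℕ} (hn : n ∈ Finset.Icc 1 K) :
    IsPrim (((n : ℝ) - 1) * τ) (n * τ) u du :=
  have h := interval_bounds G.tau_pos G.tau_mul hn
  G.isPrim.mono h.1 h.2.1.le h.2.2

/-- The energy estimate for one step of the scheme. -/
lemma energy_le
    (G : GridSolution ε f T τ L N K u du) (O : SpaceOps Ω f L M) {u0 : H01 Ω} {h : ℕ → ℝ → H01 Ω}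
    (hh : IsESET ε f τ K N M u0 h) {n : ℕ} (hn : n ∈ Finset.Icc 1 K) :
    energy ε L (rho τ N M u h n (n * τ)) + (ε / (4 * L) - 36 * τ ^ 2 * L / (5 * ε)) *
        (∫ t in (((n : ℝ) - 1) * τ)..(n * τ), ‖val (deriv (rho τ N M u h n) t)‖ ^ 2) ≤
      Real.exp (8 * L / ε * τ) * energy ε L (rho τ N M u h n (((n : ℝ) - 1) * τ))
        + ε / L * Ep ε L τ N M u n := by
  have hb := interval_bounds G.tau_pos G.tau_mul hn
  have hu := G.isPrim_interval hn
  have h1 := O.energy_step (ε := ε) (N := N) G.eps_pos G.L_pos hb.2.1 G.one_le hu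
    (fun w hw => O.integral_weakIntegrand_of_isWeakSolution G.isWeakSolution G.isPrim
      hb.1 hb.2.1.le hb.2.2 hw)
    (isTimePoly_iff.1 (hh n hn).1) (fun w hw => O.integral_weakIntegrand_of_isESET hh hn hw)
    (O.rho_eq G.tau_pos G.one_le hu) (O.rho_mem G.tau_pos G.one_le hh hn hu)
  rw [← Ep_eq O G.tau_pos G.one_le hu] at h1
  have e : (n : ℝ) * τ - ((n : ℝ) - 1) * τ = τ := by ring
  rw [e] at h1
  refine h1.trans ?_
  have h2 : 1 + 8 * L / ε * τ ≤ Real.exp (8 * L / ε * τ) := by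
    linarith [Real.add_one_le_exp (8 * L / ε * τ)]
  have h3 := energy_nonneg (ε := ε) G.L_pos (rho τ N M u h n (((n : ℝ) - 1) * τ))
  gcongr

lemma tau_sq_le
    (G : GridSolution ε f T τ L N K u du) (hτ : τ ≤ ε / (4 * √2 * L)) : 32 * τ ^ 2 * L ^ 2 ≤ ε ^ 2 := by
  have hL := G.L_pos
  have h1 : τ * (4 * √2 * L) ≤ ε := (le_div_iff₀ (by positivity)).1 hτ
  have h2 : 0 ≤ τ * (4 * √2 * L) := by have := G.tau_pos; positivity
  have h3 : (τ * (4 * √2 * L)) ^ 2 ≤ ε ^ 2 := by gcongr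
  have h4 : (τ * (4 * √2 * L)) ^ 2 = 32 * τ ^ 2 * L ^ 2 := by
    have := Real.sq_sqrt (zero_le_two (α := ℝ))
    linear_combination 16 * τ ^ 2 * L ^ 2 * this
  linarith

/-- The error inequality, with a slightly larger factor in front of `‖ρ_t‖²`. -/
lemma energy_add_sum_le
    (G : GridSolution ε f T τ L N K u du) (O : SpaceOps Ω f L M) {h : ℕ → ℝ → H01 Ω}
    (hh : IsESET ε f τ K N M (spaceProj M (u 0)) h) {D : ℝ} (hD : 0 ≤ D)
    (hD' : D ≤ ε / (4 * L) - 36 * τ ^ 2 * L / (5 * ε)) {n : ℕ} (hn : n ≤ K) :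
    energy ε L (nodal τ (spaceProj M (u 0)) h n - O.P (u (n * τ))) +
      ∑ k ∈ Finset.Icc 1 n, D *
        (∫ t in (((k : ℝ) - 1) * τ)..(k * τ), ‖val (deriv (rho τ N M u h k) t)‖ ^ 2) ≤
      ∑ k ∈ Finset.Icc 1 n, Real.exp (8 * L / ε * ((n : ℝ) - k) * τ) *
        (ε / L * Ep ε L τ N M u k) := by
  have hL := G.L_pos
  have hε := G.eps_pos
  have hτ := G.tau_pos
  -- In terms of nodal values the case `n = 0` makes sense, and its error is zero because the scheme
  -- starts at `P u(0)`.
  induction n with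
  | zero =>
    have e1 : val (0 : H01 Ω) = 0 := rfl
    have e2 : grad (0 : H01 Ω) = 0 := rfl
    simp [nodal, O.spaceProj_eq, energy, e1, e2]
  | succ m ih =>
    have ih := ih (by omega)
    have hn1 : m + 1 ∈ Finset.Icc 1 K := Finset.mem_Icc.2 ⟨by omega, hn⟩
    have h1 := G.energy_le O hh hn1
    have hu := G.isPrim_interval hn1
    rw [O.rho_right (u0 := spaceProj M (u 0)) hτ G.one_le (by omega) hu,
      O.rho_left hτ G.one_le hh hn1 hu] at h1
    have e0 : (((m + 1 : ℕ) : ℝ) - 1) * τ = m * τ := by push_cast; ring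
    rw [e0, Nat.add_sub_cancel] at h1
    rw [Finset.sum_Icc_succ_top (by omega), Finset.sum_Icc_succ_top (by omega), e0]
    set I := fun k : ℕ => ∫ t in (((k : ℝ) - 1) * τ)..(k * τ),
      ‖val (deriv (rho τ N M u h k) t)‖ ^ 2 with hI
    have hI0 : ∀ k, 0 ≤ I k := fun k =>
      intervalIntegral.integral_nonneg (by nlinarith) fun t _ => sq_nonneg _
    have hIm : ∫ t in (m * τ)..((m + 1 : ℕ) * τ),
        ‖val (deriv (rho τ N M u h (m + 1)) t)‖ ^ 2 = I (m + 1) := by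
      rw [hI]; simp only [e0]
    rw [hIm] at h1 ⊢
    set q := Real.exp (8 * L / ε * τ) with hq
    have hq1 : 1 ≤ q := Real.one_le_exp (by positivity)
    have h2 : D * I (m + 1) ≤ (ε / (4 * L) - 36 * τ ^ 2 * L / (5 * ε)) * I (m + 1) :=
      mul_le_mul_of_nonneg_right hD' (hI0 _)
    have h3 : 0 ≤ ∑ k ∈ Finset.Icc 1 m, D * I k :=
      Finset.sum_nonneg fun k _ => mul_nonneg hD (hI0 k)
    have h4 := mul_le_mul_of_nonneg_left ih (Real.exp_pos (8 * L / ε * τ)).le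
    rw [← hq, mul_add, Finset.mul_sum (Finset.Icc 1 m) _ q] at h4
    have h5 : ∑ k ∈ Finset.Icc 1 m, Real.exp (8 * L / ε * (((m + 1 : ℕ) : ℝ) - k) * τ) *
        (ε / L * Ep ε L τ N M u k) =
        ∑ k ∈ Finset.Icc 1 m, q * (Real.exp (8 * L / ε * ((m : ℝ) - k) * τ) *
        (ε / L * Ep ε L τ N M u k)) := by
      refine Finset.sum_congr rfl fun k _ => ?_
      have e : Real.exp (8 * L / ε * (((m + 1 : ℕ) : ℝ) - k) * τ) =
          q * Real.exp (8 * L / ε * ((m : ℝ) - k) * τ) := by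
        rw [hq, ← Real.exp_add]
        congr 1
        push_cast
        ring
      rw [e, mul_assoc]
    -- The induction hypothesis is multiplied by `q ≥ 1`; its sum of derivatives may be reduced
    -- again because `D ≥ 0`.
    have h6 : ∑ k ∈ Finset.Icc 1 m, D * I k ≤ q * ∑ k ∈ Finset.Icc 1 m, D * I k :=
      le_mul_of_one_le_left h3 hq1
    rw [h5, sub_self, mul_zero, zero_mul, Real.exp_zero, one_mul]
    rw [← Finset.mul_sum (Finset.Icc 1 m) _ q] at h4 ⊢
    linarith

lemma Ep_nonneg (hτ : 0 < τ) (hL : 0 < L) (hε : 0 < ε) (n : ℕ) : 0 ≤ Ep ε L τ N M u n := by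
  have hab : ((n : ℝ) - 1) * τ ≤ n * τ := by nlinarith
  refine add_nonneg (add_nonneg ?_ ?_) ?_ <;>
  exact mul_nonneg (by positivity) (intervalIntegral.integral_nonneg hab fun t _ => sq_nonneg _)

/-- The error inequality. -/
lemma errLHS_le
    (G : GridSolution ε f T τ L N K u du) (O : SpaceOps Ω f L M) {h : ℕ → ℝ → H01 Ω}
    (hh : IsESET ε f τ K N M (spaceProj M (u 0)) h) (hτ : τ ≤ ε / (4 * √2 * L)) {n : ℕ}
    (hn : n ∈ Finset.Icc 1 K) :
    errLHS ε L τ N M u h n ≤ ∑ k ∈ Finset.Icc 1 n, Real.exp (8 * L / ε * ((n : ℝ) - k) * τ) *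
      (ε / L * Ep ε L τ N M u k) := by
  have hL := G.L_pos
  have hε := G.eps_pos
  have h0 := G.tau_sq_le hτ
  have hn' := Finset.mem_Icc.1 hn
  -- This is exactly the step size condition: `D_τ ≥ 0` means `32 τ² L² ≤ ε²`.
  have hD : 0 ≤ ε / (4 * L) - 8 * τ ^ 2 * L / ε := by
    rw [sub_nonneg, div_le_div_iff₀ hε (by positivity)]
    linarith
  have hD' : ε / (4 * L) - 8 * τ ^ 2 * L / ε ≤ ε / (4 * L) - 36 * τ ^ 2 * L / (5 * ε) := by
    have : 36 * τ ^ 2 * L / (5 * ε) ≤ 8 * τ ^ 2 * L / ε := by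
      rw [div_le_div_iff₀ (by positivity) hε]
      have : 0 ≤ τ ^ 2 * L * ε := by positivity
      linarith
    linarith
  refine le_trans (le_of_eq ?_) (G.energy_add_sum_le O hh hD hD' hn'.2)
  rw [← O.rho_right G.tau_pos G.one_le hn'.1 (G.isPrim_interval hn), errLHS, energy]

/-- The error at the nodes and the time derivatives of the error. -/
lemma energy_le_and_integral_le
    (G : GridSolution ε f T τ L N K u du) (O : SpaceOps Ω f L M) {h : ℕ → ℝ → H01 Ω}
    (hh : IsESET ε f τ K N M (spaceProj M (u 0)) h) (hτ : τ ≤ ε / (4 * √2 * L)) {E : ℝ}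
    (hE : ∀ n ∈ Finset.Icc 1 K, Ep ε L τ N M u n ≤ τ * E) (hE0 : 0 ≤ E) {n : ℕ}
    (hn : n ∈ Finset.Icc 1 K) :
    energy ε L (rho τ N M u h n (((n : ℝ) - 1) * τ)) ≤
      Real.exp (8 * L / ε * T) * (ε / L * (T * E)) ∧
    ε / (40 * L) *
      (∫ t in (((n : ℝ) - 1) * τ)..(n * τ), ‖val (deriv (rho τ N M u h n) t)‖ ^ 2) ≤
      Real.exp (8 * L / ε * T) * (ε / L * (T * E)) := by
  have hL := G.L_pos
  have hε := G.eps_pos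
  have hτ0 := G.tau_pos
  have h0 := G.tau_sq_le hτ
  have hn' := Finset.mem_Icc.1 hn
  have hD : 0 ≤ ε / (40 * L) := by positivity
  -- With `32 τ² L² ≤ ε²` the subtracted term is at most `(36/5) / 32 = 9/40` of `ε / L`, and `1/4 -
  -- 9/40 = 1/40`. The factor stays positive even where `D_τ = 0`.
  have hD' : ε / (40 * L) ≤ ε / (4 * L) - 36 * τ ^ 2 * L / (5 * ε) := by
    have e : ε / (4 * L) - ε / (40 * L) = 9 * ε / (40 * L) := by field_simp; norm_num
    have : 36 * τ ^ 2 * L / (5 * ε) ≤ 9 * ε / (40 * L) := by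
      rw [div_le_div_iff₀ (by positivity) (by positivity)]
      nlinarith
    linarith
  have hbound : ∀ m ≤ K, ∑ k ∈ Finset.Icc 1 m, Real.exp (8 * L / ε * ((m : ℝ) - k) * τ) *
      (ε / L * Ep ε L τ N M u k) ≤ Real.exp (8 * L / ε * T) * (ε / L * (T * E)) := by
    intro m hm
    have hmT : (m : ℝ) * τ ≤ T := by
      rw [← G.tau_mul]
      have : (m : ℝ) ≤ K := by exact_mod_cast hm
      gcongr
    have h1 : ∀ k ∈ Finset.Icc 1 m, Real.exp (8 * L / ε * ((m : ℝ) - k) * τ) *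
        (ε / L * Ep ε L τ N M u k) ≤ Real.exp (8 * L / ε * T) * (ε / L * (τ * E)) := by
      intro k hk
      rw [Finset.mem_Icc] at hk
      have hkE := hE k (Finset.mem_Icc.2 ⟨hk.1, hk.2.trans hm⟩)
      have hE1 := Ep_nonneg (N := N) (M := M) (u := u) hτ0 hL hε k
      have hexp : 8 * L / ε * ((m : ℝ) - k) * τ ≤ 8 * L / ε * T := by
        rw [mul_assoc]
        refine mul_le_mul_of_nonneg_left ?_ (by positivity)
        have : 0 ≤ (k : ℝ) * τ := by positivity
        linarith
      gcongr
    refine (Finset.sum_le_sum h1).trans ?_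
    rw [Finset.sum_const, Nat.card_Icc, Nat.add_sub_cancel, nsmul_eq_mul]
    calc (m : ℝ) * (Real.exp (8 * L / ε * T) * (ε / L * (τ * E)))
        = Real.exp (8 * L / ε * T) * (ε / L * (m * τ * E)) := by ring
      _ ≤ _ := by gcongr
  set I := fun k : ℕ => ∫ t in (((k : ℝ) - 1) * τ)..(k * τ),
      ‖val (deriv (rho τ N M u h k) t)‖ ^ 2 with hI
  have hI0 : ∀ k, 0 ≤ I k := fun k =>
    intervalIntegral.integral_nonneg (by nlinarith) fun t _ => sq_nonneg _
  constructor
  · have h1 := G.energy_add_sum_le O hh hD hD' (n := n - 1) (by omega)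
    have h2 : 0 ≤ ∑ k ∈ Finset.Icc 1 (n - 1), ε / (40 * L) * I k :=
      Finset.sum_nonneg fun k _ => mul_nonneg hD (hI0 k)
    rw [O.rho_left hτ0 G.one_le hh hn (G.isPrim_interval hn)]
    have e : ((n - 1 : ℕ) : ℝ) = (n : ℝ) - 1 := by
      rw [Nat.cast_sub hn'.1, Nat.cast_one]
    have h3 := hbound (n - 1) (by omega)
    rw [e] at h1 h3
    linarith
  · have h1 := G.energy_add_sum_le O hh hD hD' hn'.2
    have h2 : ε / (40 * L) * I n ≤ ∑ k ∈ Finset.Icc 1 n, ε / (40 * L) * I k :=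
      Finset.single_le_sum (f := fun k => ε / (40 * L) * I k)
        (fun k _ => mul_nonneg hD (hI0 k)) (Finset.mem_Icc.2 ⟨hn'.1, le_rfl⟩)
    have h3 := energy_nonneg (ε := ε) hL
      (nodal τ (spaceProj M (u 0)) h n - O.P (u (n * τ)))
    have h4 := hbound n hn'.2
    linarith

end GridSolution

end Scheme

/-! ### Approximation of smooth functions in time, and the reproducing kernel. -/

section Approximation

variable {X Y : Type*} [NormedAddCommGroup X] [NormedSpace ℝ X] [CompleteSpace X]
  [NormedAddCommGroup Y] [NormedSpace ℝ Y] [CompleteSpace Y] {T a b : ℝ}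

lemma isPrim_derivWithin (hT : 0 < T) {g : ℝ → X} (hg : ContDiffOn ℝ 1 g (Icc 0 T)) :
    IsPrim 0 T g (derivWithin g (Icc 0 T)) := by
  have hc : ContinuousOn (derivWithin g (Icc 0 T)) (Icc 0 T) :=
    hg.continuousOn_derivWithin (uniqueDiffOn_Icc hT) le_rfl
  refine ⟨?_, fun t ht => ?_⟩
  · obtain ⟨C, hC⟩ := (isCompact_Icc (a := (0 : ℝ)) (b := T)).exists_bound_of_continuousOn hc
    refine MemLp.of_bound ((hc.mono Ioc_subset_Icc_self).aestronglyMeasurable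
      measurableSet_Ioc) C ?_
    filter_upwards [ae_restrict_mem measurableSet_Ioc] with x hx
    exact hC x (Ioc_subset_Icc_self hx)
  · have hs : Icc 0 t ⊆ Icc 0 T := Icc_subset_Icc_right ht.2
    rw [intervalIntegral.integral_eq_sub_of_hasDerivAt_of_le ht.1 (f := g)]
    · abel
    · exact hg.continuousOn.mono hs
    · intro x hx
      have hx' : Icc 0 T ∈ nhds x := Icc_mem_nhds hx.1 (hx.2.trans_le ht.2)
      exact ((hg.differentiableOn one_ne_zero x (hs (Ioo_subset_Icc_self hx))).hasDerivWithinAt).hasDerivAt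
        hx'
    · refine ContinuousOn.intervalIntegrable ?_
      rw [uIcc_of_le ht.1]
      exact hc.mono hs

/-- Approximation of a smooth function by polynomials in time. -/
lemma exists_tpoly_approx (hT : 0 < T) (ha : 0 ≤ a) (hab : a ≤ b) (hb : b ≤ T) (Λ : X →L[ℝ] Y)
    {C : ℝ} (m : ℕ) : ∀ g : ℝ → X, ContDiffOn ℝ m g (Icc 0 T) →
      (∀ t ∈ Icc 0 T, ‖Λ (iteratedDerivWithin m g (Icc 0 T) t)‖ ≤ C) →
      ∃ p ∈ tpoly m (⊤ : Submodule ℝ X), ∀ t ∈ Icc a b, ‖Λ (g t - p t)‖ ≤ C * (b - a) ^ m := by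
  induction m with
  | zero =>
    intro g _ hC
    refine ⟨0, Submodule.zero_mem _, fun t ht => ?_⟩
    simpa using hC t ⟨ha.trans ht.1, ht.2.trans hb⟩
  | succ m ih =>
    intro g hg hC
    have hu := uniqueDiffOn_Icc hT
    have hC0 : 0 ≤ C := (norm_nonneg _).trans (hC 0 ⟨le_rfl, hT.le⟩)
    have hg' : ContDiffOn ℝ m (derivWithin g (Icc 0 T)) (Icc 0 T) :=
      hg.derivWithin hu (by norm_cast)
    obtain ⟨p, hp, hpC⟩ := ih _ hg' fun t ht => by
      rw [← iteratedDerivWithin_succ']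
      exact hC t ht
    have hprim := (isPrim_derivWithin hT (hg.of_le (by simp))).mono ha hab hb
    -- Integrating the approximation of `g'` from `a` and adding `g a` builds the Taylor polynomial
    -- at `a`. Only the image of the highest derivative under `Λ` has to be bounded.
    refine ⟨(fun _ => g a) + fun t => ∫ s in a..t, p s,
      Submodule.add_mem _ (const_mem_tpoly (Nat.succ_pos _) trivial) (integral_mem_tpoly hp a),
      fun t ht => ?_⟩
    have hi := (hprim.mono le_rfl ht.1 ht.2).intervalIntegrable ht.1
    have hpi := (continuous_of_tpoly hp).intervalIntegrable (μ := volume) a t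
    rw [Pi.add_apply, hprim.2 t ht, add_sub_add_left_eq_sub,
      ← intervalIntegral.integral_sub hi hpi, ← Λ.intervalIntegral_comp_comm (hi.sub hpi)]
    have h1 := intervalIntegral.norm_integral_le_of_norm_le_const (a := a) (b := t)
      (f := fun s => Λ (derivWithin g (Icc 0 T) s - p s)) (C := C * (b - a) ^ m) fun s hs => by
        rw [uIoc_of_le ht.1] at hs
        exact hpC s ⟨hs.1.le, hs.2.trans ht.2⟩
    refine h1.trans ?_
    rw [abs_of_nonneg (sub_nonneg.2 ht.1), pow_succ, ← mul_assoc]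
    have : 0 ≤ b - a := sub_nonneg.2 hab
    have h2 : t - a ≤ b - a := by linarith [ht.2]
    gcongr

variable {Y : Type*} [NormedAddCommGroup Y] [InnerProductSpace ℝ Y] [CompleteSpace Y]

/-- The error of the projection in time. -/
lemma norm_map_timeProj_sub_le (hT : 0 < T) (ha : 0 ≤ a) (hab : a < b) (hb : b ≤ T) {N : ℕ}
    (hN : 1 ≤ N) {u : ℝ → X} (hu : ContDiffOn ℝ ((N + 1 : ℕ) : WithTop ℕ∞) u (Icc 0 T))
    (Λ : X →L[ℝ] Y) {C : ℝ}
    (hC : ∀ t ∈ Icc 0 T, ‖Λ (iteratedDerivWithin (N + 1) u (Icc 0 T) t)‖ ≤ C)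
    {t : ℝ} (ht : t ∈ Icc a b) :
    ‖Λ (timeProj N a b u t - u t)‖ ≤ C * (b - a) ^ (N + 1) := by
  have hud := uniqueDiffOn_Icc hT
  have hC0 : 0 ≤ C := (norm_nonneg _).trans (hC 0 ⟨le_rfl, hT.le⟩)
  have hprim := (isPrim_derivWithin hT (hu.of_le (by simp))).mono ha hab.le hb
  obtain ⟨p, hp, hpC⟩ := exists_tpoly_approx hT ha hab.le hb Λ N (derivWithin u (Icc 0 T))
    (hu.derivWithin hud (by norm_cast)) fun t ht => by
      rw [← iteratedDerivWithin_succ']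
      exact hC t ht
  have hba : 0 ≤ b - a := (sub_pos.2 hab).le
  have h1 := norm_map_timeProj_sub_sq_le hab hN hprim Λ hp ht
  have hm : MemLp (fun s => Λ (derivWithin u (Icc 0 T) s - p s)) 2 (volume.restrict (Ioc a b)) :=
    Λ.comp_memLp' (hprim.1.sub (memLp_Ioc_of_continuous (continuous_of_tpoly hp)))
  have h2 : ∫ s in a..b, ‖Λ (derivWithin u (Icc 0 T) s - p s)‖ ^ 2 ≤
      ∫ s in a..b, (C * (b - a) ^ N) ^ 2 := by
    refine intervalIntegral.integral_mono_on hab.le (memLp_intervalIntegrable_norm_sq hab.le hm)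
      intervalIntegrable_const fun s hs => ?_
    have := hpC s hs
    gcongr
  rw [intervalIntegral.integral_const, smul_eq_mul] at h2
  have h3 : ‖Λ (timeProj N a b u t - u t)‖ ^ 2 ≤ (C * (b - a) ^ (N + 1)) ^ 2 := by
    -- Approximating `u_t` gives `C (b - a)^N`. One factor `b - a` comes from Cauchy-Schwarz and one
    -- from the length of the interval, which raises the exponent by one after taking roots.
    refine h1.trans ((mul_le_mul_of_nonneg_left h2 hba).trans (le_of_eq ?_))
    ring
  exact le_of_sq_le_sq h3 (by positivity)

/-- A kernel that reproduces polynomials in time from their moments. -/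
lemma exists_kernel (N : ℕ) : ∃ C : ℝ, 0 ≤ C ∧ ∀ a b : ℝ, a < b → ∀ t ∈ Icc a b,
    ∃ k ∈ tpoly N (⊤ : Submodule ℝ ℝ), (∀ s ∈ Icc a b, |k s| ≤ C / (b - a)) ∧
      ∀ g ∈ tpoly (N + 1) (⊤ : Submodule ℝ ℝ), ∫ s in a..b, k s * (g s - g a) = g t - g a := by
  -- The weight `x` on `[0, 1]` is chosen because `G(x) - G(0)` is `x` times a polynomial of degree
  -- less than `N`.
  let e : Fin N → ℝ → ℝ := dualMonomial 0 1 id N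
  have hec : ∀ i, Continuous (e i) := fun i => continuous_dualMonomial i
  have hbd : ∀ i, ∃ C, ∀ x ∈ Icc (0 : ℝ) 1, ‖e i x‖ ≤ C := fun i =>
    isCompact_Icc.exists_bound_of_continuousOn (hec i).continuousOn
  choose B hB using hbd
  refine ⟨∑ i, |B i|, Finset.sum_nonneg fun i _ => abs_nonneg _, fun a b hab t ht => ?_⟩
  have hba : 0 < b - a := sub_pos.2 hab
  have hdual := integral_dualMonomial_mul (m := N) zero_lt_one (η := id) continuous_id
    (fun s hs => hs.1) (fun s hs => hs.1)
  set θ := (t - a) / (b - a) with hθ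
  have hθ0 : 0 ≤ θ := div_nonneg (by linarith [ht.1]) hba.le
  have hθ1 : θ ≤ 1 := (div_le_one hba).2 (by linarith [ht.2])
  -- Pairing `G - G(0)` with `e i` extracts the coefficient of `x^(i+1)`, and the weights `θ^(i+1)`
  -- reassemble `G(θ) - G(0)`.
  let k0 : ℝ → ℝ := fun x => ∑ i : Fin N, θ ^ ((i : ℕ) + 1) * e i x
  have hk0 : k0 ∈ tpoly N (⊤ : Submodule ℝ ℝ) := by
    have : k0 = ∑ i : Fin N, θ ^ ((i : ℕ) + 1) • e i := by
      ext x; simp [k0]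
    rw [this]
    exact sum_mem fun i _ => Submodule.smul_mem _ _ (dualMonomial_mem i)
  have hk0c : Continuous k0 := continuous_of_tpoly hk0
  have hrep : ∀ G ∈ tpoly (N + 1) (⊤ : Submodule ℝ ℝ),
      ∫ x in (0 : ℝ)..1, k0 x * (G x - G 0) = G θ - G 0 := by
    rintro G ⟨c, -, hG⟩
    have hG' : ∀ x, G x - G 0 = ∑ j : Fin N, c (j + 1) * (x * x ^ (j : ℕ)) := by
      intro x
      rw [hG, hG, Finset.sum_range_succ', Finset.sum_range_succ', Finset.sum_range,
        Finset.sum_range]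
      simp [pow_succ, mul_comm]
    have hexp : ∀ x, k0 x * (G x - G 0) = ∑ i : Fin N, ∑ j : Fin N,
        θ ^ ((i : ℕ) + 1) * c (j + 1) * (e i x * (x * x ^ (j : ℕ))) := by
      intro x
      rw [hG', Finset.sum_mul_sum]
      exact Finset.sum_congr rfl fun i _ => Finset.sum_congr rfl fun j _ => by ring
    simp_rw [hexp]
    rw [intervalIntegral.integral_finsetSum
      (fun i _ => (Continuous.intervalIntegrable (by have := hec i; fun_prop) _ _)), hG']
    refine Finset.sum_congr rfl fun i _ => ?_
    rw [intervalIntegral.integral_finsetSum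
      (fun j _ => (Continuous.intervalIntegrable (by have := hec i; fun_prop) _ _))]
    simp_rw [intervalIntegral.integral_const_mul]
    have : ∀ j : Fin N, ∫ x in (0 : ℝ)..1, e i x * (x * x ^ (j : ℕ)) = if i = j then 1 else 0 :=
      fun j => hdual i j
    simp_rw [this]
    simp [pow_succ, mul_comm]
  have haff : ∀ s, (s - a) / (b - a) = (b - a)⁻¹ * s + (-(a / (b - a))) := fun s => by ring
  -- The affine change of variables contributes `(b - a)⁻¹`; since `θ ∈ [0, 1]`, the remaining bound
  -- depends only on `N`.
  refine ⟨(b - a)⁻¹ • fun s => k0 ((s - a) / (b - a)), ?_, ?_, ?_⟩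
  · simp_rw [haff]
    exact Submodule.smul_mem _ _ (comp_affine_mem_tpoly hk0 _ _)
  · intro s hs
    have hx0 : 0 ≤ (s - a) / (b - a) := div_nonneg (by linarith [hs.1]) hba.le
    have hx1 : (s - a) / (b - a) ≤ 1 := (div_le_one hba).2 (by linarith [hs.2])
    rw [Pi.smul_apply, smul_eq_mul, abs_mul, abs_of_pos (inv_pos.2 hba),
      div_eq_inv_mul (∑ i, |B i|)]
    refine mul_le_mul_of_nonneg_left ?_ (inv_pos.2 hba).le
    refine (Finset.abs_sum_le_sum_abs _ _).trans (Finset.sum_le_sum fun i _ => ?_)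
    rw [abs_mul, abs_of_nonneg (pow_nonneg hθ0 _)]
    calc θ ^ ((i : ℕ) + 1) * |e i ((s - a) / (b - a))| ≤ 1 * |B i| := by
          refine mul_le_mul (pow_le_one₀ hθ0 hθ1) ?_ (abs_nonneg _) zero_le_one
          exact (hB i _ ⟨hx0, hx1⟩).trans (le_abs_self _)
      _ = |B i| := one_mul _
  · intro g hg
    have h1 := hrep (fun x => g ((b - a) * x + a)) (comp_affine_mem_tpoly hg _ _)
    have e1 : (b - a) * θ + a = t := by rw [hθ, mul_div_cancel₀ _ hba.ne']; ring
    simp only [mul_zero, zero_add, e1] at h1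
    rw [← h1]
    have h2 := intervalIntegral.integral_comp_mul_add (a := 0) (b := 1)
      (fun s => k0 ((s - a) / (b - a)) * (g s - g a)) hba.ne' a
    have e2 : ∀ x, ((b - a) * x + a - a) / (b - a) = x := fun x => by
      rw [add_sub_cancel_right, mul_div_cancel_left₀ _ hba.ne']
    simp only [e2, mul_zero, zero_add, mul_one, sub_add_cancel, smul_eq_mul] at h2
    rw [h2, ← intervalIntegral.integral_const_mul]
    simp [mul_assoc]

end Approximation

/-! ### The gradient of the error between the nodes. -/

section InteriorEstimate

variable {d : ℕ} {Ω : Set (Sp d)} {f : ℝ → ℝ} {L : ℝ} {M : ℕ}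

/-- The square of a sum of four terms is at most four times the sum of squares. For the three
projection errors `4` is relaxed to `6`, so that they form the consistency error `Ep`. -/
lemma SpaceOps.integral_norm_residual_sq_le (O : SpaceOps Ω f L M) {ε a b : ℝ} {N : ℕ}
    {u du h ρ : ℝ → H01 Ω} (hε : 0 < ε) (hL : 0 < L) (hab : a < b) (hN : 1 ≤ N)
    (hu : IsPrim a b u du) (hh : h ∈ tpoly (N + 1) (PM0 Ω M))
    (hρ : ∀ t, ρ t = h t - O.P (timeProj N a b u t)) (hρc : Continuous ρ) :
    ∫ t in a..b, ‖O.residual ε N a b u h t‖ ^ 2 ≤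
      (6 * (∫ t in a..b, ‖val (O.P (deriv (timeProj N a b u) t) -
          deriv (timeProj N a b u) t)‖ ^ 2)
      + 6 * ε ^ 2 * (∫ t in a..b, ‖O.Λ (timeProj N a b u t - u t)‖ ^ 2)
      + 6 * L ^ 2 / ε ^ 2 * (∫ t in a..b, ‖val (O.P (timeProj N a b u t) - u t)‖ ^ 2))
      + 4 * L ^ 2 / ε ^ 2 * ∫ t in a..b, ‖val (ρ t)‖ ^ 2 := by
  obtain ⟨k1, k2, k3⟩ := O.continuousOn_timeProj_terms hab hN hu
  have kR := O.continuousOn_residual (ε := ε) hL hab hN hu hh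
  have ii : ∀ {g : ℝ → ℝ}, ContinuousOn g (Icc a b) → IntervalIntegrable g volume a b := by
    intro g hg
    refine ContinuousOn.intervalIntegrable ?_
    rwa [uIcc_of_le hab.le]
  have m0 : IntervalIntegrable (fun t => ‖O.residual ε N a b u h t‖ ^ 2) volume a b :=
    ii (kR.norm.pow 2)
  have m1 : IntervalIntegrable (fun t => ‖val (O.P (deriv (timeProj N a b u) t) -
          deriv (timeProj N a b u) t)‖ ^ 2) volume a b := (k1.pow 2).intervalIntegrable _ _
  have m2 : IntervalIntegrable (fun t => ‖O.Λ (timeProj N a b u t - u t)‖ ^ 2) volume a b :=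
    ii (k2.pow 2)
  have m3 : IntervalIntegrable (fun t => ‖val (O.P (timeProj N a b u t) - u t)‖ ^ 2) volume a b :=
    ii (k3.pow 2)
  have m4 : IntervalIntegrable (fun t => ‖val (ρ t)‖ ^ 2) volume a b :=
    ((continuous_val hρc).norm.pow 2).intervalIntegrable _ _
  have key : ∫ t in a..b, ‖O.residual ε N a b u h t‖ ^ 2 ≤
      ∫ t in a..b, (6 * ‖val (O.P (deriv (timeProj N a b u) t) -
          deriv (timeProj N a b u) t)‖ ^ 2
        + 6 * ε ^ 2 * ‖O.Λ (timeProj N a b u t - u t)‖ ^ 2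
        + 6 * L ^ 2 / ε ^ 2 * ‖val (O.P (timeProj N a b u t) - u t)‖ ^ 2
        + 4 * L ^ 2 / ε ^ 2 * ‖val (ρ t)‖ ^ 2) := by
    refine intervalIntegral.integral_mono_on hab.le m0 ((((m1.const_mul _).add
      (m2.const_mul _)).add (m3.const_mul _)).add (m4.const_mul _)) fun t _ => ?_
    have hr := O.norm_residual_le (ε := ε) hε hL N a b u h t
    rw [← hρ] at hr
    set A := ‖val (O.P (deriv (timeProj N a b u) t) - deriv (timeProj N a b u) t)‖
    set B := ‖O.Λ (timeProj N a b u t - u t)‖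
    set D := ‖val (O.P (timeProj N a b u t) - u t)‖
    set r := ‖val (ρ t)‖
    have h1 : ‖O.residual ε N a b u h t‖ ^ 2 ≤ (A + ε * B + L / ε * (D + r)) ^ 2 := by gcongr
    have e1 : 6 * L ^ 2 / ε ^ 2 * D ^ 2 = 6 * (L / ε * D) ^ 2 := by ring
    have e2 : 4 * L ^ 2 / ε ^ 2 * r ^ 2 = 4 * (L / ε * r) ^ 2 := by ring
    rw [e1, e2]
    refine h1.trans ?_
    rw [mul_add]
    set D' := L / ε * D
    set r' := L / ε * r
    nlinarith [sq_nonneg (A - ε * B), sq_nonneg (A - D'), sq_nonneg (A - r'),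
      sq_nonneg (ε * B - D'), sq_nonneg (ε * B - r'), sq_nonneg (D' - r'), sq_nonneg A,
      sq_nonneg (ε * B), sq_nonneg D']
  rw [intervalIntegral.integral_add (((m1.const_mul _).add (m2.const_mul _)).add
      (m3.const_mul _)) (m4.const_mul _),
    intervalIntegral.integral_add ((m1.const_mul _).add (m2.const_mul _)) (m3.const_mul _),
    intervalIntegral.integral_add (m1.const_mul _) (m2.const_mul _),
    intervalIntegral.integral_const_mul, intervalIntegral.integral_const_mul,
    intervalIntegral.integral_const_mul, intervalIntegral.integral_const_mul] at key
  exact key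

/-- The gradient of the error inside a time interval is controlled by its value at the left end
point, the time derivative and the right-hand side of the error equation. -/
lemma norm_grad_sub_sq_le {ε : ℝ} (hε : 0 < ε) {N : ℕ} {a b t : ℝ} (hab : a < b)
    (ht : t ∈ Icc a b) {C : ℝ} (hC : 0 ≤ C) {k : ℝ → ℝ}
    (hk : k ∈ tpoly N (⊤ : Submodule ℝ ℝ)) (hkC : ∀ s ∈ Icc a b, |k s| ≤ C / (b - a))
    (hrep : ∀ g ∈ tpoly (N + 1) (⊤ : Submodule ℝ ℝ), ∫ s in a..b, k s * (g s - g a) = g t - g a)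
    {S : Submodule ℝ (H01 Ω)} {ρ : ℝ → H01 Ω} (hρ : ρ ∈ tpoly (N + 1) S) {R : ℝ → L2 Ω}
    (hR : ContinuousOn R (Icc a b))
    (heq : ∀ w ∈ tpoly N S, ∫ s in a..b, (⟪val (deriv ρ s), val (w s)⟫_ℝ +
      ε * ⟪grad (ρ s), grad (w s)⟫_ℝ) = ∫ s in a..b, ⟪R s, val (w s)⟫_ℝ) :
    ε / 2 * ‖grad (ρ t - ρ a)‖ ^ 2 ≤
      C * ((∫ s in a..b, ‖R s‖ ^ 2) + 3 / 2 * ∫ s in a..b, ‖val (deriv ρ s)‖ ^ 2)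
        + ε / 2 * (C ^ 2 * ‖grad (ρ a)‖ ^ 2) := by
  have hba : 0 < b - a := sub_pos.2 hab
  set v := ρ t - ρ a with hv
  have hvS : v ∈ S := S.sub_mem (eval_mem_of_tpoly hρ t) (eval_mem_of_tpoly hρ a)
  have hkc := continuous_of_tpoly hk
  have cρ := continuous_of_tpoly hρ
  have cρ' := continuous_val (continuous_of_tpoly (deriv_mem_tpoly hρ))
  have ii : ∀ {g : ℝ → ℝ}, ContinuousOn g (Icc a b) → IntervalIntegrable g volume a b := by
    intro g hg
    refine ContinuousOn.intervalIntegrable ?_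
    rwa [uIcc_of_le hab.le]
  -- The test function `k(s) v` with `v = ρ(t) - ρ(a)`: by the reproducing property, its gradient
  -- term yields `‖∇v‖²` up to the contribution of `∇ρ(a)`.
  have h1 := heq _ (smul_const_mem_tpoly hk hvS)
  have e1 : ∀ s, val (k s • v) = k s • val v := fun s => rfl
  have e2 : ∀ s, grad (k s • v) = k s • grad v := fun s => rfl
  simp only [e1, e2, real_inner_smul_right] at h1
  have hg := hrep (fun s => ⟪grad (ρ s), grad v⟫_ℝ) (by
    have := map_mem_tpoly hρ ((innerSL ℝ (grad v)).comp gradL).toLinearMap (S' := ⊤)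
      fun _ _ => trivial
    have e : (fun s => ((innerSL ℝ (grad v)).comp gradL).toLinearMap (ρ s)) =
        fun s => ⟪grad (ρ s), grad v⟫_ℝ := by
      ext s
      exact real_inner_comm (grad (ρ s)) (grad v)
    rwa [e] at this)
  have e3 : ⟪grad (ρ t), grad v⟫_ℝ - ⟪grad (ρ a), grad v⟫_ℝ = ‖grad v‖ ^ 2 := by
    rw [← inner_sub_left, ← real_inner_self_eq_norm_sq]
    rfl
  rw [e3] at hg
  have j1 : IntervalIntegrable (fun s => k s * ⟪val (deriv ρ s), val v⟫_ℝ) volume a b :=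
    (hkc.mul (cρ'.inner continuous_const)).intervalIntegrable _ _
  have j2 : IntervalIntegrable (fun s => k s * ⟪grad (ρ s), grad v⟫_ℝ) volume a b :=
    (hkc.mul ((continuous_grad cρ).inner continuous_const)).intervalIntegrable _ _
  have j3 : IntervalIntegrable (fun s => k s * ⟪R s, val v⟫_ℝ) volume a b :=
    ii (hkc.continuousOn.mul (hR.inner continuousOn_const))
  have j4 : IntervalIntegrable k volume a b := hkc.intervalIntegrable _ _
  have h2 : ‖grad v‖ ^ 2 = (∫ s in a..b, k s * ⟪grad (ρ s), grad v⟫_ℝ) -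
      (∫ s in a..b, k s) * ⟪grad (ρ a), grad v⟫_ℝ := by
    rw [← hg, ← intervalIntegral.integral_mul_const,
      ← intervalIntegral.integral_sub j2 (j4.mul_const _)]
    congr 1
    ext s
    ring
  have h3 : ε * (∫ s in a..b, k s * ⟪grad (ρ s), grad v⟫_ℝ) =
      ∫ s in a..b, k s * (⟪R s, val v⟫_ℝ - ⟪val (deriv ρ s), val v⟫_ℝ) := by
    rw [intervalIntegral.integral_add j1 (j2.const_mul _),
      intervalIntegral.integral_const_mul] at h1
    simp_rw [mul_sub]
    rw [intervalIntegral.integral_sub j3 j1, ← h1]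
    ring
  have hv2 : ‖val v‖ ^ 2 ≤ (b - a) * ∫ s in a..b, ‖val (deriv ρ s)‖ ^ 2 := by
    have := ((isPrim_of_tpoly hρ a b).map valL).norm_sub_sq_le ht
    rw [← map_sub] at this
    exact this
  set R2 := ∫ s in a..b, ‖val (deriv ρ s)‖ ^ 2
  have m1 : IntervalIntegrable (fun s => ‖R s‖ ^ 2) volume a b := ii (hR.norm.pow 2)
  have m2 : IntervalIntegrable (fun s => ‖val (deriv ρ s)‖ ^ 2) volume a b :=
    (cρ'.norm.pow 2).intervalIntegrable _ _
  have h4 : ∫ s in a..b, k s * (⟪R s, val v⟫_ℝ - ⟪val (deriv ρ s), val v⟫_ℝ) ≤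
      ∫ s in a..b, C * (‖R s‖ ^ 2 + ‖val (deriv ρ s)‖ ^ 2 +
        1 / 2 * (‖val v‖ ^ 2 / (b - a) ^ 2)) := by
    refine intervalIntegral.integral_mono_on hab.le ?_ ?_ fun s hs => ?_
    · exact ii (hkc.continuousOn.mul ((hR.inner continuousOn_const).sub
        (cρ'.inner continuous_const).continuousOn))
    · exact ((m1.add m2).add intervalIntegrable_const).const_mul _
    · rw [← inner_sub_left]
      have p1 : k s * ⟪R s - val (deriv ρ s), val v⟫_ℝ ≤
          |k s| * ((‖R s‖ + ‖val (deriv ρ s)‖) * ‖val v‖) := by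
        refine (le_abs_self _).trans ?_
        rw [abs_mul]
        refine mul_le_mul_of_nonneg_left ?_ (abs_nonneg _)
        exact (abs_real_inner_le_norm _ _).trans
          (mul_le_mul_of_nonneg_right (norm_sub_le _ _) (norm_nonneg _))
      have p2 : |k s| * ((‖R s‖ + ‖val (deriv ρ s)‖) * ‖val v‖) ≤
          C / (b - a) * ((‖R s‖ + ‖val (deriv ρ s)‖) * ‖val v‖) :=
        mul_le_mul_of_nonneg_right (hkC s hs) (by positivity)
      refine p1.trans (p2.trans ?_)
      have e5 : C / (b - a) * ((‖R s‖ + ‖val (deriv ρ s)‖) * ‖val v‖) =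
          C * ((‖R s‖ + ‖val (deriv ρ s)‖) * (‖val v‖ / (b - a))) := by ring
      rw [e5, ← div_pow]
      refine mul_le_mul_of_nonneg_left ?_ hC
      nlinarith [sq_nonneg (‖R s‖ + ‖val (deriv ρ s)‖ - ‖val v‖ / (b - a)),
        sq_nonneg (‖R s‖ - ‖val (deriv ρ s)‖)]
  rw [intervalIntegral.integral_const_mul,
    intervalIntegral.integral_add (m1.add m2) intervalIntegrable_const,
    intervalIntegral.integral_add m1 m2, intervalIntegral.integral_const, smul_eq_mul] at h4
  -- The scaling is balanced here: the kernel costs `1 / (b - a)`, which is compensated by `‖v‖² ≤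
  -- (b - a) ∫ ‖ρ_t‖²`.
  have h5 : (b - a) * (1 / 2 * (‖val v‖ ^ 2 / (b - a) ^ 2)) ≤ 1 / 2 * R2 := by
    have e6 : (b - a) * (1 / 2 * (‖val v‖ ^ 2 / (b - a) ^ 2)) =
        1 / 2 * (‖val v‖ ^ 2 / (b - a)) := by field_simp
    rw [e6]
    have : ‖val v‖ ^ 2 / (b - a) ≤ R2 := by
      rw [div_le_iff₀ hba]; linarith
    linarith
  have h6 : |∫ s in a..b, k s| ≤ C := by
    have := intervalIntegral.norm_integral_le_of_norm_le_const (a := a) (b := b)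
      (f := k) (C := C / (b - a)) fun s hs => by
        rw [uIoc_of_le hab.le] at hs
        exact hkC s (Ioc_subset_Icc_self hs)
    rwa [abs_of_pos hba, div_mul_cancel₀ _ hba.ne'] at this
  have h7 : -((∫ s in a..b, k s) * ⟪grad (ρ a), grad v⟫_ℝ) ≤
      C * (‖grad (ρ a)‖ * ‖grad v‖) := by
    refine (neg_le_abs _).trans ?_
    rw [abs_mul]
    exact mul_le_mul h6 (abs_real_inner_le_norm _ _) (abs_nonneg _) hC
  have h8 : C * (‖grad (ρ a)‖ * ‖grad v‖) ≤
      1 / 2 * ‖grad v‖ ^ 2 + 1 / 2 * (C ^ 2 * ‖grad (ρ a)‖ ^ 2) := by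
    nlinarith [sq_nonneg (C * ‖grad (ρ a)‖ - ‖grad v‖)]
  have h9 : ε * ‖grad v‖ ^ 2 ≤ C * ((∫ s in a..b, ‖R s‖ ^ 2) + R2 + 1 / 2 * R2) +
      ε * (1 / 2 * ‖grad v‖ ^ 2 + 1 / 2 * (C ^ 2 * ‖grad (ρ a)‖ ^ 2)) := by
    have q1 : C * ((∫ s in a..b, ‖R s‖ ^ 2) + R2 +
        (b - a) * (1 / 2 * (‖val v‖ ^ 2 / (b - a) ^ 2))) ≤
        C * ((∫ s in a..b, ‖R s‖ ^ 2) + R2 + 1 / 2 * R2) := by gcongr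
    have q2 := mul_le_mul_of_nonneg_left (h7.trans h8) hε.le
    have q3 : ε * ‖grad v‖ ^ 2 = ε * (∫ s in a..b, k s * ⟪grad (ρ s), grad v⟫_ℝ) +
        ε * -((∫ s in a..b, k s) * ⟪grad (ρ a), grad v⟫_ℝ) := by rw [h2]; ring
    rw [q3, h3]
    linarith
  -- Half of `ε ‖∇v‖²` is absorbed by the left side.
  linarith

end InteriorEstimate

/-! ### Convergence rates from the accuracy of the projection in space. -/

section Rates

variable {d : ℕ} {Ω : Set (Sp d)} {f : ℝ → ℝ} {L : ℝ}

lemma norm_grad_le (w : H01 Ω) : ‖grad w‖ ≤ ‖w‖ :=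
  le_of_sq_le_sq (by rw [norm_sq_eq_val_add_grad]; nlinarith [sq_nonneg ‖val w‖]) (norm_nonneg _)

/-- The error of the space-time projection. -/
lemma SpaceOps.norm_proj_sub_le {M : ℕ} (O : SpaceOps Ω f L M) {T c r B Cp a b : ℝ} {N : ℕ}
    {u : ℝ → H01 Ω} (hT : 0 < T) (hN : 1 ≤ N)
    (hu : ContDiffOn ℝ ((N + 1 : ℕ) : WithTop ℕ∞) u (Icc 0 T))
    (hacc : SpaceAccuracy T c r N M u) (hCp0 : 0 ≤ Cp) (hCp : ∀ w : H01 Ω, ‖val w‖ ≤ Cp * ‖grad w‖)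
    (hB : ∀ t ∈ Icc 0 T, ‖iteratedDerivWithin (N + 1) u (Icc 0 T) t‖ ≤ B)
    (ha : 0 ≤ a) (hab : a < b) (hb : b ≤ T) {t : ℝ} (ht : t ∈ Icc a b) :
    ‖val (O.P (timeProj N a b u t) - u t)‖ ≤
      Cp * (B * (b - a) ^ (N + 1)) + c * (M : ℝ) ^ (-r) ∧
    ‖grad (O.P (timeProj N a b u t) - u t)‖ ≤
      B * (b - a) ^ (N + 1) + c * (M : ℝ) ^ (-r) := by
  have hacc' := hacc t ⟨ha.trans ht.1, ht.2.trans hb⟩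
  rw [O.spaceProj_eq] at hacc'
  have h1 := norm_map_timeProj_sub_le hT ha hab hb hN hu (gradL (Ω := Ω))
    (fun t ht => (norm_grad_le _).trans (hB t ht)) ht
  rw [gradL_apply] at h1
  have h2 := ((O.isSpaceProj (timeProj N a b u t - u t)).norm_grad_le).trans h1
  -- The error in time is placed under `P`, whose gradient is a contraction. Its `L²`-norm is then
  -- bounded through Poincaré, since no bound of `P` in `L²` is available.
  have e : O.P (timeProj N a b u t) - u t =
      O.P (timeProj N a b u t - u t) + (O.P (u t) - u t) := by rw [map_sub]; abel
  have e1 : ∀ v w : H01 Ω, val (v + w) = val v + val w := fun _ _ => rfl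
  have e2 : ∀ v w : H01 Ω, grad (v + w) = grad v + grad w := fun _ _ => rfl
  rw [e, e1, e2]
  refine ⟨(norm_add_le _ _).trans (add_le_add ((hCp _).trans ?_) hacc'.1),
    (norm_add_le _ _).trans (add_le_add h2 hacc'.2.1)⟩
  exact mul_le_mul_of_nonneg_left h2 hCp0

/-- The consistency error on one time interval. -/
lemma Ep_le_of_spaceAccuracy {M : ℕ} (O : SpaceOps Ω f L M) {ε T τ c r B Cp : ℝ} {N K n : ℕ}
    {u : ℝ → H01 Ω} (hε : 0 < ε) (hL : 0 < L) (hT : 0 < T) (hN : 1 ≤ N)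
    (hu : ContDiffOn ℝ ((N + 1 : ℕ) : WithTop ℕ∞) u (Icc 0 T))
    (hacc : SpaceAccuracy T c r N M u) (hCp0 : 0 ≤ Cp) (hCp : ∀ w : H01 Ω, ‖val w‖ ≤ Cp * ‖grad w‖)
    (hB : ∀ t ∈ Icc 0 T, ‖iteratedDerivWithin (N + 1) u (Icc 0 T) t‖ ≤ B)
    (hτ : 0 < τ) (hK : (K : ℝ) * τ = T) (hn : n ∈ Finset.Icc 1 K) :
    Ep ε L τ N M u n ≤ τ * (((6 + 12 * L ^ 2 / ε ^ 2) * c ^ 2 + 6 * ε ^ 2 * c ^ 2 +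
      12 * L ^ 2 / ε ^ 2 * (Cp * B) ^ 2) *
      (((M : ℝ) ^ (-r)) ^ 2 + (τ ^ (N + 1)) ^ 2)) := by
  obtain ⟨ha, hab, hb⟩ := GridSolution.interval_bounds hτ hK hn
  have hprim := (isPrim_derivWithin hT (hu.of_le (by simp))).mono ha hab.le hb
  rw [Ep_eq O hτ hN hprim]
  obtain ⟨k1, k2, k3⟩ := O.continuousOn_timeProj_terms hab hN hprim
  set a := ((n : ℝ) - 1) * τ
  set b := (n : ℝ) * τ
  have hba : b - a = τ := by simp only [a, b]; ring
  set σ := (M : ℝ) ^ (-r)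
  set κ := τ ^ (N + 1)
  have hsub : Icc a b ⊆ Icc 0 T := Icc_subset_Icc ha hb
  have ii : ∀ {g : ℝ → ℝ}, ContinuousOn g (Icc a b) → IntervalIntegrable g volume a b := by
    intro g hg
    refine ContinuousOn.intervalIntegrable ?_
    rwa [uIcc_of_le hab.le]
  have hconst : ∀ {g : ℝ → ℝ} {D : ℝ}, IntervalIntegrable (fun t => g t ^ 2) volume a b →
      (∀ t ∈ Icc a b, 0 ≤ g t) → (∀ t ∈ Icc a b, g t ≤ D) →
      ∫ t in a..b, g t ^ 2 ≤ τ * D ^ 2 := by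
    intro g D hg h0 hD
    have h := intervalIntegral.integral_mono_on hab.le hg (g := fun _ => D ^ 2)
      intervalIntegrable_const fun t ht => pow_le_pow_left₀ (h0 t ht) (hD t ht) 2
    rwa [intervalIntegral.integral_const, smul_eq_mul, hba] at h
  have h1 : ∫ t in a..b, ‖val (O.P (deriv (timeProj N a b u) t) -
      deriv (timeProj N a b u) t)‖ ^ 2 ≤ τ * (c * σ) ^ 2 := by
    -- As `P - id` commutes with the `L²`-projection in time, which does not increase norms, the
    -- accuracy assumption on `u_t` suffices.
    let Λ : H01 Ω →L[ℝ] L2 Ω := valL.comp (O.P - ContinuousLinearMap.id ℝ (H01 Ω))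
    have e : ∀ w, val (O.P w - w) = Λ w := fun w => rfl
    have hi := hprim.intervalIntegrable hab.le
    simp_rw [e, deriv_timeProj hab hN hprim, map_polyProj hi Λ]
    refine (integral_norm_polyProj_sq_le hab (Λ.comp_memLp' hprim.1)).trans ?_
    refine hconst (memLp_intervalIntegrable_norm_sq hab.le (Λ.comp_memLp' hprim.1))
      (fun t _ => norm_nonneg _) fun t ht => ?_
    have := (hacc t (hsub ht)).2.2.1
    rwa [O.spaceProj_eq] at this
  have h2 : ∫ t in a..b, ‖O.Λ (timeProj N a b u t - u t)‖ ^ 2 ≤ τ * (c * κ) ^ 2 := by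
    refine hconst (ii (k2.pow 2)) (fun t _ => norm_nonneg _) fun t ht => ?_
    have := norm_map_timeProj_sub_le hT ha hab hb hN hu O.Λ (C := c) (fun t ht => by
      have := (hacc t ht).2.2.2
      rwa [O.spaceProj_eq, O.lap_eq] at this) ht
    rwa [hba] at this
  have h3 : ∫ t in a..b, ‖val (O.P (timeProj N a b u t) - u t)‖ ^ 2 ≤
      τ * (Cp * (B * κ) + c * σ) ^ 2 := by
    refine hconst (ii (k3.pow 2)) (fun t _ => norm_nonneg _) fun t ht => ?_
    have := (O.norm_proj_sub_le hT hN hu hacc hCp0 hCp hB ha hab hb ht).1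
    rwa [hba] at this
  have h4 : (Cp * (B * κ) + c * σ) ^ 2 ≤ 2 * ((Cp * B) ^ 2 * κ ^ 2) + 2 * (c ^ 2 * σ ^ 2) := by
    nlinarith [sq_nonneg (Cp * (B * κ) - c * σ)]
  have h5 : 6 * L ^ 2 / ε ^ 2 * (∫ t in a..b, ‖val (O.P (timeProj N a b u t) - u t)‖ ^ 2) ≤
      6 * L ^ 2 / ε ^ 2 * (τ * (2 * ((Cp * B) ^ 2 * κ ^ 2) + 2 * (c ^ 2 * σ ^ 2))) := by
    refine mul_le_mul_of_nonneg_left (h3.trans ?_) (by positivity)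
    exact mul_le_mul_of_nonneg_left h4 hτ.le
  have h6 : 6 * ε ^ 2 * (∫ t in a..b, ‖O.Λ (timeProj N a b u t - u t)‖ ^ 2) ≤
      6 * ε ^ 2 * (τ * (c * κ) ^ 2) := by gcongr
  -- Surplus terms: the stated bound multiplies both `σ²` and `κ²` by the full constant.
  have p1 : 0 ≤ τ * ((6 + 12 * L ^ 2 / ε ^ 2) * c ^ 2) * κ ^ 2 := by positivity
  have p2 : 0 ≤ τ * (6 * ε ^ 2 * c ^ 2) * σ ^ 2 := by positivity
  have p3 : 0 ≤ τ * (12 * L ^ 2 / ε ^ 2 * (Cp * B) ^ 2) * σ ^ 2 := by positivity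
  have e7 : τ * (((6 + 12 * L ^ 2 / ε ^ 2) * c ^ 2 + 6 * ε ^ 2 * c ^ 2 +
      12 * L ^ 2 / ε ^ 2 * (Cp * B) ^ 2) * (σ ^ 2 + κ ^ 2)) =
      6 * (τ * (c * σ) ^ 2) + 6 * ε ^ 2 * (τ * (c * κ) ^ 2) +
      6 * L ^ 2 / ε ^ 2 * (τ * (2 * ((Cp * B) ^ 2 * κ ^ 2) + 2 * (c ^ 2 * σ ^ 2))) +
      τ * ((6 + 12 * L ^ 2 / ε ^ 2) * c ^ 2) * κ ^ 2 + τ * (6 * ε ^ 2 * c ^ 2) * σ ^ 2 +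
      τ * (12 * L ^ 2 / ε ^ 2 * (Cp * B) ^ 2) * σ ^ 2 := by ring
  rw [e7]
  linarith

/-- The difference between the discrete solution and the projection, at all times. -/
lemma GridSolution.exists_norm_rho_le (ε L T : ℝ) (N : ℕ) (hε : 0 < ε) (hL : 0 < L)
    (hT : 0 < T) : ∃ C : ℝ, 0 ≤ C ∧ ∀ {τ : ℝ} {K M : ℕ} {u du : ℝ → H01 Ω},
      GridSolution ε f T τ L N K u du → ∀ (_ : SpaceOps Ω f L M) {h : ℕ → ℝ → H01 Ω},
      IsESET ε f τ K N M (spaceProj M (u 0)) h → τ ≤ ε / (4 * √2 * L) → ∀ {E : ℝ}, 0 ≤ E →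
      (∀ n ∈ Finset.Icc 1 K, Ep ε L τ N M u n ≤ τ * E) → ∀ n ∈ Finset.Icc 1 K,
      ∀ t ∈ Icc (((n : ℝ) - 1) * τ) (n * τ),
      ‖val (rho τ N M u h n t)‖ + ‖grad (rho τ N M u h n t)‖ ≤ C * √E := by
  obtain ⟨Ck, hCk, hker⟩ := exists_kernel N
  -- Up to the factor `E`: `w` bounds the energy at the left end, `r` the integral of `‖ρ_t‖²`, `i`
  -- that of the squared residual, `γ` the term `‖∇ρ(a)‖²`, and `g` the term `‖∇(ρ(t) - ρ(a))‖²`.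
  -- All are fixed before `τ`, `K` and `M`.
  set w := Real.exp (8 * L / ε * T) * (ε / L * T) with hw
  have hw0 : 0 ≤ w := by positivity
  set r := 40 * L / ε * w with hr
  have hr0 : 0 ≤ r := by positivity
  set i := T + 4 * L ^ 2 / ε ^ 2 * (T * (2 * w + 2 * (T * r))) with hi
  have hi0 : 0 ≤ i := by positivity
  set γ := 2 * L / ε ^ 2 * w with hγ
  have hγ0 : 0 ≤ γ := by positivity
  set g := 2 / ε * (Ck * (i + 3 / 2 * r)) + Ck ^ 2 * γ with hg
  have hg0 : 0 ≤ g := by positivity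
  refine ⟨√w + √(T * r) + (√γ + √g), by positivity, ?_⟩
  intro τ K M u du G O h hh hτ E hE0 hE n hn t ht
  have hτ0 := G.tau_pos
  have hprim := G.isPrim_interval hn
  obtain ⟨ha, hab, hb⟩ := interval_bounds hτ0 G.tau_mul hn
  have hτT : τ ≤ T := by nlinarith
  obtain ⟨h1, h2⟩ := G.energy_le_and_integral_le O hh hτ hE hE0 hn
  have hρ := O.rho_eq (N := N) (h := h) (n := n) hτ0 G.one_le hprim
  have hρm := O.rho_mem hτ0 G.one_le hh hn hprim
  have hEp := hE n hn
  rw [Ep_eq O hτ0 G.one_le hprim] at hEp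
  obtain ⟨k, hk, hkC, hrep⟩ := hker _ _ hab t ht
  have hhm := isTimePoly_iff.1 (hh n hn).1
  have hgrad := norm_grad_sub_sq_le hε hab ht hCk hk hkC hrep hρm
    (O.continuousOn_residual (ε := ε) hL hab G.one_le hprim hhm)
    fun v hv => O.error_equation (ε := ε) hL hab G.one_le hprim
      (fun v hv => O.integral_weakIntegrand_of_isWeakSolution G.isWeakSolution G.isPrim
        ha hab.le hb hv) hhm (fun v hv => O.integral_weakIntegrand_of_isESET hh hn hv) hρ hv
  have hres := O.integral_norm_residual_sq_le hε hL hab G.one_le hprim hhm hρ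
    (continuous_of_tpoly hρm)
  have hval := integral_norm_val_sq_le hρm hab.le
  have hv := ((isPrim_of_tpoly hρm (((n : ℝ) - 1) * τ) (n * τ)).map valL).norm_sub_sq_le ht
  simp only [valL_apply] at hv
  set ρ := rho τ N M u h n
  set a := ((n : ℝ) - 1) * τ
  set b := (n : ℝ) * τ
  have hba : b - a = τ := by simp only [a, b]; ring
  rw [hba] at hval hv
  set R2 := ∫ s in a..b, ‖val (deriv ρ s)‖ ^ 2
  set IR := ∫ s in a..b, ‖O.residual ε N a b u (h n) s‖ ^ 2
  have hR20 : 0 ≤ R2 := intervalIntegral.integral_nonneg hab.le fun s _ => sq_nonneg _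
  have hwE : Real.exp (8 * L / ε * T) * (ε / L * (T * E)) = w * E := by rw [hw]; ring
  rw [hwE] at h1 h2
  have hva : ‖val (ρ a)‖ ^ 2 ≤ w * E := by
    refine le_trans ?_ h1
    rw [energy, le_add_iff_nonneg_right]; positivity
  have hga : ‖grad (ρ a)‖ ^ 2 ≤ γ * E := by
    have h3 : ε ^ 2 / (2 * L) * ‖grad (ρ a)‖ ^ 2 ≤ w * E := by
      refine le_trans ?_ h1
      rw [energy, le_add_iff_nonneg_left]; positivity
    have h4 : 2 * L / ε ^ 2 * (ε ^ 2 / (2 * L) * ‖grad (ρ a)‖ ^ 2) ≤ 2 * L / ε ^ 2 * (w * E) := by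
      gcongr
    have e : 2 * L / ε ^ 2 * (ε ^ 2 / (2 * L) * ‖grad (ρ a)‖ ^ 2) = ‖grad (ρ a)‖ ^ 2 := by
      field_simp
    rw [e] at h4
    rw [hγ]; linarith
  have hR2 : R2 ≤ r * E := by
    have h4 : 40 * L / ε * (ε / (40 * L) * R2) ≤ 40 * L / ε * (w * E) := by gcongr
    have e : 40 * L / ε * (ε / (40 * L) * R2) = R2 := by field_simp
    rw [e] at h4
    rw [hr]; linarith
  have hτR : τ * R2 ≤ T * r * E := by
    calc τ * R2 ≤ T * (r * E) := by gcongr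
      _ = _ := by ring
  have hI : ∫ s in a..b, ‖val (ρ s)‖ ^ 2 ≤ T * (2 * w + 2 * (T * r)) * E := by
    refine hval.trans ?_
    calc τ * (2 * ‖val (ρ a)‖ ^ 2 + 2 * (τ * R2)) ≤ T * (2 * (w * E) + 2 * (T * r * E)) := by
          gcongr
      _ = _ := by ring
  have hIR : IR ≤ i * E := by
    have h5 : τ * E ≤ T * E := by gcongr
    have h6 : 4 * L ^ 2 / ε ^ 2 * (∫ s in a..b, ‖val (ρ s)‖ ^ 2) ≤
        4 * L ^ 2 / ε ^ 2 * (T * (2 * w + 2 * (T * r)) * E) := by gcongr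
    rw [hi]
    linarith
  have hgv : ‖grad (ρ t - ρ a)‖ ^ 2 ≤ g * E := by
    have h7 : ε / 2 * ‖grad (ρ t - ρ a)‖ ^ 2 ≤
        Ck * (i * E + 3 / 2 * (r * E)) + ε / 2 * (Ck ^ 2 * (γ * E)) :=
      hgrad.trans (by gcongr)
    have h8 : 2 / ε * (ε / 2 * ‖grad (ρ t - ρ a)‖ ^ 2) ≤
        2 / ε * (Ck * (i * E + 3 / 2 * (r * E)) + ε / 2 * (Ck ^ 2 * (γ * E))) := by gcongr
    have e1 : 2 / ε * (ε / 2 * ‖grad (ρ t - ρ a)‖ ^ 2) = ‖grad (ρ t - ρ a)‖ ^ 2 := by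
      field_simp
    have e2 : 2 / ε * (Ck * (i * E + 3 / 2 * (r * E)) + ε / 2 * (Ck ^ 2 * (γ * E))) = g * E := by
      rw [hg]; field_simp
    rwa [e1, e2] at h8
  have hsq : ∀ {x y : ℝ}, 0 ≤ y → x ^ 2 ≤ y * E → x ≤ √y * √E := by
    intro x y hy hx
    rw [← Real.sqrt_mul hy]
    exact Real.le_sqrt_of_sq_le hx
  have n1 : ‖val (ρ t)‖ ≤ ‖val (ρ a)‖ + ‖val (ρ t) - val (ρ a)‖ := by
    simpa using norm_add_le (val (ρ a)) (val (ρ t) - val (ρ a))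
  have n2 : ‖grad (ρ t)‖ ≤ ‖grad (ρ a)‖ + ‖grad (ρ t - ρ a)‖ := by
    have e : grad (ρ t - ρ a) = grad (ρ t) - grad (ρ a) := rfl
    rw [e]
    simpa using norm_add_le (grad (ρ a)) (grad (ρ t) - grad (ρ a))
  have q1 := hsq hw0 hva
  have q2 := hsq (by positivity) (hv.trans hτR)
  have q3 := hsq hγ0 hga
  have q4 := hsq hg0 hgv
  linarith

end Rates

end ESET

end

/-! ### Assembly of the error inequality and the rates. -/

theorem theorem3 (d : ℕ) (hd : 1 ≤ d) (Ω : Set (ESET.Sp d)) (hΩo : IsOpen Ω)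
    (hΩc : IsConnected Ω) (hΩb : Bornology.IsBounded Ω)
    (ε L T : ℝ) (hε : 0 < ε) (hT : 0 < T)
    (f : ℝ → ℝ) (hf : Differentiable ℝ f) (hL : ∀ s, |deriv f s| < L)
    (N : ℕ) (hN : 1 ≤ N)
    (u : ℝ → ESET.H01 Ω) (hu : ESET.IsWeakSolution ε f T u) :
    -- the error inequality
    (∀ (M K : ℕ) (τ : ℝ) (h : ℕ → ℝ → ESET.H01 Ω), 1 ≤ K → τ = T / K →
      τ ≤ ε / (4 * √2 * L) →
      ESET.IsESET ε f τ K N M (ESET.spaceProj M (u 0)) h →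
      ∀ n ∈ Finset.Icc 1 K,
        ESET.errLHS ε L τ N M u h n
          ≤ ∑ k ∈ Finset.Icc 1 n, Real.exp (8 * L / ε * ((n : ℝ) - k) * τ) *
              (ε / L * ESET.Ep ε L τ N M u k) ∧
        (ε ≤ L → ESET.errLHS ε L τ N M u h n
          ≤ ∑ k ∈ Finset.Icc 1 n, Real.exp (8 * L / ε * ((n : ℝ) - k) * τ) *
              ESET.Ep ε L τ N M u k)) ∧
    -- the rates
    (ContDiffOn ℝ ((N + 1 : ℕ) : WithTop ℕ∞) u (Set.Icc 0 T) →
      ∀ c r : ℝ, ∃ C : ℝ, ∀ (M K : ℕ) (τ : ℝ), 1 ≤ M → 1 ≤ K → τ = T / K →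
        ESET.SpaceAccuracy T c r N M u →
        (∀ n ∈ Finset.Icc 1 K,
          ESET.Ep ε L τ N M u n
            ≤ C * (τ * (M : ℝ) ^ (-(2 * r)) + τ ^ (2 * N + 3))) ∧
        (τ ≤ ε / (4 * √2 * L) →
          ∀ h : ℕ → ℝ → ESET.H01 Ω,
            ESET.IsESET ε f τ K N M (ESET.spaceProj M (u 0)) h →
            ∀ n ∈ Finset.Icc 1 K, ∀ t ∈ Set.Icc (((n : ℝ) - 1) * τ) (n * τ),
              ‖ESET.val (h n t - u t)‖ + ‖ESET.grad (h n t - u t)‖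
                ≤ C * ((M : ℝ) ^ (-r) + τ ^ (N + 1)))) := by
  have hL0 : 0 < L := (abs_nonneg _).trans_lt (hL 0)
  have hgrid : ∀ {K : ℕ} {τ : ℝ}, 1 ≤ K → τ = T / K → 0 < τ ∧ (K : ℝ) * τ = T := by
    intro K τ hK hτ
    have hK' : (0 : ℝ) < K := by exact_mod_cast hK
    rw [hτ]
    exact ⟨div_pos hT hK', mul_div_cancel₀ _ hK'.ne'⟩
  refine ⟨?_, ?_⟩
  · intro M K τ h hK hτ hτL hh n hn
    obtain ⟨O⟩ := ESET.nonempty_spaceOps hd hΩo hΩb hf hL M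
    obtain ⟨du, hdu⟩ := hu.1
    obtain ⟨hτ0, hKτ⟩ := hgrid hK hτ
    have G : ESET.GridSolution ε f T τ L N K u du := ⟨hε, hL0, hτ0, hKτ, hN, hu, hdu⟩
    have h1 := G.errLHS_le O hh hτL hn
    refine ⟨h1, fun hεL => h1.trans (Finset.sum_le_sum fun k _ => ?_)⟩
    have h2 := ESET.GridSolution.Ep_nonneg (N := N) (M := M) (u := u) hτ0 hL0 hε k
    refine mul_le_mul_of_nonneg_left ?_ (Real.exp_pos _).le
    exact mul_le_of_le_one_left h2 ((div_le_one hL0).2 hεL)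
  · intro hreg c r
    obtain ⟨Cp, hCp0, hCp⟩ := ESET.exists_poincare hd hΩb hΩo
    obtain ⟨B, hB⟩ := (isCompact_Icc (a := (0 : ℝ)) (b := T)).exists_bound_of_continuousOn
      (hreg.continuousOn_iteratedDerivWithin (m := N + 1) le_rfl (uniqueDiffOn_Icc hT))
    obtain ⟨Cρ, hCρ0, hCρ⟩ := ESET.GridSolution.exists_norm_rho_le (f := f) (Ω := Ω)
      ε L T N hε hL0 hT
    have hB0 : 0 ≤ B := (norm_nonneg _).trans (hB 0 ⟨le_rfl, hT.le⟩)
    set C1 := (6 + 12 * L ^ 2 / ε ^ 2) * c ^ 2 + 6 * ε ^ 2 * c ^ 2 +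
      12 * L ^ 2 / ε ^ 2 * (Cp * B) ^ 2
    have hC1 : 0 ≤ C1 := by positivity
    -- One constant serves both claims: `C1` for the consistency error, the second entry for the
    -- total error. Value and gradient each contribute one `|c|`; the absolute value is needed
    -- because `c` has no prescribed sign when the constant is chosen.
    refine ⟨max C1 (Cρ * √C1 + (Cp * B + B + 2 * |c|)), ?_⟩
    intro M K τ hM hK hτ hacc
    obtain ⟨hτ0, hKτ⟩ := hgrid hK hτ
    obtain ⟨O⟩ := ESET.nonempty_spaceOps hd hΩo hΩb hf hL M
    have hM0 : (0 : ℝ) < M := by exact_mod_cast hM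
    set σ := (M : ℝ) ^ (-r) with hσ
    set κ := τ ^ (N + 1) with hκ
    have hσ0 : 0 < σ := Real.rpow_pos_of_pos hM0 _
    have hκ0 : 0 < κ := pow_pos hτ0 _
    have hEp : ∀ n ∈ Finset.Icc 1 K, ESET.Ep ε L τ N M u n ≤ τ * (C1 * (σ ^ 2 + κ ^ 2)) :=
      fun n hn => ESET.Ep_le_of_spaceAccuracy O hε hL0 hT hN hreg hacc hCp0 hCp hB hτ0 hKτ hn
    constructor
    · intro n hn
      refine (hEp n hn).trans ?_
      have e1 : (M : ℝ) ^ (-(2 * r)) = σ ^ 2 := by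
        rw [hσ, ← Real.rpow_natCast, ← Real.rpow_mul hM0.le]
        congr 1
        push_cast
        ring
      have e2 : τ * (C1 * (σ ^ 2 + κ ^ 2)) = C1 * (τ * σ ^ 2 + τ ^ (2 * N + 3)) := by
        rw [hκ]; ring
      rw [e1, e2]
      gcongr
      exact le_max_left _ _
    · intro hτL h hh n hn t ht
      have G : ESET.GridSolution ε f T τ L N K u (derivWithin u (Icc 0 T)) :=
        ⟨hε, hL0, hτ0, hKτ, hN, hu, ESET.isPrim_derivWithin hT (hreg.of_le (by simp))⟩
      have h1 := hCρ G O hh hτL (by positivity) hEp n hn t ht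
      obtain ⟨ha, hab, hb⟩ := ESET.GridSolution.interval_bounds hτ0 hKτ hn
      obtain ⟨h2, h3⟩ := O.norm_proj_sub_le hT hN hreg hacc hCp0 hCp hB ha hab hb ht
      have hba : (n : ℝ) * τ - ((n : ℝ) - 1) * τ = τ := by ring
      rw [hba] at h2 h3
      have hsqrt : √(C1 * (σ ^ 2 + κ ^ 2)) ≤ √C1 * (σ + κ) := by
        rw [Real.sqrt_mul hC1]
        refine mul_le_mul_of_nonneg_left ?_ (Real.sqrt_nonneg _)
        refine Real.sqrt_le_iff.2 ⟨by positivity, ?_⟩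
        nlinarith [mul_pos hσ0 hκ0]
      have hρ := O.rho_eq (N := N) (h := h) (n := n) hτ0 hN (G.isPrim_interval hn) t
      set pu := O.P (ESET.timeProj N (((n : ℝ) - 1) * τ) (n * τ) u t)
      have e3 : h n t - u t = ESET.rho τ N M u h n t + (pu - u t) := by rw [hρ]; abel
      have h4 : ‖ESET.val (h n t - u t)‖ ≤
          ‖ESET.val (ESET.rho τ N M u h n t)‖ + ‖ESET.val (pu - u t)‖ := by
        rw [e3]; exact norm_add_le _ _
      have h5 : ‖ESET.grad (h n t - u t)‖ ≤
          ‖ESET.grad (ESET.rho τ N M u h n t)‖ + ‖ESET.grad (pu - u t)‖ := by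
        rw [e3]; exact norm_add_le _ _
      have h6 : Cρ * √(C1 * (σ ^ 2 + κ ^ 2)) ≤ Cρ * (√C1 * (σ + κ)) := by gcongr
      have h7 : c * σ ≤ |c| * σ := by gcongr; exact le_abs_self c
      have h8 : ‖ESET.val (h n t - u t)‖ + ‖ESET.grad (h n t - u t)‖ ≤
          (Cρ * √C1 + (Cp * B + B + 2 * |c|)) * (σ + κ) := by
        have p1 : 0 ≤ Cp * B * σ := by positivity
        have p2 : 0 ≤ B * σ := by positivity
        have p3 : 0 ≤ |c| * κ := by positivity
        nlinarith
      refine h8.trans ?_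
      gcongr
      exact le_max_right _ _
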